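/- **Setting.** For a locally integrable $u:\mathbb R\to\mathbb R$ put $\|u\|_{BS}=\sup_{t}\int_t^{t+1}|u|\,dx$, and let $BS(\mathbb R)$ be the space of those $u$ with $\|u\|_{BS}<\infty$. Such a $u$ is *Stepanov almost periodic* if every sequence of shifts $u(\cdot+z_k)$ has a subsequence converging in $BS(\mathbb R)$. For a Carathéodory function $g(x,u)$ (continuous in $u\in\mathbb R$ for a.e. $x\in\mathbb R$, measurable in $x$ for every $u$) put $\|g\|_R=\bigl\|\sup_{|u|\le R}|g(\cdot,u)|\bigr\|_{BS}$. Such a $g$ is *strictly Stepanov almost periodic* if $\|g\|_R<\infty$ for all $R>0$ and for every sequence $z_k$ there are a subsequence $z_{k'}$ and a Carathéodory function $\tilde g$ with $\|\tilde g\|_R<\infty$ and $\|g(\cdot+z_{k'},\cdot)-\tilde g\|_R\to0$ for all $R>0$. Let $\chi\in\{1,-1\}$, let $V:\mathbb R\to\mathbb R$ and $f:\mathbb R\times\mathbb R\to\mathbb R$, and put $F(x,u)=\int_0^u f(x,s)\,ds$. Assume: 1. $V$ is Stepanov almost periodic and $0\notin\sigma(L)$, where $L=-\frac{d^2}{dx^2}+V$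 is the self-adjoint operator in $L^2(\mathbb R)$ given by the form $(Lu,v)=\int_{\mathbb R}(u'v'+Vuv)\,dx$ on $H^1(\mathbb R)$; if $\chi=-1$, then moreover $\sigma(L)\cap(-\infty,0)\ne\emptyset$. 2. For a.e. $x$, $f(x,\cdot)$ is continuously differentiable; $F$, $f$ and $f_u$ are strictly Stepanov almost periodic; for every $u\neq0$ there is $c>0$ with $F(x,u)\ge c$ for a.e. $x$. 3. $f(x,0)=f_u(x,0)=0$ for a.e. $x$, and for every $R>0$ there is $\mu(R)>0$ such that for a.e. $x$: $|f_u(x,u)-f_u(x,v)|\le\mu(R)|u-v|$ whenever $|u|,|v|\le R$. 4. There is $\theta\in(0,1)$ such that for a.e. $x$: $0<f(x,u)u\le\theta f_u(x,u)u^2$ for all $u\ne0$. Let the *envelope* of $(V,f)$ be the closure of the set of shifts $\{(V(\cdot+z),f(\cdot+z,\cdot)):z\in\mathbb R\}$ in the topology given by the seminorms $\|V\|_{BS}+\|f_u\|_R$, $R>0$, among pairs $(W,g)$ with $W\in BS(\mathbb R)$ and $g$, $g_u$ Carathéodory functions such that, for a.e. $x$, $g(x,\cdot)$ is continuously differentiable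 with $g(x,0)=0$, and $\|g_u\|_R<\infty$ for all $R>0$. Write its elements as $(V_h,f_h)$, $h\in\mathcal H$, put $L_h=-\frac{d^2}{dx^2}+V_h$ and $F_h(x,u)=\int_0^uf_h(x,s)\,ds$, and let $$J_h(u)=\tfrac12(L_hu,u)-\chi\int_{\mathbb R}F_h(x,u(x))\,dx,\qquad u\in H^1(\mathbb R),$$ with $J$ the functional for $(V,f)$ itself. Let $E_h^{\pm}\subset H^1(\mathbb R)$ be the positive and negative spectral subspaces of $L_h$. If $\chi=1$, put $$\mathcal N_h=\{u\in H^1(\mathbb R)\setminus\{0\}:\ (J_h'(u),u)=0,\ (J_h'(u),v)=0\ \ \forall v\in E_h^-\},\qquad m_h=\inf_{\mathcal N_h}J_h .$$ If $\chi=-1$, replace $J_h$ by $-J_h$ and $E_h^-$ by $E_h^+$ in these definitions. Let $\mathcal N$ and $m$ be the same objects for $(V,f)$. **Proposition.** For every $h\in\mathcal H$ one has $m_h=m$ (as infima in the extended reals). -/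

import Mathlib

open MeasureTheory Set Filter Topology
open scoped ENNReal

noncomputable section

namespace NLS

/-! ### Stepanov spaces -/

/-- The uniform local mass `sup_t ∫_t^{t+1} p(x) dx` of a nonnegative function. -/
def uniformLocalMass (p : ℝ → ℝ≥0∞) : ℝ≥0∞ :=
  ⨆ t : ℝ, ∫⁻ x in Icc t (t + 1), p x

/-- The Stepanov norm `‖u‖_BS = sup_t ∫_t^{t+1} |u(x)| dx` (with value `∞` allowed). -/
def stepanovNorm (u : ℝ → ℝ) : ℝ≥0∞ :=
  uniformLocalMass fun x => ‖u x‖ₑ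

/-- The space `BS(ℝ)` of Stepanov bounded functions. -/
def StepanovBounded (u : ℝ → ℝ) : Prop :=
  LocallyIntegrable u ∧ stepanovNorm u < ⊤

/-- Stepanov almost periodicity: the set of shifts `u(· + z)` is precompact in `BS(ℝ)`. -/
def StepanovAP (u : ℝ → ℝ) : Prop :=
  StepanovBounded u ∧
    ∀ z : ℕ → ℝ, ∃ k : ℕ → ℕ, StrictMono k ∧ ∃ w : ℝ → ℝ, StepanovBounded w ∧
      Tendsto (fun n => stepanovNorm fun x => u (x + z (k n)) - w x) atTop (𝓝 0)

/-- Carathéodory functions `g(x,u)`. -/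
def IsCaratheodory (g : ℝ → ℝ → ℝ) : Prop :=
  (∀ᵐ x, Continuous (g x)) ∧ ∀ u, AEMeasurable fun x => g x u

/-- The seminorm `‖g‖_R`, the Stepanov norm of `x ↦ sup_{|u| ≤ R} |g(x,u)|`. -/
def stepanovSeminorm (R : ℝ) (g : ℝ → ℝ → ℝ) : ℝ≥0∞ :=
  uniformLocalMass fun x => ⨆ u ∈ Icc (-R) R, ‖g x u‖ₑ

/-- Strict Stepanov almost periodicity in `x` of a Carathéodory function `g(x,u)`. -/
def StrictlyStepanovAP (g : ℝ → ℝ → ℝ) : Prop :=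
  IsCaratheodory g ∧ (∀ R > 0, stepanovSeminorm R g < ⊤) ∧
    ∀ z : ℕ → ℝ, ∃ k : ℕ → ℕ, StrictMono k ∧ ∃ w : ℝ → ℝ → ℝ,
      IsCaratheodory w ∧ (∀ R > 0, stepanovSeminorm R w < ⊤) ∧
      ∀ R > 0, Tendsto
        (fun n => stepanovSeminorm R fun x u => g (x + z (k n)) u - w x u) atTop (𝓝 0)

/-! ### The Sobolev space `H¹(ℝ)` -/

/-- The real Hilbert space `L²(ℝ)`. -/
abbrev L2 : Type := Lp ℝ 2 (volume : Measure ℝ)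

/-- `g` is the weak derivative of `u`. -/
def HasWeakDeriv (u g : ℝ → ℝ) : Prop :=
  ∀ φ : ℝ → ℝ, ContDiff ℝ (⊤ : ℕ∞) φ → HasCompactSupport φ →
    ∫ x, u x * deriv φ x = -∫ x, g x * φ x

theorem integrable_mul_test (u : L2) {φ : ℝ → ℝ} (h : Continuous φ)
    (hc : HasCompactSupport φ) : Integrable fun x => u x * φ x := by
  have hu : LocallyIntegrable u :=
    (Lp.memLp u).locallyIntegrable (by norm_num)
  have := hu.integrable_smul_left_of_hasCompactSupport h hc
  refine this.congr (Eventually.of_forall fun x => ?_)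
  simp [mul_comm]

/-- `H¹(ℝ)`, realized as the graph `{(u, u')}` of the weak derivative inside the Hilbert sum
`L²(ℝ) ⊕ L²(ℝ)`. In particular it carries the graph norm `(‖u‖₂² + ‖u'‖₂²)^{1/2}`; since weak
derivatives are unique, an element is determined by its first component `u`. -/
def sobolevGraph : Submodule ℝ (WithLp 2 (L2 × L2)) where
  carrier := {p | HasWeakDeriv p.fst p.snd}
  zero_mem' := by
    intro φ hφ hc
    have h0 : (((0 : WithLp 2 (L2 × L2)).fst : L2) : ℝ → ℝ) =ᵐ[volume] 0 := Lp.coeFn_zero _ _ _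
    have h1 : (((0 : WithLp 2 (L2 × L2)).snd : L2) : ℝ → ℝ) =ᵐ[volume] 0 := Lp.coeFn_zero _ _ _
    rw [integral_eq_zero_of_ae, integral_eq_zero_of_ae, neg_zero]
    · filter_upwards [h1] with x hx
      rw [hx, Pi.zero_apply, zero_mul]
    · filter_upwards [h0] with x hx
      rw [hx, Pi.zero_apply, zero_mul]
  add_mem' := by
    intro p q hp hq φ hφ hc
    have hd : Continuous (deriv φ) := hφ.continuous_deriv (by simp)
    have e1 : ∫ x, (p + q).fst x * deriv φ x
        = ∫ x, (p.fst x * deriv φ x + q.fst x * deriv φ x) := by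
      refine integral_congr_ae ?_
      filter_upwards [Lp.coeFn_add p.fst q.fst] with x hx
      rw [WithLp.add_fst, hx, Pi.add_apply, add_mul]
    have e2 : ∫ x, (p + q).snd x * φ x = ∫ x, (p.snd x * φ x + q.snd x * φ x) := by
      refine integral_congr_ae ?_
      filter_upwards [Lp.coeFn_add p.snd q.snd] with x hx
      rw [WithLp.add_snd, hx, Pi.add_apply, add_mul]
    rw [e1, e2, integral_add (integrable_mul_test _ hd hc.deriv)
      (integrable_mul_test _ hd hc.deriv),
      integral_add (integrable_mul_test _ hφ.continuous hc)
      (integrable_mul_test _ hφ.continuous hc), hp φ hφ hc, hq φ hφ hc]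
    ring
  smul_mem' := by
    intro c p hp φ hφ hc
    have e1 : ∫ x, (c • p).fst x * deriv φ x = ∫ x, c * (p.fst x * deriv φ x) := by
      refine integral_congr_ae ?_
      filter_upwards [Lp.coeFn_smul c p.fst] with x hx
      rw [WithLp.smul_fst, hx, Pi.smul_apply, smul_eq_mul, mul_assoc]
    have e2 : ∫ x, (c • p).snd x * φ x = ∫ x, c * (p.snd x * φ x) := by
      refine integral_congr_ae ?_
      filter_upwards [Lp.coeFn_smul c p.snd] with x hx
      rw [WithLp.smul_snd, hx, Pi.smul_apply, smul_eq_mul, mul_assoc]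
    rw [e1, e2, integral_const_mul, integral_const_mul, hp φ hφ hc]
    ring

/-- The Sobolev space `H¹(ℝ)` with its graph norm. -/
abbrev H1 : Type := sobolevGraph

/-- The function `u ∈ L²(ℝ)` underlying an element of `H¹(ℝ)`. -/
def H1.toL2 (u : H1) : L2 := (u : WithLp 2 (L2 × L2)).fst

/-- The weak derivative `u' ∈ L²(ℝ)` of an element of `H¹(ℝ)`. -/
def H1.wderiv (u : H1) : L2 := (u : WithLp 2 (L2 × L2)).snd

/-! ### The Schrödinger operator `L = -d²/dx² + V` -/

/-- The quadratic form `(Lu,v) = ∫ u' v' dx + ∫ V u v dx` on `H¹(ℝ)`. -/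
def form (V : ℝ → ℝ) (u v : H1) : ℝ :=
  (∫ x, u.wderiv x * v.wderiv x) + ∫ x, V x * u.toL2 x * v.toL2 x

/-- The graph of the self-adjoint operator `L` of `L²(ℝ)` associated to the form: `u` is in the
domain of `L` and `L u = g`. -/
def OperatorGraph (V : ℝ → ℝ) (u g : L2) : Prop :=
  ∃ w : H1, w.toL2 = u ∧ ∀ v : H1, form V w v = inner ℝ g v.toL2

/-- The resolvent set of `L`: those `r` such that `L - r` has an everywhere defined bounded
inverse `B`, i.e. `(L - r) u = g ↔ u = B g`. As `L` is self-adjoint only real `r` matter, and for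
these it makes no difference whether real or complex `L²(ℝ)` is used. -/
def resolventSet (V : ℝ → ℝ) : Set ℝ :=
  {r | ∃ B : L2 →L[ℝ] L2, ∀ u g : L2, OperatorGraph V u (g + r • u) ↔ u = B g}

/-- The spectrum `σ(L)`. -/
def spectrum (V : ℝ → ℝ) : Set ℝ := (resolventSet V)ᶜ

/-- The splitting `H¹(ℝ) = E⁺ ⊕ E⁻` into the positive and the negative subspace of the form
`(Lu,u)`: it reduces `L` (it is orthogonal both in `L²(ℝ)` and for the form), and the form is
positive definite on `E⁺` and negative definite on `E⁻`. -/
structure IsSpectralSplitting (V : ℝ → ℝ) (Epos Eneg : Submodule ℝ H1) : Prop where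
  isCompl : IsCompl Epos Eneg
  orthogonal : ∀ u ∈ Epos, ∀ v ∈ Eneg, inner ℝ u.toL2 v.toL2 = 0
  form_orthogonal : ∀ u ∈ Epos, ∀ v ∈ Eneg, form V u v = 0
  pos : ∀ u ∈ Epos, u ≠ 0 → 0 < form V u u
  neg : ∀ u ∈ Eneg, u ≠ 0 → form V u u < 0

/-- The positive subspace `E⁺`. If `0 ∉ σ(L)` there is exactly one spectral splitting (given by
the spectral projectors of `L` for `(0,∞)` and `(-∞,0)`), so the supremum is over one element. -/
def posSubspace (V : ℝ → ℝ) : Submodule ℝ H1 :=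
  sSup {Epos | ∃ Eneg, IsSpectralSplitting V Epos Eneg}

/-- The negative subspace `E⁻`; see `posSubspace`. -/
def negSubspace (V : ℝ → ℝ) : Submodule ℝ H1 :=
  sSup {Eneg | ∃ Epos, IsSpectralSplitting V Epos Eneg}

/-! ### The nonlinearity, the functional, and the generalized Nehari manifold -/

/-- The primitive `F(x,u) = ∫_0^u f(x,s) ds`. -/
def primitive (f : ℝ → ℝ → ℝ) (x u : ℝ) : ℝ := ∫ s in (0 : ℝ)..u, f x s

/-- The partial derivative `f_u`. -/
def partialU (f : ℝ → ℝ → ℝ) (x u : ℝ) : ℝ := deriv (f x) u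

/-- The functional `J(u) = ½ (Lu,u) - χ ∫ F(x,u(x)) dx` on `H¹(ℝ)`. -/
def energy (χ : ℝ) (V : ℝ → ℝ) (f : ℝ → ℝ → ℝ) (u : H1) : ℝ :=
  1 / 2 * form V u u - χ * ∫ x, primitive f x (u.toL2 x)

/-- The subspace against which `J'(u)` has to vanish on the generalized Nehari manifold: `E⁻` if
`χ = 1`; if `χ = -1`, where `J` is replaced by `-J` and `E⁺`, `E⁻` are interchanged, it is `E⁺`. -/
def constraintSubspace (χ : ℝ) (V : ℝ → ℝ) : Submodule ℝ H1 :=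
  if χ = 1 then negSubspace V else posSubspace V

/-- The generalized Nehari manifold: all `u ≠ 0` such that `(J'(u),u) = 0` and `(J'(u),v) = 0`
for all `v ∈ E⁻` (all `v ∈ E⁺` if `χ = -1`), where `J'` is the Fréchet derivative. -/
def nehari (χ : ℝ) (V : ℝ → ℝ) (f : ℝ → ℝ → ℝ) : Set H1 :=
  {u | u ≠ 0 ∧ fderiv ℝ (energy χ V f) u u = 0 ∧
    ∀ v ∈ constraintSubspace χ V, fderiv ℝ (energy χ V f) u v = 0}

/-- The ground level `m`, the infimum of `J` (of `-J` if `χ = -1`) over the generalized Nehari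
manifold, taken in the extended reals so that it is a true infimum. -/
def groundLevel (χ : ℝ) (V : ℝ → ℝ) (f : ℝ → ℝ → ℝ) : EReal :=
  ⨅ u ∈ nehari χ V f, ((χ * energy χ V f u : ℝ) : EReal)

/-- `(W, g)` is in the envelope of `(V, f)`: it is a limit of shifts `(V(· + z), f(· + z, ·))` for
the topology given by the seminorms `‖V‖_BS + ‖f_u‖_R`, `R > 0`, on pairs of a Stepanov bounded
potential and a nonlinearity vanishing at `u = 0` whose derivative in `u` is a Carathéodory
function with finite seminorms. The topology has a countable base of neighbourhoods
(`R = 1, 2, …` suffice), so that sequences describe the closure. -/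
structure InEnvelope (V : ℝ → ℝ) (f : ℝ → ℝ → ℝ) (W : ℝ → ℝ) (g : ℝ → ℝ → ℝ) : Prop where
  potential : StepanovBounded W
  contDiff : ∀ᵐ x, ContDiff ℝ 1 (g x)
  measurable : IsCaratheodory g
  measurable_partialU : IsCaratheodory (partialU g)
  map_zero : ∀ᵐ x, g x 0 = 0
  bounded : ∀ R > 0, stepanovSeminorm R (partialU g) < ⊤
  limit : ∃ z : ℕ → ℝ,
    Tendsto (fun n => stepanovNorm fun x => V (x + z n) - W x) atTop (𝓝 0) ∧
    ∀ R > 0, Tendsto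
      (fun n => stepanovSeminorm R fun x u => partialU f (x + z n) u - partialU g x u)
      atTop (𝓝 0)

end NLS

end

/-! The ground level is invariant under translation of (V, f), so it is enough to compare levels
along shifts converging to (W, g). The comparison is a persistence argument: near every point u of
the limit manifold there are points of the manifolds of all late shifts, and their energies approach
that of u. Hence m ≤ m_h, trivially so if the limit manifold is empty. The seminorms are translation
invariant, so (V, f) is in turn a limit of shifts of (W, g) by the opposite amounts, and the same
argument gives m_h ≤ m. Neither compactness nor existence of minimizers enters.

Persistence rests on nondegeneracy. Let T be the bounded operator on H¹ representing the form of χL,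
E its negative subspace, M multiplication by g(x,u)/u and Q multiplication by g_u(x,u). At a point u
of the manifold, T u and M u agree when tested against u and against E. For w = su + v with v ∈ E
this gives ⟨Tw,w⟩ = ⟨Mw,w⟩ − ⟨Mv,v⟩ + ⟨Tv,v⟩, and superlinearity says M ≤ θQ; so the Hessian T − Q
is negative definite on ℝu ⊕ E (`exists_hessian_negDef`). For a late shift with negative subspace
E_n, the gradient is therefore strongly decreasing along Z = ℝu + E_n near u and almost orthogonal
to Z at u. A contraction in u + Z finds a point a where it is orthogonal to Z. As u ∈ Z, also a ∈ Z,
and both Nehari conditions hold at a (`exists_constrained_zero`).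

This needs norm convergence of the projections onto E_n as operators on H¹. With K making A = L + K
coercive, S = A^{-1/2} T A^{-1/2} is symmetric and invertible, and (1 − sign S)/2, conjugated back
by A^{1/2}, is the projection. Square roots come from a contraction and depend continuously on the
operator by a Sylvester estimate, so the whole construction is continuous (`tendsto_negProj`). A
splitting orthogonal for both A and T is unique (`IsSplit.unique`), which identifies this projection
with the spectral splitting.

The analytic input is ∫|p u v| ≤ 4‖p‖_BS ‖u‖‖v‖ on H¹, from local bounds on unit cells; on shorter
cells the derivative gets a small weight, which gives coercivity of L + K. The hypotheses pass to
the envelope: the gap through a bound on the inverse common to all shifts, the pointwise conditions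
through affine inequalities at rational u (`Gapped.limit`, `Superlin.limit`). -/

noncomputable section

namespace NLS

open scoped RealInnerProductSpace

/-! ### Symmetric bounded operators: square root, sign, and the negative projection of a pair of
forms. -/

section Operators

variable {H : Type*} [NormedAddCommGroup H] [InnerProductSpace ℝ H]

/-- A bounded operator that is symmetric for the inner product. -/
def SymmOp (A : H →L[ℝ] H) : Prop := ∀ x y, ⟪A x, y⟫ = ⟪x, A y⟫

/-- The quadratic form of `A` is bounded below by `c`. -/
def LowerBd (c : ℝ) (A : H →L[ℝ] H) : Prop := ∀ x, c * ‖x‖ ^ 2 ≤ ⟪A x, x⟫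

theorem apply_of_mul_eq {A B C : H →L[ℝ] H} (h : A * B = C) (x : H) : A (B x) = C x :=
  congrArg (fun W : H →L[ℝ] H => W x) h

theorem SymmOp.add {A B : H →L[ℝ] H} (hA : SymmOp A) (hB : SymmOp B) : SymmOp (A + B) := by
  intro x y
  simp [inner_add_left, inner_add_right, hA x y, hB x y]

theorem SymmOp.sub {A B : H →L[ℝ] H} (hA : SymmOp A) (hB : SymmOp B) : SymmOp (A - B) := by
  intro x y
  simp [inner_sub_left, inner_sub_right, hA x y, hB x y]

theorem SymmOp.smul {A : H →L[ℝ] H} (c : ℝ) (hA : SymmOp A) : SymmOp (c • A) := by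
  intro x y
  simp [inner_smul_left, inner_smul_right, hA x y]

theorem SymmOp.one : SymmOp (1 : H →L[ℝ] H) := fun _ _ => rfl

theorem SymmOp.mul_self {A : H →L[ℝ] H} (hA : SymmOp A) : SymmOp (A * A) := by
  intro x y
  change ⟪A (A x), y⟫ = ⟪x, A (A y)⟫
  rw [hA, hA]

/-- The norm of a symmetric operator is the supremum of its Rayleigh quotient in absolute value, so
form bounds become norm bounds. -/
theorem SymmOp.norm_le {A : H →L[ℝ] H} (hA : SymmOp A) {r : ℝ} (hr : 0 ≤ r)
    (h : ∀ x, |⟪A x, x⟫| ≤ r * ‖x‖ ^ 2) : ‖A‖ ≤ r := by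
  have hs : (A : H →ₗ[ℝ] H).IsSymmetric := fun x y => hA x y
  rw [ContinuousLinearMap.norm_eq_iSup_rayleighQuotient A hs]
  refine Real.iSup_le (fun x => ?_) hr
  rcases eq_or_ne x 0 with rfl | hx
  · simpa using hr
  · have : 0 < ‖x‖ ^ 2 := by positivity
    rw [ContinuousLinearMap.rayleighQuotient, abs_div, abs_of_pos this, div_le_iff₀ this]
    exact h x

theorem inner_le_norm_op (A : H →L[ℝ] H) (x : H) : ⟪A x, x⟫ ≤ ‖A‖ * ‖x‖ ^ 2 :=
  calc ⟪A x, x⟫ ≤ ‖A x‖ * ‖x‖ := real_inner_le_norm _ _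
    _ ≤ ‖A‖ * ‖x‖ * ‖x‖ := by gcongr; exact A.le_opNorm x
    _ = _ := by ring

theorem norm_sub_le_of_lowerBd {Q : H →L[ℝ] H} (hQ : SymmOp Q) {q s : ℝ} (h : LowerBd q Q)
    (hs : ‖Q‖ ≤ s) (hq : q ≤ s) : ‖s • 1 - Q‖ ≤ s - q := by
  refine ((SymmOp.one.smul s).sub hQ).norm_le (by linarith) fun x => ?_
  have h1 := h x
  have h2 := inner_le_norm_op Q x
  have h3 : ‖Q‖ * ‖x‖ ^ 2 ≤ s * ‖x‖ ^ 2 := by gcongr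
  have : ⟪(s • (1 : H →L[ℝ] H) - Q) x, x⟫ = s * ‖x‖ ^ 2 - ⟪Q x, x⟫ := by
    simp [inner_sub_left, inner_smul_left]
  rw [this, abs_of_nonneg (by linarith)]
  linarith

/-- The estimate for the Sylvester equation `Q D + D Q' = E`. -/
theorem sylvester_bound {Q Q' D E : H →L[ℝ] H} (hQ : SymmOp Q) (hQ' : SymmOp Q') {q : ℝ}
    (h : LowerBd q Q) (h' : LowerBd 0 Q') (he : Q * D + D * Q' = E) :
    q * ‖D‖ ≤ ‖E‖ := by
  set s := max (max ‖Q‖ ‖Q'‖) (max q 0)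
  have h1 : ‖s • 1 - Q‖ ≤ s - q := norm_sub_le_of_lowerBd hQ h (by simp [s]) (by simp [s])
  have h2 : ‖s • 1 - Q'‖ ≤ s - 0 := norm_sub_le_of_lowerBd hQ' h' (by simp [s]) (by simp [s])
  have hs : 0 ≤ s := by simp [s]
  -- Writing Q = s − (s − Q), and likewise for Q', isolates 2sD. The two remainders cost (s − q)‖D‖
  -- and s‖D‖, which leaves exactly q‖D‖ ≤ ‖E‖.
  have key : (2 * s) • D = E + (s • 1 - Q) * D + D * (s • 1 - Q') := by
    rw [← he]
    simp only [sub_mul, mul_sub, smul_mul_assoc, mul_smul_comm, one_mul, mul_one]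
    module
  have : 2 * s * ‖D‖ ≤ ‖E‖ + (s - q) * ‖D‖ + ‖D‖ * (s - 0) := by
    calc 2 * s * ‖D‖ = ‖(2 * s) • D‖ := by rw [norm_smul, Real.norm_of_nonneg (by positivity)]
      _ ≤ ‖E‖ + ‖(s • 1 - Q) * D‖ + ‖D * (s • 1 - Q')‖ := by rw [key]; exact norm_add₃_le
      _ ≤ _ := by
        gcongr
        · exact (norm_mul_le _ _).trans (by gcongr)
        · exact (norm_mul_le _ _).trans (by gcongr)
  linarith

theorem isUnit_of_lowerBd [CompleteSpace H] {A : H →L[ℝ] H} {c : ℝ} (hc : 0 < c)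
    (h : LowerBd c A) : IsUnit A := by
  refine ContinuousLinearMap.isUnit_of_forall_le_norm_inner_map (𝕜 := ℝ) A (c := ⟨c, hc.le⟩) hc fun x => ?_
  have := h x
  rw [Real.norm_eq_abs]
  refine le_trans ?_ (le_abs_self _)
  change ‖x‖ ^ 2 * c ≤ _
  linarith

/-- For `‖R‖ < 1` the operator `1 - R` has a square root `1 - Y`, with `Y` in the closed
commutative subalgebra generated by `R`. -/
theorem exists_sqrt_one_sub [CompleteSpace H] {R : H →L[ℝ] H} (hR : SymmOp R) (h1 : ‖R‖ < 1) :
    ∃ Y : H →L[ℝ] H, SymmOp Y ∧ ‖Y‖ ≤ ‖R‖ ∧ (∀ Z, Commute Z R → Commute Z Y) ∧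
      (1 - Y) * (1 - Y) = 1 - R := by
  set ρ := ‖R‖
  have hρ0 : 0 ≤ ρ := norm_nonneg _
  -- (1 − Y)² = 1 − R is the fixed point equation Y = (R + Y²)/2, whose right side contracts the
  -- ball of radius ρ = ‖R‖ < 1 with constant ρ. Symmetry and commutation are closed conditions
  -- preserved by the iteration, so the fixed point inherits them.
  set s : Set (H →L[ℝ] H) := {Y | SymmOp Y ∧ ‖Y‖ ≤ ρ ∧ ∀ Z, Commute Z R → Commute Z Y}
  have hsc : IsClosed s := by
    have e : s = {Y | SymmOp Y} ∩ ({Y | ‖Y‖ ≤ ρ} ∩ {Y | ∀ Z, Commute Z R → Commute Z Y}) := rfl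
    rw [e]
    refine IsClosed.inter ?_ (IsClosed.inter ?_ ?_)
    · simp only [SymmOp, ofPred_forall]
      refine isClosed_iInter fun x => isClosed_iInter fun y => ?_
      exact isClosed_eq (by fun_prop) (by fun_prop)
    · exact isClosed_le continuous_norm continuous_const
    · simp only [ofPred_forall]
      refine isClosed_iInter fun Z => isClosed_iInter fun hZ => ?_
      exact isClosed_eq (by fun_prop) (by fun_prop)
  let Ψ : (H →L[ℝ] H) → (H →L[ℝ] H) := fun Y => (1 / 2 : ℝ) • (R + Y * Y)
  have hmaps : MapsTo Ψ s s := by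
    rintro Y ⟨hY1, hY2, hY3⟩
    refine ⟨(hR.add hY1.mul_self).smul _, ?_, fun Z hZ => ?_⟩
    · calc ‖Ψ Y‖ = 1 / 2 * ‖R + Y * Y‖ := by
            rw [norm_smul, Real.norm_of_nonneg (by positivity)]
        _ ≤ 1 / 2 * (ρ + ρ * ρ) := by
            gcongr
            refine (norm_add_le _ _).trans ?_
            gcongr
            exact (norm_mul_le _ _).trans (by gcongr)
        _ ≤ ρ := by nlinarith
    · exact (hZ.add_right ((hY3 Z hZ).mul_right (hY3 Z hZ))).smul_right _
  have hcon : ContractingWith ⟨ρ, hρ0⟩ (hmaps.restrict Ψ s s) := by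
    refine ⟨h1, LipschitzWith.of_dist_le_mul ?_⟩
    rintro ⟨Y, hY⟩ ⟨Z, hZ⟩
    rw [Subtype.dist_eq, Subtype.dist_eq]
    simp only [MapsTo.val_restrict_apply, dist_eq_norm]
    have e : Ψ Y - Ψ Z = (1 / 2 : ℝ) • (Y * (Y - Z) + (Y - Z) * Z) := by
      simp only [Ψ, mul_sub, sub_mul]
      module
    rw [e, norm_smul, Real.norm_of_nonneg (by positivity)]
    calc 1 / 2 * ‖Y * (Y - Z) + (Y - Z) * Z‖
        ≤ 1 / 2 * (ρ * ‖Y - Z‖ + ‖Y - Z‖ * ρ) := by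
          gcongr
          refine (norm_add_le _ _).trans ?_
          gcongr
          · exact (norm_mul_le _ _).trans (by gcongr; exact hY.2.1)
          · exact (norm_mul_le _ _).trans (by gcongr; exact hZ.2.1)
      _ = ρ * ‖Y - Z‖ := by ring
  have h0 : (0 : H →L[ℝ] H) ∈ s :=
    ⟨fun x y => by simp, by simpa using hρ0, fun Z _ => Commute.zero_right Z⟩
  obtain ⟨Y, hYs, hfix, -⟩ :=
    ContractingWith.exists_fixedPoint' hsc.isComplete hmaps hcon h0 (edist_ne_top _ _)
  refine ⟨Y, hYs.1, hYs.2.1, hYs.2.2, ?_⟩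
  have hfix' : (1 / 2 : ℝ) • (R + Y * Y) = Y := hfix
  have h2 : R + Y * Y = (2 : ℝ) • Y := by
    conv_rhs => rw [← hfix', smul_smul]
    norm_num
  have : (1 - Y) * (1 - Y) = 1 - (2 : ℝ) • Y + Y * Y := by
    rw [two_smul]; noncomm_ring
  rw [this, ← h2]
  abel

/-- `Q` is a nonnegative symmetric square root of `A`. -/
structure IsSqrt (A Q : H →L[ℝ] H) : Prop where
  symm : SymmOp Q
  nonneg : LowerBd 0 Q
  sq : Q * Q = A

/-- With s = max(‖A‖, c) one has ‖1 − A/s‖ ≤ (s − c)/s < 1, so A/s has a root, rescaled by √s.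
Commutation is recorded because it later lets the sign commute with whatever commutes with the
operator. -/
theorem exists_isSqrt [CompleteSpace H] {A : H →L[ℝ] H} (hA : SymmOp A) {c : ℝ} (hc : 0 < c)
    (h : LowerBd c A) : ∃ Q, IsSqrt A Q ∧ ∀ Z, Commute Z A → Commute Z Q := by
  set s := max ‖A‖ c
  have hs : 0 < s := lt_of_lt_of_le hc (le_max_right _ _)
  have hA' := norm_sub_le_of_lowerBd hA h (le_max_left _ _ : ‖A‖ ≤ s) (le_max_right _ _)
  have eR : 1 - s⁻¹ • A = s⁻¹ • (s • 1 - A) := by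
    rw [smul_sub, smul_smul, inv_mul_cancel₀ hs.ne', one_smul]
  have hR : ‖1 - s⁻¹ • A‖ < 1 := by
    rw [eR, norm_smul, Real.norm_of_nonneg (by positivity), inv_mul_lt_iff₀ hs]
    linarith
  obtain ⟨Y, hY1, hY2, hY3, hY4⟩ := exists_sqrt_one_sub (SymmOp.one.sub (hA.smul s⁻¹)) hR
  refine ⟨Real.sqrt s • (1 - Y), ⟨(SymmOp.one.sub hY1).smul _, fun x => ?_, ?_⟩, fun Z hZ => ?_⟩
  · have h2 := inner_le_norm_op Y x
    have h3 : ‖Y‖ * ‖x‖ ^ 2 ≤ 1 * ‖x‖ ^ 2 := by gcongr; exact hY2.trans hR.le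
    have : ⟪(Real.sqrt s • (1 - Y)) x, x⟫ = Real.sqrt s * (‖x‖ ^ 2 - ⟪Y x, x⟫) := by
      simp [inner_sub_left, inner_smul_left]
    rw [this, zero_mul]
    exact mul_nonneg (Real.sqrt_nonneg _) (by linarith)
  · rw [smul_mul_smul_comm, hY4, Real.mul_self_sqrt hs.le, sub_sub_cancel, smul_smul,
      mul_inv_cancel₀ hs.ne', one_smul]
  · exact ((Commute.one_right Z).sub_right
      (hY3 Z ((Commute.one_right Z).sub_right (hZ.smul_right _)))).smul_right _

/-- Since ‖Qx‖² = ⟨Ax,x⟩ ≥ c‖x‖², it suffices to have Q² ≤ (‖Q‖ + 1)Q, which nonnegativity of Q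
gives without taking a root of Q. -/
theorem IsSqrt.lowerBd {A Q : H →L[ℝ] H} (hQ : IsSqrt A Q) {c : ℝ} (hc : 0 < c)
    (h : LowerBd c A) : ∃ q > 0, LowerBd q Q := by
  refine ⟨c / (‖Q‖ + 1), by positivity, fun x => ?_⟩
  have hn : ‖Q x‖ ^ 2 = ⟪A x, x⟫ := by
    rw [← hQ.sq, ← real_inner_self_eq_norm_sq, hQ.symm, real_inner_comm]
    rfl
  have h1 := h x
  have hpos : ∀ y, 0 ≤ ⟪Q y, y⟫ := fun y => by simpa using hQ.nonneg y
  -- expand the nonnegative quadratic form of `Q` at `x - t Q x`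
  have key : ‖Q x‖ ^ 2 ≤ (‖Q‖ + 1) * ⟪Q x, x⟫ := by
    set t := (‖Q‖ + 1)⁻¹
    have ht : 0 < t := by positivity
    have h2 := hpos (x - t • Q x)
    have e : ⟪Q (x - t • Q x), x - t • Q x⟫
        = ⟪Q x, x⟫ - 2 * t * ‖Q x‖ ^ 2 + t ^ 2 * ⟪Q (Q x), Q x⟫ := by
      simp only [map_sub, map_smul, inner_sub_left, inner_sub_right, inner_smul_left,
        inner_smul_right, real_inner_self_eq_norm_sq, hQ.symm (Q x) x]
      simp
      ring
    have h3 := inner_le_norm_op Q (Q x)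
    have h4 : t * ‖Q‖ ≤ 1 := by
      rw [inv_mul_le_iff₀ (by positivity)]; linarith
    have h5 : t ^ 2 * ⟪Q (Q x), Q x⟫ ≤ t * ‖Q x‖ ^ 2 := by
      calc t ^ 2 * ⟪Q (Q x), Q x⟫ ≤ t ^ 2 * (‖Q‖ * ‖Q x‖ ^ 2) := by gcongr
        _ = t * (t * ‖Q‖) * ‖Q x‖ ^ 2 := by ring
        _ ≤ t * 1 * ‖Q x‖ ^ 2 := by gcongr
        _ = _ := by ring
    have h6 : t * ‖Q x‖ ^ 2 ≤ ⟪Q x, x⟫ := by linarith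
    rwa [inv_mul_le_iff₀ (by positivity)] at h6
  rw [div_mul_eq_mul_div, div_le_iff₀ (by positivity)]
  linarith

/-- D = Q − Q' solves Q D + D Q' = A − A'. Only one of the two roots needs a positive lower bound,
so the constant depends on the limit alone. -/
theorem IsSqrt.norm_sub_le {A A' Q Q' : H →L[ℝ] H} (hQ : IsSqrt A Q) (hQ' : IsSqrt A' Q')
    {q : ℝ} (h : LowerBd q Q) : q * ‖Q - Q'‖ ≤ ‖A - A'‖ := by
  refine sylvester_bound hQ.symm hQ'.symm h hQ'.nonneg ?_
  rw [← hQ.sq, ← hQ'.sq]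
  noncomm_ring

open Classical in
/-- The positive square root of a strictly positive symmetric operator (junk otherwise). -/
def opSqrt (A : H →L[ℝ] H) : H →L[ℝ] H :=
  if h : ∃ Q, IsSqrt A Q ∧ ∀ Z, Commute Z A → Commute Z Q then h.choose else 0

/-- Symmetric operators that are strictly positive. -/
def StrictPos (A : H →L[ℝ] H) : Prop := SymmOp A ∧ ∃ c > 0, LowerBd c A

theorem StrictPos.isUnit [CompleteSpace H] {A : H →L[ℝ] H} (h : StrictPos A) : IsUnit A := by
  obtain ⟨_, c, hc, h⟩ := h
  exact isUnit_of_lowerBd hc h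

theorem isSqrt_opSqrt [CompleteSpace H] {A : H →L[ℝ] H} (h : StrictPos A) :
    IsSqrt A (opSqrt A) := by
  obtain ⟨hs, c, hc, hl⟩ := h
  have := exists_isSqrt hs hc hl
  rw [opSqrt, dif_pos this]
  exact this.choose_spec.1

theorem commute_opSqrt [CompleteSpace H] {A Z : H →L[ℝ] H} (h : StrictPos A)
    (hZ : Commute Z A) : Commute Z (opSqrt A) := by
  obtain ⟨hs, c, hc, hl⟩ := h
  have := exists_isSqrt hs hc hl
  rw [opSqrt, dif_pos this]
  exact this.choose_spec.2 Z hZ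

theorem StrictPos.opSqrt [CompleteSpace H] {A : H →L[ℝ] H} (h : StrictPos A) :
    StrictPos (opSqrt A) := by
  obtain ⟨c, hc, hl⟩ := h.2
  exact ⟨(isSqrt_opSqrt h).symm, (isSqrt_opSqrt h).lowerBd hc hl⟩

theorem tendsto_opSqrt [CompleteSpace H] {ι : Type*} {l : Filter ι} {A : ι → H →L[ℝ] H}
    {B : H →L[ℝ] H} (hB : StrictPos B) (hA : ∀ᶠ i in l, StrictPos (A i))
    (h : Tendsto A l (𝓝 B)) : Tendsto (fun i => opSqrt (A i)) l (𝓝 (opSqrt B)) := by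
  obtain ⟨-, q, hq, hl⟩ := hB.opSqrt
  rw [tendsto_iff_norm_sub_tendsto_zero] at h ⊢
  have h' : Tendsto (fun i => q⁻¹ * ‖A i - B‖) l (𝓝 0) := by simpa using h.const_mul q⁻¹
  refine squeeze_zero' (Eventually.of_forall fun i => norm_nonneg _) ?_ h'
  filter_upwards [hA] with i hi
  rw [le_inv_mul_iff₀ hq, norm_sub_rev, norm_sub_rev (A i)]
  exact (isSqrt_opSqrt hB).norm_sub_le (isSqrt_opSqrt hi) hl

/-- ⟨M²x,x⟩ = ‖Mx‖², and an invertible M is bounded below. This makes |M| = √(M²) available. -/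
theorem StrictPos.mul_self [CompleteSpace H] {M : H →L[ℝ] H} (hM : SymmOp M) (hu : IsUnit M) :
    StrictPos (M * M) := by
  refine ⟨hM.mul_self, ?_⟩
  obtain ⟨M, rfl⟩ := hu
  set N : H →L[ℝ] H := ↑M⁻¹
  refine ⟨((‖N‖ + 1) ^ 2)⁻¹, by positivity, fun x => ?_⟩
  have e : ⟪((M : H →L[ℝ] H) * (M : H →L[ℝ] H)) x, x⟫ = ‖(M : H →L[ℝ] H) x‖ ^ 2 := by
    rw [← real_inner_self_eq_norm_sq, mul_apply_eq_comp, hM]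
  rw [e, inv_mul_le_iff₀ (by positivity), ← mul_pow]
  have hx : N ((M : H →L[ℝ] H) x) = x := apply_of_mul_eq M.inv_mul x
  have : ‖x‖ ≤ (‖N‖ + 1) * ‖(M : H →L[ℝ] H) x‖ := by
    calc ‖x‖ = ‖N ((M : H →L[ℝ] H) x)‖ := by rw [hx]
      _ ≤ ‖N‖ * ‖(M : H →L[ℝ] H) x‖ := N.le_opNorm _
      _ ≤ _ := by gcongr; linarith
  gcongr


/-- The symmetrization `A^{-1/2} T A^{-1/2}`. -/
def symmetrize (A T : H →L[ℝ] H) : H →L[ℝ] H :=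
  Ring.inverse (opSqrt A) * T * Ring.inverse (opSqrt A)

/-- The operator absolute value. -/
def opAbs (M : H →L[ℝ] H) : H →L[ℝ] H := opSqrt (M * M)

/-- The operator sign. -/
def opSign (M : H →L[ℝ] H) : H →L[ℝ] H := M * Ring.inverse (opAbs M)

/-- The projection onto the negative subspace of the form of `T`, along the positive one, where
both are taken orthogonal for the inner product given by `A`. -/
def negProj (A T : H →L[ℝ] H) : H →L[ℝ] H :=
  Ring.inverse (opSqrt A) * ((1 / 2 : ℝ) • (1 - opSign (symmetrize A T))) * opSqrt A

theorem SymmOp.inverse {A : H →L[ℝ] H} (hA : SymmOp A) : SymmOp (Ring.inverse A) := by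
  by_cases hu : IsUnit A
  · intro x y
    have h (z : H) : A (Ring.inverse A z) = z :=
      apply_of_mul_eq (Ring.mul_inverse_cancel _ hu) z
    conv_lhs => rw [← h y, ← hA, h]
  · rw [Ring.inverse_non_unit _ hu]
    exact fun x y => by simp

theorem SymmOp.conj {A C : H →L[ℝ] H} (hA : SymmOp A) (hC : SymmOp C) : SymmOp (C * A * C) := by
  intro x y
  change ⟪C (A (C x)), y⟫ = ⟪x, C (A (C y))⟫
  rw [hC, hA, hC]

theorem SymmOp.mul_of_commute {A B : H →L[ℝ] H} (hA : SymmOp A) (hB : SymmOp B)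
    (h : Commute A B) : SymmOp (A * B) := by
  intro x y
  conv_rhs => rw [h.eq]
  change ⟪A (B x), y⟫ = ⟪x, B (A y)⟫
  rw [hA, hB]

theorem commute_inverse {Z Q : H →L[ℝ] H} (h : Commute Z Q) : Commute Z (Ring.inverse Q) := by
  by_cases hu : IsUnit Q
  · obtain ⟨Q, rfl⟩ := hu
    rw [Ring.inverse_unit]
    exact h.units_inv_right
  · rw [Ring.inverse_non_unit _ hu]
    exact Commute.zero_right _

variable [CompleteSpace H]

theorem StrictPos.opAbs {M : H →L[ℝ] H} (hM : SymmOp M) (hu : IsUnit M) : StrictPos (opAbs M) :=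
  (StrictPos.mul_self hM hu).opSqrt

theorem commute_opAbs {M Z : H →L[ℝ] H} (hM : SymmOp M) (hu : IsUnit M) (h : Commute Z M) :
    Commute Z (opAbs M) :=
  commute_opSqrt (StrictPos.mul_self hM hu) (h.mul_right h)

theorem commute_opSign {M Z : H →L[ℝ] H} (hM : SymmOp M) (hu : IsUnit M) (h : Commute Z M) :
    Commute Z (opSign M) :=
  h.mul_right (commute_inverse (commute_opAbs hM hu h))

theorem SymmOp.opSign {M : H →L[ℝ] H} (hM : SymmOp M) (hu : IsUnit M) : SymmOp (opSign M) :=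
  hM.mul_of_commute (StrictPos.opAbs hM hu).1.inverse
    (commute_inverse (commute_opAbs hM hu (Commute.refl M)))

theorem opSign_mul_self {M : H →L[ℝ] H} (hM : SymmOp M) (hu : IsUnit M) :
    opSign M * opSign M = 1 := by
  have hN := (StrictPos.opAbs hM hu).isUnit
  have hc := commute_inverse (commute_opAbs hM hu (Commute.refl M))
  have hs : opAbs M * opAbs M = M * M := (isSqrt_opSqrt (StrictPos.mul_self hM hu)).sq
  calc NLS.opSign M * NLS.opSign M
      = M * (Ring.inverse (opAbs M) * M) * Ring.inverse (opAbs M) := by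
        simp only [NLS.opSign, mul_assoc]
    _ = M * M * Ring.inverse (opAbs M) * Ring.inverse (opAbs M) := by
        rw [← hc.eq]; simp only [mul_assoc]
    _ = opAbs M * (opAbs M * Ring.inverse (opAbs M)) * Ring.inverse (opAbs M) := by
        rw [← hs]; simp only [mul_assoc]
    _ = 1 := by rw [Ring.mul_inverse_cancel _ hN, mul_one, Ring.mul_inverse_cancel _ hN]

theorem opSign_mul_opAbs {M : H →L[ℝ] H} (hM : SymmOp M) (hu : IsUnit M) :
    opAbs M * opSign M = M := by
  have hc := commute_opAbs hM hu (Commute.refl M)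
  have hN := (StrictPos.opAbs hM hu).isUnit
  rw [NLS.opSign, ← mul_assoc, ← hc.eq, mul_assoc, Ring.mul_inverse_cancel _ hN, mul_one]

theorem tendsto_inverse {ι : Type*} {l : Filter ι} {A : ι → H →L[ℝ] H}
    {B : H →L[ℝ] H} (hB : IsUnit B) (h : Tendsto A l (𝓝 B)) :
    Tendsto (fun i => Ring.inverse (A i)) l (𝓝 (Ring.inverse B)) := by
  obtain ⟨B, rfl⟩ := hB
  exact (NormedRing.inverse_continuousAt B).tendsto.comp h

/-- A strictly positive operator and an invertible symmetric operator. -/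
structure Pencil (A T : H →L[ℝ] H) : Prop where
  pos : StrictPos A
  symm : SymmOp T
  isUnit : IsUnit T

namespace Pencil

variable {A T : H →L[ℝ] H}

theorem isUnit_sqrt (h : Pencil A T) : IsUnit (opSqrt A) := h.pos.opSqrt.isUnit

theorem symm_symmetrize (h : Pencil A T) : SymmOp (symmetrize A T) :=
  h.symm.conj h.pos.opSqrt.1.inverse

theorem isUnit_symmetrize (h : Pencil A T) : IsUnit (symmetrize A T) :=
  (h.isUnit_sqrt.ringInverse.mul h.isUnit).mul h.isUnit_sqrt.ringInverse

theorem inv_sqrt (h : Pencil A T) (x : H) : Ring.inverse (opSqrt A) (opSqrt A x) = x :=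
  apply_of_mul_eq (Ring.inverse_mul_cancel _ h.isUnit_sqrt) x

theorem sqrt_inv (h : Pencil A T) (x : H) : opSqrt A (Ring.inverse (opSqrt A) x) = x :=
  apply_of_mul_eq (Ring.mul_inverse_cancel _ h.isUnit_sqrt) x

theorem inner_left (h : Pencil A T) (x y : H) : ⟪A x, y⟫ = ⟪opSqrt A x, opSqrt A y⟫ := by
  have h1 := isSqrt_opSqrt h.pos
  conv_lhs => rw [← h1.sq]
  exact h1.symm _ _

/-- In the variable A^{1/2}x the form of A is the inner product and that of T is a single symmetric
operator; all spectral statements about the pair are read off there. -/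
theorem inner_right (h : Pencil A T) (x y : H) :
    ⟪T x, y⟫ = ⟪symmetrize A T (opSqrt A x), opSqrt A y⟫ := by
  change _ = ⟪Ring.inverse (opSqrt A) (T (Ring.inverse (opSqrt A) (opSqrt A x))), _⟫
  rw [h.pos.opSqrt.1.inverse, h.inv_sqrt, h.inv_sqrt]

theorem sqrt_negProj (h : Pencil A T) (x : H) :
    opSqrt A (negProj A T x)
      = (1 / 2 : ℝ) • (opSqrt A x - opSign (symmetrize A T) (opSqrt A x)) := by
  change opSqrt A (Ring.inverse (opSqrt A) _) = _
  rw [h.sqrt_inv]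
  rfl

theorem sqrt_injective (h : Pencil A T) {x y : H} (he : opSqrt A x = opSqrt A y) : x = y := by
  rw [← h.inv_sqrt x, he, h.inv_sqrt]

theorem sign_sign (h : Pencil A T) (x : H) :
    opSign (symmetrize A T) (opSign (symmetrize A T) x) = x :=
  apply_of_mul_eq (opSign_mul_self h.symm_symmetrize h.isUnit_symmetrize) x

theorem negProj_negProj (h : Pencil A T) (x : H) :
    negProj A T (negProj A T x) = negProj A T x := by
  apply h.sqrt_injective
  rw [h.sqrt_negProj, h.sqrt_negProj]
  simp only [map_smul, map_sub, h.sign_sign]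
  module

theorem sqrt_of_neg (h : Pencil A T) {x : H} (hx : negProj A T x = x) :
    opSign (symmetrize A T) (opSqrt A x) = - opSqrt A x := by
  have := h.sqrt_negProj x
  rw [hx] at this
  have h2 : (2 : ℝ) • opSqrt A x = opSqrt A x - opSign (symmetrize A T) (opSqrt A x) := by
    conv_lhs => rw [this, smul_smul]
    norm_num
  rw [two_smul] at h2
  rw [eq_neg_iff_add_eq_zero, ← sub_eq_zero.2 h2]
  abel

theorem sqrt_of_pos (h : Pencil A T) {x : H} (hx : negProj A T x = 0) :
    opSign (symmetrize A T) (opSqrt A x) = opSqrt A x := by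
  have := h.sqrt_negProj x
  rw [hx, map_zero, eq_comm, smul_eq_zero] at this
  rcases this with h | h
  · norm_num at h
  · exact (sub_eq_zero.1 h).symm

/-- The positive and the negative subspace are orthogonal for `A`. -/
theorem inner_left_eq_zero (h : Pencil A T) {x y : H} (hx : negProj A T x = 0)
    (hy : negProj A T y = y) : ⟪A x, y⟫ = 0 := by
  have h1 := (h.symm_symmetrize.opSign h.isUnit_symmetrize) (opSqrt A x) (opSqrt A y)
  rw [h.sqrt_of_pos hx, h.sqrt_of_neg hy, inner_neg_right] at h1
  rw [h.inner_left]
  linarith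

/-- The positive and the negative subspace are orthogonal for `T`. -/
theorem inner_right_eq_zero (h : Pencil A T) {x y : H} (hx : negProj A T x = 0)
    (hy : negProj A T y = y) : ⟪T x, y⟫ = 0 := by
  have hc := commute_opSign h.symm_symmetrize h.isUnit_symmetrize
    (Commute.refl (symmetrize A T))
  have h1 := (h.symm_symmetrize.opSign h.isUnit_symmetrize)
    (symmetrize A T (opSqrt A x)) (opSqrt A y)
  have h2 : opSign (symmetrize A T) (symmetrize A T (opSqrt A x))
      = symmetrize A T (opSqrt A x) := by
    rw [apply_of_mul_eq hc.eq.symm]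
    change symmetrize A T (opSign (symmetrize A T) (opSqrt A x)) = _
    rw [h.sqrt_of_pos hx]
  rw [h2, h.sqrt_of_neg hy, inner_neg_right] at h1
  rw [h.inner_right]
  linarith

theorem inner_right_of_sign (h : Pencil A T) {x : H} {σ : ℝ}
    (hx : opSign (symmetrize A T) (opSqrt A x) = σ • opSqrt A x) :
    ⟪T x, x⟫ = σ * ⟪opAbs (symmetrize A T) (opSqrt A x), opSqrt A x⟫ := by
  rw [h.inner_right]
  conv_lhs => rw [← opSign_mul_opAbs h.symm_symmetrize h.isUnit_symmetrize]
  change ⟪opAbs (symmetrize A T) (opSign (symmetrize A T) (opSqrt A x)), _⟫ = _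
  rw [hx, map_smul, real_inner_smul_left]

/-- On the two subspaces the sign acts on A^{1/2}x as ±1, so with S the symmetrization ⟨Tx,x⟩ =
±⟨|S|A^{1/2}x, A^{1/2}x⟩; the lower bounds of |S| and of A multiply. -/
theorem exists_coercive (h : Pencil A T) : ∃ α > 0,
    (∀ x, negProj A T x = 0 → α * ‖x‖ ^ 2 ≤ ⟪T x, x⟫) ∧
    (∀ x, negProj A T x = x → ⟪T x, x⟫ ≤ -(α * ‖x‖ ^ 2)) := by
  obtain ⟨-, q, hq, hQ⟩ := StrictPos.opAbs h.symm_symmetrize h.isUnit_symmetrize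
  obtain ⟨-, c, hc, hA⟩ := h.pos
  have key (x : H) : q * c * ‖x‖ ^ 2 ≤ ⟪opAbs (symmetrize A T) (opSqrt A x), opSqrt A x⟫ := by
    refine le_trans ?_ (hQ _)
    rw [mul_assoc, ← real_inner_self_eq_norm_sq (opSqrt A x), ← h.inner_left]
    gcongr
    exact hA x
  refine ⟨q * c, by positivity, fun x hx => ?_, fun x hx => ?_⟩
  · rw [h.inner_right_of_sign (σ := 1) (by rw [one_smul, h.sqrt_of_pos hx]), one_mul]
    exact key x
  · rw [h.inner_right_of_sign (σ := -1) (by rw [neg_one_smul, h.sqrt_of_neg hx]), neg_one_mul]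
    exact neg_le_neg (key x)

/-- The projection commutes with every operator that is symmetric for both forms. -/
theorem negProj_comm (h : Pencil A T) {B : H →L[ℝ] H}
    (hA : ∀ x y, ⟪A (B x), y⟫ = ⟪A x, B y⟫) (hT : ∀ x y, ⟪T (B x), y⟫ = ⟪T x, B y⟫) (x : H) :
    negProj A T (B x) = B (negProj A T x) := by
  set C := opSqrt A
  set D := Ring.inverse C
  set M := symmetrize A T
  have hD (z : H) : D (C z) = z := h.inv_sqrt z
  have hC (z : H) : C (D z) = z := h.sqrt_inv z
  have hCs : SymmOp C := h.pos.opSqrt.1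
  have hDs : SymmOp D := hCs.inverse
  have hM (z : H) : M z = D (T (D z)) := rfl
  have hMs : SymmOp M := h.symm_symmetrize
  -- Symmetry of B for the form of A says that Z = A^{1/2} B A^{-1/2} is symmetric. Symmetry for T
  -- then says that Z commutes with the symmetrization, hence with its sign.
  set Z : H →L[ℝ] H := C * B * D
  have hZ (z : H) : Z z = C (B (D z)) := rfl
  have hZs : SymmOp Z := by
    intro x y
    have := hA (D x) (D y)
    rw [h.inner_left, h.inner_left] at this
    rw [hZ, hZ]
    change ⟪C (B (D x)), C (D y)⟫ = ⟪C (D x), C (B (D y))⟫ at this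
    rwa [hC, hC] at this
  have hcomm : Commute Z M := by
    refine ContinuousLinearMap.ext fun x => ext_inner_right ℝ fun y => ?_
    change ⟪Z (M x), y⟫ = ⟪M (Z x), y⟫
    rw [hZs, hM, hDs, hM, hDs, hZ, hZ, hD, hD, hT]
  have hU := commute_opSign h.symm_symmetrize h.isUnit_symmetrize hcomm
  have hU' (z : H) : opSign M (Z z) = Z (opSign M z) := (congrArg (fun W => W z) hU.eq).symm
  apply h.sqrt_injective
  rw [h.sqrt_negProj]
  have e : C (B (negProj A T x)) = Z (C (negProj A T x)) := by rw [hZ, hD]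
  have e' : C (B x) = Z (C x) := by rw [hZ, hD]
  change (1 / 2 : ℝ) • (C (B x) - opSign M (C (B x))) = C (B (negProj A T x))
  rw [e, h.sqrt_negProj, e', hU', map_smul, map_sub]

end Pencil

/-- Norm continuity of each ingredient: roots of strictly positive operators, inverses at units,
products. -/
theorem tendsto_negProj {ι : Type*} {l : Filter ι} {A T : ι → H →L[ℝ] H} {B S : H →L[ℝ] H}
    (h : Pencil B S) (hi : ∀ᶠ i in l, Pencil (A i) (T i)) (hA : Tendsto A l (𝓝 B))
    (hT : Tendsto T l (𝓝 S)) :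
    Tendsto (fun i => negProj (A i) (T i)) l (𝓝 (negProj B S)) := by
  have h1 := tendsto_opSqrt h.pos (hi.mono fun i hi => hi.pos) hA
  have h2 := tendsto_inverse h.isUnit_sqrt h1
  have h3 : Tendsto (fun i => symmetrize (A i) (T i)) l (𝓝 (symmetrize B S)) :=
    (h2.mul hT).mul h2
  have h4 : Tendsto (fun i => opAbs (symmetrize (A i) (T i))) l
      (𝓝 (opAbs (symmetrize B S))) :=
    tendsto_opSqrt (StrictPos.mul_self h.symm_symmetrize h.isUnit_symmetrize)
      (hi.mono fun i hi => StrictPos.mul_self hi.symm_symmetrize hi.isUnit_symmetrize)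
      (h3.mul h3)
  have h5 := h3.mul (tendsto_inverse
    (StrictPos.opAbs h.symm_symmetrize h.isUnit_symmetrize).isUnit h4)
  exact (h2.mul ((tendsto_const_nhds.sub h5).const_smul _)).mul h1

end Operators

set_option linter.unusedSectionVars false

/-! ### Uniqueness of the splitting orthogonal for two forms. -/

section Splitting

variable {H : Type*} [NormedAddCommGroup H] [InnerProductSpace ℝ H] [CompleteSpace H]

/-- A splitting into a positive and a negative subspace for the form of `T`, orthogonal for the
forms of `A` and of `T`. -/
structure IsSplit (A T : H →L[ℝ] H) (Ep En : Submodule ℝ H) : Prop where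
  isCompl : IsCompl Ep En
  orthogonal : ∀ u ∈ Ep, ∀ v ∈ En, ⟪A u, v⟫ = 0
  orthogonal' : ∀ u ∈ Ep, ∀ v ∈ En, ⟪T u, v⟫ = 0
  pos : ∀ u ∈ Ep, u ≠ 0 → 0 < ⟪T u, u⟫
  neg : ∀ u ∈ En, u ≠ 0 → ⟪T u, u⟫ < 0

variable {A T : H →L[ℝ] H}

/-- The negative subspace of a pencil. -/
def pencilNeg (A T : H →L[ℝ] H) : Submodule ℝ H := ((1 - negProj A T : H →L[ℝ] H) : H →ₗ[ℝ] H).ker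

/-- The positive subspace of a pencil. -/
def pencilPos (A T : H →L[ℝ] H) : Submodule ℝ H := (negProj A T : H →ₗ[ℝ] H).ker

theorem mem_pencilNeg {x : H} : x ∈ pencilNeg A T ↔ negProj A T x = x := by
  rw [pencilNeg, LinearMap.mem_ker]
  change x - negProj A T x = 0 ↔ _
  rw [sub_eq_zero, eq_comm]

theorem mem_pencilPos {x : H} : x ∈ pencilPos A T ↔ negProj A T x = 0 := by
  rw [pencilPos, LinearMap.mem_ker]
  rfl

theorem Pencil.isSplit (h : Pencil A T) : IsSplit A T (pencilPos A T) (pencilNeg A T) where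
  isCompl := by
    refine IsCompl.of_eq ?_ ?_
    · rw [Submodule.eq_bot_iff]
      rintro x ⟨h1, h2⟩
      rw [← mem_pencilNeg.1 h2, mem_pencilPos.1 h1]
    · rw [Submodule.eq_top_iff']
      intro x
      rw [← sub_add_cancel x (negProj A T x)]
      refine Submodule.add_mem_sup (mem_pencilPos.2 ?_) (mem_pencilNeg.2 (h.negProj_negProj x))
      rw [map_sub, h.negProj_negProj, sub_self]
  orthogonal u hu v hv := h.inner_left_eq_zero (mem_pencilPos.1 hu) (mem_pencilNeg.1 hv)
  orthogonal' u hu v hv := h.inner_right_eq_zero (mem_pencilPos.1 hu) (mem_pencilNeg.1 hv)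
  pos u hu h0 := by
    obtain ⟨α, hα, h1, -⟩ := h.exists_coercive
    exact lt_of_lt_of_le (by positivity) (h1 u (mem_pencilPos.1 hu))
  neg u hu h0 := by
    obtain ⟨α, hα, -, h1⟩ := h.exists_coercive
    exact lt_of_le_of_lt (h1 u (mem_pencilNeg.1 hu)) (neg_lt_zero.2 (by positivity))

/-- The projection of a splitting is symmetric for every symmetric form for which the splitting
is orthogonal. -/
theorem inner_projection_comm {Ep En : Submodule ℝ H} (hc : IsCompl Ep En) {S : H →L[ℝ] H}
    (hS : SymmOp S) (ho : ∀ u ∈ Ep, ∀ v ∈ En, ⟪S u, v⟫ = 0) (x y : H) :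
    ⟪S (En.projection Ep hc.symm x), y⟫ = ⟪S x, En.projection Ep hc.symm y⟫ := by
  set B := En.projection Ep hc.symm
  have hB (z : H) : B z ∈ En := Submodule.projection_apply_mem hc.symm z
  have hB' (z : H) : z - B z ∈ Ep := Submodule.sub_projection_mem hc.symm z
  have h1 := ho _ (hB' x) _ (hB y)
  have h2 := ho _ (hB' y) _ (hB x)
  rw [map_sub, inner_sub_left, sub_eq_zero] at h1 h2
  rw [h1, ← real_inner_comm, ← hS, h2, hS, real_inner_comm]

/-- The projection B of any splitting is symmetric for A and for T, and bounded because A is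
coercive, so it commutes with the canonical projection. A vector of En in the canonical positive
subspace would have a form value both negative and nonnegative, so it vanishes; the same holds with
signs exchanged for Ep. -/
theorem IsSplit.unique (h : Pencil A T) {Ep En : Submodule ℝ H} (hs : IsSplit A T Ep En) :
    Ep = pencilPos A T ∧ En = pencilNeg A T := by
  have hc := hs.isCompl.symm
  have hA := inner_projection_comm hs.isCompl h.pos.1 hs.orthogonal
  have hT := inner_projection_comm hs.isCompl h.symm hs.orthogonal'
  obtain ⟨c, hc0, hcA⟩ := h.pos.2
  have hidem (x : H) : En.projection Ep hc (En.projection Ep hc x) = En.projection Ep hc x :=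
    Submodule.projection_apply_of_mem_left hc (Submodule.projection_apply_mem hc x)
  set B : H →L[ℝ] H := (En.projection Ep hc).mkContinuous (c⁻¹ * ‖A‖) (by
    intro x
    set y := En.projection Ep hc x
    have h1 : c * ‖y‖ ^ 2 ≤ ‖A‖ * ‖x‖ * ‖y‖ := by
      calc c * ‖y‖ ^ 2 ≤ ⟪A y, y⟫ := hcA y
        _ = ⟪A x, y⟫ := by rw [hA, hidem]
        _ ≤ ‖A x‖ * ‖y‖ := real_inner_le_norm _ _
        _ ≤ _ := by gcongr; exact A.le_opNorm x
    rcases (norm_nonneg y).eq_or_lt with h0 | h0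
    · rw [← h0]; positivity
    · rw [mul_assoc, le_inv_mul_iff₀ hc0]
      exact le_of_mul_le_mul_right (by linarith) h0)
  have hBe (x : H) : B x = En.projection Ep hc x := rfl
  have hcomm := h.negProj_comm (B := B) hA hT
  obtain ⟨α, hα, h1, h2⟩ := h.exists_coercive
  have hmemEn {x : H} : x ∈ En ↔ B x = x := by
    refine ⟨fun hx => Submodule.projection_apply_of_mem_left hc hx, fun hx => ?_⟩
    rw [← hx]
    exact Submodule.projection_apply_mem hc x
  have hmemEp {x : H} : x ∈ Ep ↔ B x = 0 := by
    rw [hBe, Submodule.projection_apply_eq_zero_iff]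
  have hEn : ∀ x ∈ En, negProj A T x = x := by
    intro x hx
    have hPx : negProj A T x ∈ En := by
      rw [hmemEn, ← hcomm, hmemEn.1 hx]
    have hy : x - negProj A T x ∈ En := En.sub_mem hx hPx
    have hy0 : negProj A T (x - negProj A T x) = 0 := by
      rw [map_sub, h.negProj_negProj, sub_self]
    by_contra hne
    have h3 := hs.neg _ hy (fun h0 => hne (sub_eq_zero.1 h0).symm)
    have h4 := h1 _ hy0
    have : 0 ≤ α * ‖x - negProj A T x‖ ^ 2 := by positivity
    linarith
  have hEp : ∀ x ∈ Ep, negProj A T x = 0 := by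
    intro x hx
    have hPx : negProj A T x ∈ Ep := by
      rw [hmemEp, ← hcomm, hmemEp.1 hx, map_zero]
    by_contra hne
    have h3 := hs.pos _ hPx hne
    have h4 := h2 _ (h.negProj_negProj x)
    have : 0 ≤ α * ‖negProj A T x‖ ^ 2 := by positivity
    linarith
  have hdec (x : H) : negProj A T x = B x := by
    have hx : x - B x ∈ Ep := Submodule.sub_projection_mem hc x
    have h3 := hEp _ hx
    have h4 := hEn (B x) (Submodule.projection_apply_mem hc x)
    rw [map_sub, sub_eq_zero] at h3
    rw [h3, h4]
  refine ⟨?_, ?_⟩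
  · ext x
    rw [hmemEp, mem_pencilPos, hdec]
  · ext x
    rw [hmemEn, mem_pencilNeg, hdec]

end Splitting

/-! ### Persistence of nondegenerate constrained critical points. -/

section Zeros

variable {H : Type*} [NormedAddCommGroup H] [InnerProductSpace ℝ H] [CompleteSpace H]

/-- A map that is strongly monotone near `u` along a closed subspace `Z` and almost orthogonal to
`Z` at `u` becomes orthogonal to `Z` at a point of `u + Z` near `u`. -/
theorem exists_zero_of_monotone {δ Λ ρ : ℝ} (hδ : 0 < δ) (hδΛ : δ ≤ Λ) (hρ : 0 < ρ) :
    ∃ η > 0, ∀ (G : H → H) (Z : Submodule ℝ H) (_ : IsClosed (Z : Set H)) (u : H)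
      (_ : ∀ a b, ‖a - u‖ ≤ ρ → ‖b - u‖ ≤ ρ → a - b ∈ Z →
        ⟪G a - G b, a - b⟫ ≤ -(δ * ‖a - b‖ ^ 2))
      (_ : ∀ a b, ‖a - u‖ ≤ ρ → ‖b - u‖ ≤ ρ → a - b ∈ Z → ‖G a - G b‖ ≤ Λ * ‖a - b‖)
      (_ : ∀ z ∈ Z, |⟪G u, z⟫| ≤ η * ‖z‖),
      ∃ a, ‖a - u‖ ≤ ρ ∧ a - u ∈ Z ∧ ∀ z ∈ Z, ⟪G a, z⟫ = 0 := by
  have hΛ : 0 < Λ := hδ.trans_le hδΛ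
  -- The iteration w ↦ w + λ P G(u + w), with P the orthogonal projection onto Z, contracts with k²
  -- = 1 − 2λδ + λ²Λ², smallest at λ = δ/Λ². The threshold η makes 0 move by at most (1 − k)ρ, so
  -- the closed ρ-ball of Z is mapped into itself.
  set lam := δ / Λ ^ 2
  have hlam : 0 < lam := by positivity
  set k := Real.sqrt (1 - (δ / Λ) ^ 2)
  have hq : 0 ≤ 1 - (δ / Λ) ^ 2 := by
    have : (δ / Λ) ^ 2 ≤ 1 := pow_le_one₀ (by positivity) (by rw [div_le_one hΛ]; exact hδΛ)
    linarith
  have hk0 : 0 ≤ k := Real.sqrt_nonneg _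
  have hk2 : k ^ 2 = 1 - (δ / Λ) ^ 2 := Real.sq_sqrt hq
  have hk1 : k < 1 := by
    have : 0 < (δ / Λ) ^ 2 := by positivity
    nlinarith
  have hlam2 : 1 - 2 * lam * δ + lam ^ 2 * Λ ^ 2 = k ^ 2 := by
    rw [hk2]
    simp only [lam]
    field_simp
    ring
  refine ⟨(1 - k) * ρ / lam, by have : 0 < 1 - k := by linarith
                                positivity, ?_⟩
  intro G Z hZ u hmono hlip hsmall
  have : CompleteSpace Z := hZ.completeSpace_coe
  set P := Z.starProjection
  have hPm (x : H) : P x ∈ Z := Submodule.starProjection_apply_mem Z x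
  have hPi (x z : H) (hz : z ∈ Z) : ⟪P x, z⟫ = ⟪x, z⟫ := by
    have := Submodule.starProjection_inner_eq_zero (K := Z) x z hz
    rw [inner_sub_left, sub_eq_zero] at this
    exact this.symm
  have hPn (x : H) : ‖P x‖ ≤ ‖x‖ := Submodule.norm_starProjection_apply_le Z x
  let Ψ : H → H := fun w => w + lam • P (G (u + w))
  set s : Set H := {w | w ∈ Z ∧ ‖w‖ ≤ ρ}
  have hs : IsClosed s := hZ.inter (isClosed_le continuous_norm continuous_const)
  have hcontr : ∀ w ∈ s, ∀ w' ∈ s, ‖Ψ w - Ψ w'‖ ≤ k * ‖w - w'‖ := by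
    rintro w ⟨hw, hwρ⟩ w' ⟨hw', hwρ'⟩
    have hd : w - w' ∈ Z := Z.sub_mem hw hw'
    have e1 : u + w - (u + w') = w - w' := by abel
    have m := hmono (u + w) (u + w') (by simpa using hwρ) (by simpa using hwρ')
      (by rw [e1]; exact hd)
    have l := hlip (u + w) (u + w') (by simpa using hwρ) (by simpa using hwρ')
      (by rw [e1]; exact hd)
    rw [e1] at m l
    set g := G (u + w) - G (u + w')
    have e2 : Ψ w - Ψ w' = (w - w') + lam • P g := by
      simp only [Ψ, g, map_sub, smul_sub]
      abel
    have h2 : ‖Ψ w - Ψ w'‖ ^ 2 ≤ (k * ‖w - w'‖) ^ 2 := by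
      rw [e2, norm_add_sq_real, norm_smul, real_inner_smul_right, Real.norm_of_nonneg hlam.le,
        real_inner_comm, hPi _ _ hd, mul_pow, mul_pow, ← hlam2]
      have h3 : ‖P g‖ ^ 2 ≤ (Λ * ‖w - w'‖) ^ 2 := by
        gcongr
        exact (hPn g).trans l
      nlinarith [mul_le_mul_of_nonneg_left h3 (sq_nonneg lam),
        mul_le_mul_of_nonneg_left m hlam.le]
    exact le_of_sq_le_sq h2 (by positivity)
  have h0s : (0 : H) ∈ s := ⟨Z.zero_mem, by simpa using hρ.le⟩
  have hΨ0 : ‖Ψ 0‖ ≤ (1 - k) * ρ := by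
    have h1 : ‖P (G u)‖ ≤ (1 - k) * ρ / lam := by
      have h2 := hsmall _ (hPm (G u))
      rw [← hPi _ _ (hPm (G u)), real_inner_self_eq_norm_sq, abs_of_nonneg (by positivity)] at h2
      rcases (norm_nonneg (P (G u))).eq_or_lt with h | h
      · rw [← h]
        have : 0 < 1 - k := by linarith
        positivity
      · exact le_of_mul_le_mul_right (by linarith) h
    simp only [Ψ, add_zero, zero_add, norm_smul, Real.norm_of_nonneg hlam.le]
    calc lam * ‖P (G u)‖ ≤ lam * ((1 - k) * ρ / lam) := by gcongr
      _ = _ := by field_simp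
  have hmaps : MapsTo Ψ s s := by
    rintro w ⟨hw, hwρ⟩
    refine ⟨Z.add_mem hw (Z.smul_mem _ (hPm _)), ?_⟩
    have h1 := hcontr w ⟨hw, hwρ⟩ 0 h0s
    rw [sub_zero] at h1
    calc ‖Ψ w‖ = ‖(Ψ w - Ψ 0) + Ψ 0‖ := by rw [sub_add_cancel]
      _ ≤ ‖Ψ w - Ψ 0‖ + ‖Ψ 0‖ := norm_add_le _ _
      _ ≤ k * ρ + (1 - k) * ρ := by
        gcongr
        exact h1.trans (by gcongr)
      _ = ρ := by ring
  have hcon : ContractingWith ⟨k, hk0⟩ (hmaps.restrict Ψ s s) := by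
    refine ⟨hk1, LipschitzWith.of_dist_le_mul ?_⟩
    rintro ⟨w, hw⟩ ⟨w', hw'⟩
    rw [Subtype.dist_eq, Subtype.dist_eq]
    simp only [MapsTo.val_restrict_apply, dist_eq_norm]
    exact hcontr w hw w' hw'
  obtain ⟨w, hws, hfix, -⟩ :=
    ContractingWith.exists_fixedPoint' hs.isComplete hmaps hcon h0s (edist_ne_top _ _)
  refine ⟨u + w, by simpa using hws.2, by simpa using hws.1, fun z hz => ?_⟩
  have h1 : lam • P (G (u + w)) = 0 := by
    have : w + lam • P (G (u + w)) = w := hfix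
    simpa using this
  rw [smul_eq_zero] at h1
  rw [← hPi _ _ hz, h1.resolve_left hlam.ne', inner_zero_left]

theorem inner_quadratic_add (D : H →L[ℝ] H) (x y : H) :
    ⟪D (x + y), x + y⟫ = ⟪D x, x⟫ + ⟪D x, y⟫ + (⟪D y, x⟫ + ⟪D y, y⟫) := by
  rw [map_add, inner_add_left, inner_add_right, inner_add_right]

/-- Negative definiteness on ℝu + ran P₀ survives on nearby spaces: replacing v by P₀v leaves an
error of size e‖v‖, and expanding the form around su + P₀v loses at most e times a constant times s²
+ ‖v‖². The hypothesis on e keeps half of δ₀. -/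
theorem quadratic_le_of_close {P₀ D : H →L[ℝ] H} {u : H} (hPi : ∀ x, P₀ (P₀ x) = P₀ x)
    {δ₀ : ℝ} (hδ₀ : 0 < δ₀)
    (hD : ∀ (s : ℝ) (v : H), P₀ v = v →
      ⟪D (s • u + v), s • u + v⟫ ≤ -(δ₀ * (s ^ 2 + ‖v‖ ^ 2)))
    {e : ℝ} (he1 : e ≤ 1)
    (heK : e * (2 * δ₀ + ‖D‖ * (2 * (‖u‖ + 1 + 1) + 1) + 1) ≤ δ₀ / 2) (s : ℝ) {v : H}
    (hv : ‖v - P₀ v‖ ≤ e * ‖v‖) :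
    ⟪D (s • u + v), s • u + v⟫ ≤ -(δ₀ / 2 * (s ^ 2 + ‖v‖ ^ 2)) := by
  rcases eq_or_ne v 0 with rfl | hv0
  · have := hD s 0 (map_zero _)
    nlinarith [sq_nonneg s, sq_nonneg ‖(0 : H)‖]
  have he0 : 0 ≤ e := by
    have h1 : 0 < ‖v‖ := norm_pos_iff.2 hv0
    exact nonneg_of_mul_nonneg_left ((norm_nonneg _).trans hv) h1
  set N := Real.sqrt (s ^ 2 + ‖v‖ ^ 2)
  have hN : N ^ 2 = s ^ 2 + ‖v‖ ^ 2 := Real.sq_sqrt (by positivity)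
  have hN0 : 0 ≤ N := Real.sqrt_nonneg _
  have hsN : |s| ≤ N := Real.abs_le_sqrt (by nlinarith [sq_nonneg ‖v‖])
  have hvN : ‖v‖ ≤ N := Real.le_sqrt_of_sq_le (by nlinarith [sq_nonneg s])
  set z' := s • u + P₀ v
  set w := v - P₀ v
  have hw : ‖w‖ ≤ e * N := hv.trans (by gcongr)
  have hz : s • u + v = z' + w := by simp [z', w]
  have hPv : ‖v‖ - e * ‖v‖ ≤ ‖P₀ v‖ := by
    have := norm_sub_norm_le v (P₀ v)
    have := hv
    linarith
  have hPv' : ‖P₀ v‖ ≤ 2 * N := by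
    have h6 : ‖P₀ v‖ ≤ ‖v‖ + ‖v - P₀ v‖ := by
      simpa using norm_sub_le v (v - P₀ v)
    have := hv
    nlinarith
  have hz' : ‖z'‖ ≤ (‖u‖ + 1 + 1) * N := by
    calc ‖z'‖ ≤ ‖s • u‖ + ‖P₀ v‖ := norm_add_le _ _
      _ ≤ N * ‖u‖ + 2 * N := by
        rw [norm_smul]
        gcongr
        exact hsN
      _ = _ := by ring
  have hDz' := hD s (P₀ v) (hPi v)
  have hPsq : ‖v‖ ^ 2 - 2 * e * ‖v‖ ^ 2 ≤ ‖P₀ v‖ ^ 2 := by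
    have h6 : 0 ≤ ‖v‖ - e * ‖v‖ := by nlinarith [norm_nonneg v]
    nlinarith [mul_self_le_mul_self h6 hPv, sq_nonneg (e * ‖v‖)]
  have hb (x y : H) : ⟪D x, y⟫ ≤ ‖D‖ * ‖x‖ * ‖y‖ :=
    (real_inner_le_norm _ _).trans (by gcongr; exact D.le_opNorm x)
  have c1 : ⟪D z', w⟫ ≤ ‖D‖ * ((‖u‖ + 1 + 1) * N) * (e * N) := (hb _ _).trans (by gcongr)
  have c2 : ⟪D w, z'⟫ ≤ ‖D‖ * (e * N) * ((‖u‖ + 1 + 1) * N) := (hb _ _).trans (by gcongr)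
  have c3 : ⟪D w, w⟫ ≤ ‖D‖ * (e * N) * (1 * N) :=
    (hb _ _).trans (by gcongr; exact hw.trans (by gcongr))
  rw [hz, inner_quadratic_add]
  have c4 : e * (2 * δ₀ + ‖D‖ * (2 * (‖u‖ + 1 + 1) + 1) + 1) * N ^ 2 ≤ δ₀ / 2 * N ^ 2 := by gcongr
  have c5 : δ₀ * (s ^ 2 + (‖v‖ ^ 2 - 2 * e * ‖v‖ ^ 2)) ≤ δ₀ * (s ^ 2 + ‖P₀ v‖ ^ 2) := by gcongr
  have c6 : δ₀ * (2 * e * ‖v‖ ^ 2) ≤ δ₀ * (2 * e * N ^ 2) := by gcongr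
  have c7 : 0 ≤ e * N ^ 2 := by positivity
  have c8 : e * (2 * δ₀ + ‖D‖ * (2 * (‖u‖ + 1 + 1) + 1) + 1) * N ^ 2 = δ₀ * (2 * e * N ^ 2) + ‖D‖ * ((‖u‖ + 1 + 1) * N) * (e * N)
    + ‖D‖ * (e * N) * ((‖u‖ + 1 + 1) * N) + ‖D‖ * (e * N) * (1 * N) + e * N ^ 2 := by
    ring
  rw [← hN]
  have c9 : δ₀ * (s ^ 2 + (‖v‖ ^ 2 - 2 * e * ‖v‖ ^ 2)) = δ₀ * N ^ 2 - δ₀ * (2 * e * ‖v‖ ^ 2) := by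
    rw [hN]; ring
  linarith

/-- Persistence of a nondegenerate constrained maximum: `g₀` is the gradient at `u` of a limit
functional, orthogonal to `ℝ u ⊕ ran P`, and its Hessian `D` is negative definite there. -/
theorem exists_constrained_zero {P : ℕ → H →L[ℝ] H} {P₀ D : H →L[ℝ] H} {u g₀ : H}
    {G : ℕ → H → H} (hPi : ∀ x, P₀ (P₀ x) = P₀ x) (hP : Tendsto P atTop (𝓝 P₀))
    {δ₀ : ℝ} (hδ₀ : 0 < δ₀)
    (hD : ∀ (s : ℝ) (v : H), P₀ v = v →
      ⟪D (s • u + v), s • u + v⟫ ≤ -(δ₀ * (s ^ 2 + ‖v‖ ^ 2)))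
    (hu : ⟪g₀, u⟫ = 0) (hg : ∀ v, P₀ v = v → ⟪g₀, v⟫ = 0)
    (hG : Tendsto (fun n => G n u) atTop (𝓝 g₀))
    {Λ C r₀ : ℝ} (hr₀ : 0 < r₀) (hC : 0 < C) {ε : ℕ → ℝ} (hε : Tendsto ε atTop (𝓝 0))
    (hlip : ∀ᶠ n in atTop, ∀ a b, ‖a - u‖ ≤ r₀ → ‖b - u‖ ≤ r₀ →
      ‖G n a - G n b‖ ≤ Λ * ‖a - b‖)
    (happ : ∀ᶠ n in atTop, ∀ r ≤ r₀, ∀ a b, ‖a - u‖ ≤ r → ‖b - u‖ ≤ r →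
      ⟪G n a - G n b - D (a - b), a - b⟫ ≤ (ε n + C * r) * ‖a - b‖ ^ 2)
    {ρ : ℝ} (hρ : 0 < ρ) :
    ∀ᶠ n in atTop, ∃ a, ‖a - u‖ ≤ ρ ∧ ⟪G n a, a⟫ = 0 ∧ ∀ v, P n v = v → ⟪G n a, v⟫ = 0 := by
  set U := ‖u‖ + 1
  have hU : 0 < U := by positivity
  set δ := δ₀ / 2 / U ^ 2
  have hδ : 0 < δ := by positivity
  set K := 2 * δ₀ + ‖D‖ * (2 * (U + 1) + 1) + 1
  have hK : 0 < K := by positivity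
  set K₂ := Real.sqrt (2 * ‖D‖ / δ₀)
  have hK₂ : 0 ≤ K₂ := Real.sqrt_nonneg _
  set Λ' := max Λ (δ / 2)
  -- On this radius C r ≤ δ/4; together with ε n < δ/4 the linearization error consumes half of the
  -- negativity δ of D on Z.
  set r := min ρ (min r₀ (δ / 4 / C))
  have hr : 0 < r := by positivity
  obtain ⟨η, hη, hmain⟩ := exists_zero_of_monotone (H := H) (δ := δ / 2) (Λ := Λ') (ρ := r)
    (by positivity) (le_max_right _ _) hr
  have hPn : Tendsto (fun n => ‖P n - P₀‖) atTop (𝓝 0) := tendsto_iff_norm_sub_tendsto_zero.1 hP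
  have hGn : Tendsto (fun n => ‖G n u - g₀‖ + ‖g₀‖ * ‖P n - P₀‖ * K₂) atTop (𝓝 0) := by
    simpa using (tendsto_iff_norm_sub_tendsto_zero.1 hG).add ((hPn.const_mul ‖g₀‖).mul_const K₂)
  filter_upwards [hPn.eventually_lt_const (show 0 < min 1 (δ₀ / 2 / K) by positivity),
    hGn.eventually_lt_const hη, hε.eventually_lt_const (show 0 < δ / 4 by positivity), hlip, happ]
    with n h1 h2 h3 h4 h5
  set e := ‖P n - P₀‖
  have he0 : 0 ≤ e := norm_nonneg _
  have he1 : e ≤ 1 := (h1.trans_le (min_le_left _ _)).le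
  have heK : e * K ≤ δ₀ / 2 := by
    rw [← le_div_iff₀ hK]; exact (h1.trans_le (min_le_right _ _)).le
  have hdiff {v : H} (hv : P n v = v) : ‖v - P₀ v‖ ≤ e * ‖v‖ := by
    have := (P n - P₀).le_opNorm v
    rwa [show (P n - P₀) v = v - P₀ v by simp [hv]] at this
  have key (s : ℝ) (v : H) (hv : P n v = v) := quadratic_le_of_close hPi hδ₀ hD he1 heK s (hdiff hv)
  set E : Submodule ℝ H := ((1 - P n : H →L[ℝ] H) : H →ₗ[ℝ] H).ker
  have hE {v : H} : v ∈ E ↔ P n v = v := by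
    rw [LinearMap.mem_ker]
    change v - P n v = 0 ↔ _
    rw [sub_eq_zero, eq_comm]
  have hEc : IsClosed (E : Set H) := ContinuousLinearMap.isClosed_ker (1 - P n)
  set Z := E ⊔ Submodule.span ℝ {u}
  have hZ : IsClosed (Z : Set H) := Submodule.isClosed_sup_finiteDimensional _ _ hEc
  have hmem {z : H} (hz : z ∈ Z) : ∃ (s : ℝ) (v : H), P n v = v ∧ z = s • u + v := by
    obtain ⟨v, hv, y, hy, rfl⟩ := Submodule.mem_sup.1 hz
    obtain ⟨s, rfl⟩ := Submodule.mem_span_singleton.1 hy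
    exact ⟨s, v, hE.1 hv, add_comm _ _⟩
  have hZD {z : H} (hz : z ∈ Z) : ⟪D z, z⟫ ≤ -(δ * ‖z‖ ^ 2) := by
    obtain ⟨s, v, hv, rfl⟩ := hmem hz
    refine (key s v hv).trans (neg_le_neg ?_)
    have h6 : ‖s • u + v‖ ≤ |s| * ‖u‖ + ‖v‖ := by
      refine (norm_add_le _ _).trans ?_
      rw [norm_smul, Real.norm_eq_abs]
    have h7 : ‖s • u + v‖ ^ 2 ≤ U ^ 2 * (s ^ 2 + ‖v‖ ^ 2) := by
      have : (|s| * ‖u‖ + ‖v‖) ^ 2 ≤ U ^ 2 * (s ^ 2 + ‖v‖ ^ 2) := by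
        rw [← sq_abs s]
        simp only [U]
        nlinarith [sq_nonneg (|s| - ‖u‖ * ‖v‖), mul_nonneg (norm_nonneg u) (sq_nonneg |s|),
          mul_nonneg (norm_nonneg u) (sq_nonneg ‖v‖), sq_nonneg ‖v‖, sq_nonneg |s|]
      exact (pow_le_pow_left₀ (norm_nonneg _) h6 2).trans this
    calc δ * ‖s • u + v‖ ^ 2 ≤ δ * (U ^ 2 * (s ^ 2 + ‖v‖ ^ 2)) := by gcongr
      _ = _ := by simp only [δ]; field_simp
  have huZ : u ∈ Z := Submodule.mem_sup_right (Submodule.mem_span_singleton_self u)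
  have c1 : ∀ a b, ‖a - u‖ ≤ r → ‖b - u‖ ≤ r → a - b ∈ Z →
      ⟪G n a - G n b, a - b⟫ ≤ -(δ / 2 * ‖a - b‖ ^ 2) := by
    intro a b ha hb hab
    have h6 := h5 r ((min_le_right _ _).trans (min_le_left _ _)) a b ha hb
    have h7 := hZD hab
    have h8 : C * r ≤ δ / 4 := by
      rw [mul_comm, ← le_div_iff₀ hC]
      exact (min_le_right _ _).trans (min_le_right _ _)
    have h9 : (ε n + C * r) * ‖a - b‖ ^ 2 ≤ (δ / 2) * ‖a - b‖ ^ 2 := by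
      gcongr
      linarith
    rw [inner_sub_left] at h6
    linarith
  have c2 : ∀ a b, ‖a - u‖ ≤ r → ‖b - u‖ ≤ r → a - b ∈ Z →
      ‖G n a - G n b‖ ≤ Λ' * ‖a - b‖ := by
    intro a b ha hb _
    have hrr : r ≤ r₀ := (min_le_right _ _).trans (min_le_left _ _)
    refine (h4 a b (ha.trans hrr) (hb.trans hrr)).trans ?_
    gcongr
    exact le_max_left _ _
  have c3 : ∀ z ∈ Z, |⟪G n u, z⟫| ≤ η * ‖z‖ := by
    intro z hz
    obtain ⟨s, v, hv, rfl⟩ := hmem hz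
    set z := s • u + v
    have h6 := key s v hv
    -- Negative definiteness itself bounds the component v: (δ₀/2)‖v‖² ≤ −⟨Dz,z⟩ ≤ ‖D‖‖z‖². No
    -- separate estimate of the angle between u and the range of P n is needed.
    have h7 : ‖v‖ ≤ K₂ * ‖z‖ := by
      have h8 : -(‖D‖ * ‖z‖ ^ 2) ≤ ⟪D z, z⟫ := by
        have h9 := abs_real_inner_le_norm (D z) z
        have h10 : ‖D z‖ * ‖z‖ ≤ ‖D‖ * ‖z‖ * ‖z‖ := by gcongr; exact D.le_opNorm z
        have h11 := neg_abs_le ⟪D z, z⟫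
        nlinarith
      have h9 : ‖v‖ ^ 2 ≤ (K₂ * ‖z‖) ^ 2 := by
        rw [mul_pow, Real.sq_sqrt (by positivity), div_mul_eq_mul_div, le_div_iff₀ hδ₀]
        nlinarith [mul_nonneg hδ₀.le (sq_nonneg s)]
      exact le_of_sq_le_sq h9 (by positivity)
    -- g₀ annihilates u and the range of P₀, so only v − P₀v, of order ‖P n − P₀‖, contributes.
    have h8 : ⟪g₀, z⟫ = ⟪g₀, v - P₀ v⟫ := by
      rw [inner_sub_right, hg _ (hPi v), inner_add_right, real_inner_smul_right, hu]
      ring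
    have h9 : |⟪g₀, z⟫| ≤ ‖g₀‖ * (e * (K₂ * ‖z‖)) := by
      rw [h8]
      refine (abs_real_inner_le_norm _ _).trans ?_
      gcongr
      exact (hdiff hv).trans (by gcongr)
    have h10 : |⟪G n u - g₀, z⟫| ≤ ‖G n u - g₀‖ * ‖z‖ := abs_real_inner_le_norm _ _
    calc |⟪G n u, z⟫| = |⟪G n u - g₀, z⟫ + ⟪g₀, z⟫| := by rw [inner_sub_left, sub_add_cancel]
      _ ≤ |⟪G n u - g₀, z⟫| + |⟪g₀, z⟫| := abs_add_le _ _
      _ ≤ (‖G n u - g₀‖ + ‖g₀‖ * e * K₂) * ‖z‖ := by linarith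
      _ ≤ η * ‖z‖ := by gcongr
  obtain ⟨a, ha1, ha2, ha3⟩ := hmain (G n) Z hZ u c1 c2 c3
  -- Because u ∈ Z, the point a = (a − u) + u lies in Z as well; one orthogonality relation on Z
  -- yields both constraints.
  refine ⟨a, ha1.trans (min_le_left _ _), ha3 a ?_, fun v hv =>
    ha3 v (Submodule.mem_sup_left (hE.2 hv))⟩
  rw [← sub_add_cancel a u]
  exact Z.add_mem ha2 huZ

end Zeros

/-! ### Oscillation of a function controlled by its weak derivative. -/

section Oscillation

open scoped Convolution

/-- The primitive of the difference of two translated mollifiers. -/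
def mollifierPrimitive (ρ : ℝ → ℝ) (x y t : ℝ) : ℝ := ∫ s in (t - x)..(t - y), ρ s

theorem hasDerivAt_mollifierPrimitive {ρ : ℝ → ℝ} (hρ : Continuous ρ) (x y t : ℝ) :
    HasDerivAt (mollifierPrimitive ρ x y) (ρ (t - y) - ρ (t - x)) t := by
  have h0 (c : ℝ) : HasDerivAt (fun t => ∫ s in (0 : ℝ)..(t - c), ρ s) (ρ (t - c)) t := by
    have h1 : HasDerivAt (fun z => ∫ s in (0 : ℝ)..z, ρ s) (ρ (t - c)) (t - c) :=
      intervalIntegral.integral_hasDerivAt_right (hρ.intervalIntegrable _ _)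
        hρ.stronglyMeasurable.stronglyMeasurableAtFilter hρ.continuousAt
    have h2 := h1.comp t ((hasDerivAt_id' t).sub_const c)
    rw [mul_one] at h2
    exact h2
  refine ((h0 y).sub (h0 x)).congr_of_eventuallyEq (Eventually.of_forall fun t => ?_)
  exact (intervalIntegral.integral_interval_sub_left (hρ.intervalIntegrable _ _)
    (hρ.intervalIntegrable _ _)).symm

theorem contDiff_mollifierPrimitive {ρ : ℝ → ℝ} (hρ : ContDiff ℝ (⊤ : ℕ∞) ρ) (x y : ℝ) :
    ContDiff ℝ (⊤ : ℕ∞) (mollifierPrimitive ρ x y) := by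
  rw [contDiff_infty_iff_deriv]
  refine ⟨fun t => (hasDerivAt_mollifierPrimitive hρ.continuous x y t).differentiableAt, ?_⟩
  have : deriv (mollifierPrimitive ρ x y) = fun t => ρ (t - y) - ρ (t - x) :=
    funext fun t => (hasDerivAt_mollifierPrimitive hρ.continuous x y t).deriv
  rw [this]
  fun_prop

/-- The weak derivative is tested with the primitive Φ of the difference of mollifiers centred at y
and at x: |Φ| ≤ 1, and Φ vanishes outside (a, b) for narrow mollifiers. The set s consists of the
points where the mollifications of u converge to u, so it does not depend on the interval. -/
theorem oscillation_le {u g : ℝ → ℝ} (hu : LocallyIntegrable u) (hg : LocallyIntegrable g)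
    (h : HasWeakDeriv u g) : ∃ s : Set ℝ, (∀ᵐ x, x ∈ s) ∧ ∀ x ∈ s, ∀ y ∈ s, ∀ a b : ℝ,
      x ∈ Ioo a b → y ∈ Ioo a b → |u x - u y| ≤ ∫ t in Ioo a b, |g t| := by
  let φ : ℕ → ContDiffBump (0 : ℝ) := fun n =>
    ⟨1 / ((n : ℝ) + 1) / 2, 1 / ((n : ℝ) + 1), by positivity, by
      have : (0 : ℝ) < 1 / ((n : ℝ) + 1) := by positivity
      linarith⟩
  have hφ : Tendsto (fun n => (φ n).rOut) atTop (𝓝 0) := tendsto_one_div_add_atTop_nhds_zero_nat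
  have hφ2 : ∀ᶠ n in atTop, (φ n).rOut ≤ 2 * (φ n).rIn := Eventually.of_forall fun n => by
    simp only [φ]; linarith
  refine ⟨_, ContDiffBump.ae_convolution_tendsto_right_of_locallyIntegrable hφ hφ2 hu, ?_⟩
  intro x hx y hy a b hxa hyb
  have hconv (n : ℕ) (z : ℝ) : ((φ n).normed volume ⋆[ContinuousLinearMap.lsmul ℝ ℝ] u) z
      = ∫ t, u t * (φ n).normed volume (t - z) := by
    rw [convolution_eq_swap]
    refine integral_congr_ae (Eventually.of_forall fun t => ?_)
    simp only [ContinuousLinearMap.lsmul_apply, smul_eq_mul]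
    rw [← (φ n).normed_neg (z - t), neg_sub, mul_comm]
  have hlim := ((Tendsto.sub hx hy).abs)
  refine le_of_tendsto hlim ?_
  set d := min (min (x - a) (b - x)) (min (y - a) (b - y))
  have hd : 0 < d := by
    simp only [d, lt_min_iff, sub_pos]
    exact ⟨⟨hxa.1, hxa.2⟩, hyb.1, hyb.2⟩
  filter_upwards [hφ.eventually_lt_const hd] with n hn
  simp only [d, lt_min_iff] at hn
  obtain ⟨⟨hn1, hn2⟩, hn3, hn4⟩ := hn
  set ρ := (φ n).normed volume
  have hρ : ContDiff ℝ (⊤ : ℕ∞) ρ := (φ n).contDiff_normed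
  have hρc : HasCompactSupport ρ := (φ n).hasCompactSupport_normed
  have hρ0 (z : ℝ) : 0 ≤ ρ z := (φ n).nonneg_normed z
  have hρi : Integrable ρ := (φ n).integrable_normed
  have hρs (z : ℝ) (hz : (φ n).rOut ≤ |z|) : ρ z = 0 := by
    by_contra hne
    have : z ∈ Function.support ρ := hne
    rw [(φ n).support_normed_eq] at this
    simp at this
    linarith
  set Φ := mollifierPrimitive ρ x y
  have hΦ1 (t : ℝ) : |Φ t| ≤ 1 := by
    calc |Φ t| ≤ ∫ s in uIoc (t - x) (t - y), ‖ρ s‖ := by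
          rw [← Real.norm_eq_abs]
          exact intervalIntegral.norm_integral_le_integral_norm_uIoc
      _ ≤ ∫ s, ‖ρ s‖ := setIntegral_le_integral hρi.norm
          (Eventually.of_forall fun _ => norm_nonneg _)
      _ = ∫ s, ρ s := by
          refine integral_congr_ae (Eventually.of_forall fun t => ?_)
          exact Real.norm_of_nonneg (hρ0 t)
      _ = 1 := (φ n).integral_normed
  have hΦ0 (t : ℝ) (ht : t ∉ Ioo a b) : Φ t = 0 := by
    refine intervalIntegral.integral_zero_ae (Eventually.of_forall fun s hs => hρs s ?_)
    rw [mem_uIoc] at hs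
    simp only [mem_Ioo, not_and_or, not_lt] at ht
    rw [le_abs]
    rcases ht with ht | ht
    · right
      rcases hs with hs | hs <;> linarith [hs.2]
    · left
      rcases hs with hs | hs <;> linarith [hs.1]
  have hΦc : HasCompactSupport Φ :=
    HasCompactSupport.intro isCompact_Icc fun t ht => hΦ0 t fun h' => ht (Ioo_subset_Icc_self h')
  have hder (t : ℝ) : deriv Φ t = ρ (t - y) - ρ (t - x) :=
    (hasDerivAt_mollifierPrimitive hρ.continuous x y t).deriv
  have hint (z : ℝ) : Integrable fun t => u t * ρ (t - z) := by
    have hc : Continuous fun t => ρ (t - z) := by fun_prop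
    have hcs : HasCompactSupport fun t => ρ (t - z) :=
      hρc.comp_homeomorph (Homeomorph.subRight z)
    refine (hu.integrable_smul_left_of_hasCompactSupport hc hcs).congr
      (Eventually.of_forall fun t => ?_)
    simp [mul_comm]
  have hw := h Φ (contDiff_mollifierPrimitive hρ x y) hΦc
  have e : ∫ t, u t * deriv Φ t = (∫ t, u t * ρ (t - y)) - ∫ t, u t * ρ (t - x) := by
    rw [← integral_sub (hint y) (hint x)]
    refine integral_congr_ae (Eventually.of_forall fun t => ?_)
    simp only [hder]
    ring
  rw [hconv, hconv]
  have e2 : (∫ t, u t * ρ (t - x)) - ∫ t, u t * ρ (t - y) = ∫ t, g t * Φ t := by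
    linarith
  rw [e2]
  have hgi : IntegrableOn (fun t => |g t|) (Ioo a b) :=
    ((hg.integrableOn_isCompact isCompact_Icc).mono_set Ioo_subset_Icc_self).norm
  calc |∫ t, g t * Φ t| ≤ ∫ t, ‖g t * Φ t‖ := by
        rw [← Real.norm_eq_abs]
        exact norm_integral_le_integral_norm _
    _ = ∫ t in Ioo a b, ‖g t * Φ t‖ := by
        refine (setIntegral_eq_integral_of_forall_compl_eq_zero fun t ht => ?_).symm
        rw [hΦ0 t ht, mul_zero, norm_zero]
    _ ≤ ∫ t in Ioo a b, |g t| := by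
        refine integral_mono_of_nonneg (Eventually.of_forall fun t => norm_nonneg _) hgi
          (Eventually.of_forall fun t => ?_)
        simp only [norm_mul, Real.norm_eq_abs]
        exact mul_le_of_le_one_right (abs_nonneg _) (hΦ1 t)

/-- Cauchy–Schwarz, from ∫(|g| − c)² ≥ 0 with c the mean of |g| over s. -/
theorem sq_integral_abs_le {g : ℝ → ℝ} {s : Set ℝ} (hs : volume s ≠ ⊤)
    (hg : MemLp g 2 (volume.restrict s)) :
    (∫ t in s, |g t|) ^ 2 ≤ volume.real s * ∫ t in s, g t ^ 2 := by
  have hfin : IsFiniteMeasure (volume.restrict s) := ⟨by simpa using hs.lt_top⟩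
  have h1 : Integrable (fun t => |g t|) (volume.restrict s) :=
    (hg.integrable (by norm_num)).norm
  have h2 : Integrable (fun t => g t ^ 2) (volume.restrict s) := hg.integrable_sq
  set D := ∫ t in s, |g t|
  set B := ∫ t in s, g t ^ 2
  set l := volume.real s
  have hl : 0 ≤ l := measureReal_nonneg
  have hkey (c : ℝ) : 0 ≤ B - 2 * c * D + c ^ 2 * l := by
    have : B - 2 * c * D + c ^ 2 * l = ∫ t in s, (|g t| - c) ^ 2 := by
      have e : ∀ t, (|g t| - c) ^ 2 = g t ^ 2 - 2 * c * |g t| + c ^ 2 := fun t => by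
        rw [← sq_abs (g t)]; ring
      simp only [e]
      have i1 : Integrable (fun t => 2 * c * |g t|) (volume.restrict s) := h1.const_mul _
      have i2 : Integrable (fun t => g t ^ 2 - 2 * c * |g t|) (volume.restrict s) := h2.sub i1
      rw [integral_add i2 (integrable_const _), integral_sub h2 i1, integral_const_mul,
        integral_const]
      simp [l, B, D, mul_comm]
    rw [this]
    exact integral_nonneg fun t => sq_nonneg _
  rcases hl.eq_or_lt with h0 | h0
  · have h3 : volume.restrict s = 0 := by
      rw [Measure.restrict_eq_zero]
      rcases (ENNReal.toReal_eq_zero_iff _).1 h0.symm with h | h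
      · exact h
      · exact absurd h hs
    simp [D, h3]
    positivity
  · have := hkey (D / l)
    field_simp at this
    nlinarith

end Oscillation

/-! ### The local H¹ bound. -/

section Sobolev

theorem memLp_toL2 (u : H1) : MemLp u.toL2 2 volume := Lp.memLp u.toL2

theorem memLp_wderiv (u : H1) : MemLp u.wderiv 2 volume := Lp.memLp u.wderiv

theorem hasWeakDeriv (u : H1) : HasWeakDeriv u.toL2 u.wderiv := u.2

/-- The local `H¹` bound: on an interval of length `l`, `u² ≤ (2/l) ∫ u² + 2 l ∫ u'²`. -/
theorem sq_le_of_mem_Ioc (u : H1) : ∀ᵐ x, ∀ a l : ℝ, 0 < l → x ∈ Ioo a (a + l) →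
    u.toL2 x ^ 2 ≤ 2 / l * (∫ t in Ioc a (a + l), u.toL2 t ^ 2)
      + 2 * l * ∫ t in Ioc a (a + l), u.wderiv t ^ 2 := by
  have hu : LocallyIntegrable u.toL2 := (memLp_toL2 u).locallyIntegrable (by norm_num)
  have hg : LocallyIntegrable u.wderiv := (memLp_wderiv u).locallyIntegrable (by norm_num)
  obtain ⟨s, hs, hosc⟩ := oscillation_le hu hg (hasWeakDeriv u)
  filter_upwards [hs] with x hx a l hl hxa
  have hv : volume.real (Ioo a (a + l)) = l := by
    rw [Measure.real, Real.volume_Ioo]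
    simp [hl.le]
  rw [integral_Ioc_eq_integral_Ioo, integral_Ioc_eq_integral_Ioo]
  have hne : volume (Ioo a (a + l)) ≠ ⊤ := by simp
  have hfin : IsFiniteMeasure (volume.restrict (Ioo a (a + l))) := ⟨by simp⟩
  have hC := sq_integral_abs_le hne ((memLp_wderiv u).restrict _)
  rw [hv] at hC
  set D := ∫ t in Ioo a (a + l), |u.wderiv t|
  have hi : IntegrableOn (fun t => u.toL2 t ^ 2) (Ioo a (a + l)) :=
    (memLp_toL2 u).integrable_sq.integrableOn
  have h1 : ∫ t in Ioo a (a + l), u.toL2 x ^ 2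
      ≤ ∫ t in Ioo a (a + l), (2 * u.toL2 t ^ 2 + 2 * D ^ 2) := by
    refine setIntegral_mono_on_ae (integrable_const _) ((hi.const_mul 2).add (integrable_const _))
      measurableSet_Ioo ?_
    filter_upwards [hs] with y hy hya
    have h2 := hosc x hx y hy a (a + l) hxa hya
    have h3 : (u.toL2 x - u.toL2 y) ^ 2 ≤ D ^ 2 := by
      rw [← sq_abs (u.toL2 x - u.toL2 y)]
      gcongr
    -- p² ≤ 2q² + 2(p − q)² is (p − 2q)² ≥ 0. The result is then averaged over y.
    nlinarith [sq_nonneg (u.toL2 x - 2 * u.toL2 y)]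
  rw [integral_add (hi.const_mul 2) (integrable_const _), integral_const_mul] at h1
  simp only [integral_const, measureReal_restrict_apply_univ, hv, smul_eq_mul] at h1
  set B := ∫ t in Ioo a (a + l), u.toL2 t ^ 2
  rw [div_mul_eq_mul_div, ← sub_le_iff_le_add, le_div_iff₀ hl]
  nlinarith

end Sobolev

/-! ### H¹ as a Hilbert space whose elements are determined by their functions. -/

section Hilbert

/-- For each test function both sides of the defining identity are L² products with fixed elements,
so the graph is an intersection of closed sets. -/
instance : CompleteSpace H1 := by
  have hcl : IsClosed (sobolevGraph : Set (WithLp 2 (L2 × L2))) := by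
    have e : (sobolevGraph : Set (WithLp 2 (L2 × L2))) =
        ⋂ (φ : ℝ → ℝ) (_ : ContDiff ℝ (⊤ : ℕ∞) φ) (_ : HasCompactSupport φ),
          {p : WithLp 2 (L2 × L2) | ∫ x, p.fst x * deriv φ x = -∫ x, p.snd x * φ x} := by
      ext p
      simp only [mem_iInter]
      rfl
    rw [e]
    refine isClosed_iInter fun φ => isClosed_iInter fun hφ => isClosed_iInter fun hc => ?_
    have hpair {ψ : ℝ → ℝ} (h : Continuous ψ) (hc : HasCompactSupport ψ) :
        ∃ w : L2, ∀ f : L2, ∫ x, f x * ψ x = ⟪w, f⟫ := by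
      have hm : MemLp ψ 2 volume := h.memLp_of_hasCompactSupport hc
      refine ⟨hm.toLp ψ, fun f => ?_⟩
      rw [L2.inner_def]
      refine integral_congr_ae ?_
      filter_upwards [hm.coeFn_toLp] with x hx
      rw [hx]
      rfl
    obtain ⟨w1, h1⟩ := hpair (hφ.continuous_deriv (by simp)) hc.deriv
    obtain ⟨w2, h2⟩ := hpair hφ.continuous hc
    simp only [h1, h2]
    have c1 : Continuous fun p : WithLp 2 (L2 × L2) => p.fst :=
      (WithLp.continuous_fst _ _ _)
    have c2 : Continuous fun p : WithLp 2 (L2 × L2) => p.snd :=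
      (WithLp.continuous_snd _ _ _)
    exact isClosed_eq (continuous_const.inner c1) (continuous_const.inner c2).neg
  exact hcl.completeSpace_coe

/-- The embedding `H¹ → L²`. -/
def toL2ₗ : H1 →ₗ[ℝ] L2 where
  toFun := H1.toL2
  map_add' _ _ := rfl
  map_smul' _ _ := rfl

theorem H1.norm_sq (u : H1) : ‖u‖ ^ 2 = ‖u.toL2‖ ^ 2 + ‖u.wderiv‖ ^ 2 :=
  WithLp.prod_norm_sq_eq_of_L2 _

theorem H1.inner_eq (u v : H1) : ⟪u, v⟫ = ⟪u.toL2, v.toL2⟫ + ⟪u.wderiv, v.wderiv⟫ := rfl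

theorem H1.norm_toL2_le (u : H1) : ‖u.toL2‖ ≤ ‖u‖ := by
  refine le_of_sq_le_sq ?_ (norm_nonneg _)
  rw [H1.norm_sq u]
  nlinarith [sq_nonneg ‖u.wderiv‖]

theorem H1.norm_wderiv_le (u : H1) : ‖u.wderiv‖ ≤ ‖u‖ := by
  refine le_of_sq_le_sq ?_ (norm_nonneg _)
  rw [H1.norm_sq u]
  nlinarith [sq_nonneg ‖u.toL2‖]

theorem H1.toL2_sub (u v : H1) : (u - v).toL2 = u.toL2 - v.toL2 := rfl

theorem H1.coe_add (u v : H1) : ∀ᵐ x, (u + v).toL2 x = u.toL2 x + v.toL2 x :=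
  Lp.coeFn_add _ _

theorem H1.coe_sub (u v : H1) : ∀ᵐ x, (u - v).toL2 x = u.toL2 x - v.toL2 x :=
  Lp.coeFn_sub _ _

theorem H1.coe_smul (c : ℝ) (u : H1) : ∀ᵐ x, (c • u).toL2 x = c * u.toL2 x :=
  Lp.coeFn_smul _ _

theorem H1.coe_zero : ∀ᵐ x, (0 : H1).toL2 x = 0 := Lp.coeFn_zero _ _ _

theorem integral_sq_eq (f : L2) : ∫ x, f x ^ 2 = ‖f‖ ^ 2 := by
  rw [← real_inner_self_eq_norm_sq, L2.inner_def]
  refine integral_congr_ae (Eventually.of_forall fun x => ?_)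
  simp [sq]

/-- Weak derivatives are unique: an element of `H¹` is determined by the underlying function. -/
theorem H1.ext_toL2 {u v : H1} (h : u.toL2 = v.toL2) : u = v := by
  have h0 : (u - v).toL2 = 0 := by rw [H1.toL2_sub, h, sub_self]
  have hw : ∀ φ : ℝ → ℝ, ContDiff ℝ (⊤ : ℕ∞) φ → HasCompactSupport φ →
      ∫ x, φ x • (u - v).wderiv x = 0 := by
    intro φ hφ hc
    have h1 := hasWeakDeriv (u - v) φ hφ hc
    have h2 : ∫ x, (u - v).toL2 x * deriv φ x = 0 := by
      refine integral_eq_zero_of_ae ?_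
      rw [h0]
      filter_upwards [Lp.coeFn_zero ℝ 2 (volume : Measure ℝ)] with x hx
      rw [hx]
      simp
    rw [h2] at h1
    simp only [smul_eq_mul, mul_comm (φ _)]
    linarith
  have h1 := ae_eq_zero_of_integral_contDiff_smul_eq_zero
    ((memLp_wderiv (u - v)).locallyIntegrable (by norm_num)) hw
  have h2 : (u - v).wderiv = 0 := by
    refine Lp.ext ?_
    filter_upwards [h1, Lp.coeFn_zero ℝ 2 (volume : Measure ℝ)] with x hx hx0
    rw [hx, hx0]
    rfl
  have h3 := H1.norm_sq (u - v)
  rw [h0, h2] at h3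
  simp at h3
  exact sub_eq_zero.1 (norm_eq_zero.1 (by simpa using h3))

end Hilbert

/-! ### Stepanov functions as form multipliers on H¹. -/

section Multiplier

/-- The bound on the interval `(k l, (k+1) l]`. -/
def localBound (u : H1) (l : ℝ) (k : ℤ) : ℝ :=
  2 / l * (∫ t in Ioc (k • l) ((k + 1) • l), u.toL2 t ^ 2)
      + 2 * l * ∫ t in Ioc (k • l) ((k + 1) • l), u.wderiv t ^ 2

theorem localBound_nonneg (u : H1) {l : ℝ} (hl : 0 < l) (k : ℤ) : 0 ≤ localBound u l k := by
  have h1 : 0 ≤ ∫ t in Ioc (k • l) ((k + 1) • l), u.toL2 t ^ 2 :=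
    integral_nonneg fun _ => sq_nonneg _
  have h2 : 0 ≤ ∫ t in Ioc (k • l) ((k + 1) • l), u.wderiv t ^ 2 :=
    integral_nonneg fun _ => sq_nonneg _
  rw [localBound]
  positivity

theorem hasSum_integral_sq (f : L2) {l : ℝ} (hl : 0 < l) :
    HasSum (fun k : ℤ => ∫ t in Ioc (k • l) ((k + 1) • l), f t ^ 2) (‖f‖ ^ 2) := by
  have h := hasSum_integral_iUnion (μ := volume) (f := fun t => f t ^ 2)
    (s := fun k : ℤ => Ioc (k • l) ((k + 1) • l)) (fun k => measurableSet_Ioc)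
    (pairwise_disjoint_Ioc_zsmul l) (by
      exact (Lp.memLp f).integrable_sq.integrableOn)
  rwa [iUnion_Ioc_zsmul hl, setIntegral_univ, integral_sq_eq] at h

theorem hasSum_localBound (u : H1) {l : ℝ} (hl : 0 < l) :
    HasSum (localBound u l) (2 / l * ‖u.toL2‖ ^ 2 + 2 * l * ‖u.wderiv‖ ^ 2) :=
  ((hasSum_integral_sq u.toL2 hl).mul_left _).add ((hasSum_integral_sq u.wderiv hl).mul_left _)

theorem sq_le_localBound (u : H1) {l : ℝ} (hl : 0 < l) (k : ℤ) :
    ∀ᵐ x ∂(volume.restrict (Ioc (k • l) ((k + 1) • l))), u.toL2 x ^ 2 ≤ localBound u l k := by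
  have h : ∀ᵐ x ∂(volume.restrict (Ioo (k • l) ((k + 1) • l))),
      u.toL2 x ^ 2 ≤ localBound u l k := by
    rw [ae_restrict_iff' measurableSet_Ioo]
    filter_upwards [sq_le_of_mem_Ioc u] with x hx hxk
    have e : (k + 1) • l = k • l + l := by rw [add_smul, one_smul]
    have := hx (k • l) l hl (by rwa [← e])
    rwa [← e] at this
  rwa [Measure.restrict_congr_set Ioo_ae_eq_Ioc] at h

theorem setLIntegral_le_mass (p : ℝ → ℝ≥0∞) {l : ℝ} (hl1 : l ≤ 1) (k : ℤ) :
    ∫⁻ x in Ioc (k • l) ((k + 1) • l), p x ≤ uniformLocalMass p := by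
  refine le_trans ?_ (le_iSup _ (k • l))
  refine lintegral_mono_set fun x hx => ⟨hx.1.le, hx.2.trans ?_⟩
  rw [add_smul, one_smul]
  linarith

/-- On each cell h is at most c k, and p has at most its uniform local mass because l ≤ 1. No
measurability of p is required, since only finite constants are pulled out of integrals; this
matters when p is a supremum over uncountably many u. -/
theorem lintegral_mul_le_of_local {p h : ℝ → ℝ≥0∞} {c : ℤ → ℝ} {S : ℝ} (hc : ∀ k, 0 ≤ c k)
    (hS : HasSum c S) {l : ℝ} (hl : 0 < l) (hl1 : l ≤ 1)
    (hh : ∀ k : ℤ, ∀ᵐ x ∂(volume.restrict (Ioc (k • l) ((k + 1) • l))),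
      h x ≤ ENNReal.ofReal (c k)) :
    ∫⁻ x, p x * h x ≤ uniformLocalMass p * ENNReal.ofReal S := by
  rw [← setLIntegral_univ, ← iUnion_Ioc_zsmul hl,
    lintegral_iUnion (fun k => measurableSet_Ioc) (pairwise_disjoint_Ioc_zsmul l),
    ← hS.tsum_eq, ENNReal.ofReal_tsum_of_nonneg hc hS.summable, ← ENNReal.tsum_mul_left]
  refine ENNReal.tsum_le_tsum fun k => ?_
  calc ∫⁻ x in Ioc (k • l) ((k + 1) • l), p x * h x
      ≤ ∫⁻ x in Ioc (k • l) ((k + 1) • l), p x * ENNReal.ofReal (c k) := by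
        refine lintegral_mono_ae ?_
        filter_upwards [hh k] with x hx
        gcongr
    _ = (∫⁻ x in Ioc (k • l) ((k + 1) • l), p x) * ENNReal.ofReal (c k) :=
        lintegral_mul_const' _ _ ENNReal.ofReal_ne_top
    _ ≤ _ := by gcongr; exact setLIntegral_le_mass p hl1 k

theorem enorm_sq_eq_ofReal (x : ℝ) : ‖x‖ₑ ^ 2 = ENNReal.ofReal (x ^ 2) := by
  rw [← ofReal_norm, ← ENNReal.ofReal_pow (norm_nonneg _), Real.norm_eq_abs, sq_abs]

/-- The Stepanov class acts on `H¹` with an arbitrarily small contribution of the derivative. -/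
theorem lintegral_mul_sq_le (p : ℝ → ℝ≥0∞) (u : H1) {l : ℝ} (hl : 0 < l) (hl1 : l ≤ 1) :
    ∫⁻ x, p x * ‖u.toL2 x‖ₑ ^ 2
      ≤ uniformLocalMass p * ENNReal.ofReal (2 / l * ‖u.toL2‖ ^ 2 + 2 * l * ‖u.wderiv‖ ^ 2) := by
  refine lintegral_mul_le_of_local (localBound_nonneg u hl) (hasSum_localBound u hl) hl hl1
    fun k => ?_
  filter_upwards [sq_le_localBound u hl k] with x hx
  rw [enorm_sq_eq_ofReal]
  exact ENNReal.ofReal_le_ofReal hx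

theorem lintegral_mul_mul_le_add (p : ℝ → ℝ≥0∞) (u v : H1) :
    ∫⁻ x, p x * (‖u.toL2 x‖ₑ * ‖v.toL2 x‖ₑ)
      ≤ uniformLocalMass p * ENNReal.ofReal (2 * ‖u‖ ^ 2 + 2 * ‖v‖ ^ 2) := by
  have hS := (hasSum_localBound u one_pos).add (hasSum_localBound v one_pos)
  have e : 2 / 1 * ‖u.toL2‖ ^ 2 + 2 * 1 * ‖u.wderiv‖ ^ 2
      + (2 / 1 * ‖v.toL2‖ ^ 2 + 2 * 1 * ‖v.wderiv‖ ^ 2) = 2 * ‖u‖ ^ 2 + 2 * ‖v‖ ^ 2 := by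
    rw [H1.norm_sq u, H1.norm_sq v]; ring
  rw [e] at hS
  refine lintegral_mul_le_of_local (fun k => add_nonneg (localBound_nonneg u one_pos k)
    (localBound_nonneg v one_pos k)) hS one_pos le_rfl fun k => ?_
  filter_upwards [sq_le_localBound u one_pos k, sq_le_localBound v one_pos k] with x hx hy
  rw [← enorm_mul, ← ofReal_norm, Real.norm_eq_abs, abs_mul]
  refine ENNReal.ofReal_le_ofReal ((?_ : _ ≤ u.toL2 x ^ 2 + v.toL2 x ^ 2).trans (add_le_add hx hy))
  rw [← sq_abs (u.toL2 x), ← sq_abs (v.toL2 x)]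
  nlinarith [sq_nonneg (|u.toL2 x| - |v.toL2 x|), sq_nonneg (|u.toL2 x|), sq_nonneg (|v.toL2 x|)]

/-- The additive bound is applied to tu and t⁻¹v; t² = ‖v‖/‖u‖ balances the two squares and turns
their sum into a product. -/
theorem lintegral_mul_mul_le (p : ℝ → ℝ≥0∞) (u v : H1) :
    ∫⁻ x, p x * (‖u.toL2 x‖ₑ * ‖v.toL2 x‖ₑ)
      ≤ uniformLocalMass p * ENNReal.ofReal (4 * ‖u‖ * ‖v‖) := by
  rcases eq_or_ne u 0 with rfl | hu
  · refine le_of_eq_of_le ?_ zero_le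
    rw [← lintegral_zero]
    refine lintegral_congr_ae ?_
    filter_upwards [H1.coe_zero] with x hx
    simp [hx]
  rcases eq_or_ne v 0 with rfl | hv
  · refine le_of_eq_of_le ?_ zero_le
    rw [← lintegral_zero]
    refine lintegral_congr_ae ?_
    filter_upwards [H1.coe_zero] with x hx
    simp [hx]
  have hu' : 0 < ‖u‖ := norm_pos_iff.2 hu
  have hv' : 0 < ‖v‖ := norm_pos_iff.2 hv
  set t := Real.sqrt (‖v‖ / ‖u‖)
  have ht : 0 < t := Real.sqrt_pos.2 (by positivity)
  have ht2 : t ^ 2 = ‖v‖ / ‖u‖ := Real.sq_sqrt (by positivity)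
  have h := lintegral_mul_mul_le_add p (t • u) (t⁻¹ • v)
  have e : 2 * ‖t • u‖ ^ 2 + 2 * ‖t⁻¹ • v‖ ^ 2 = 4 * ‖u‖ * ‖v‖ := by
    rw [norm_smul, norm_smul, mul_pow, mul_pow, Real.norm_of_nonneg ht.le,
      Real.norm_of_nonneg (inv_nonneg.2 ht.le), inv_pow, ht2]
    field_simp
    ring
  rw [e] at h
  refine le_of_eq_of_le (lintegral_congr_ae ?_) h
  filter_upwards [H1.coe_smul t u, H1.coe_smul t⁻¹ v] with x hx hy
  rw [hx, hy, ← enorm_mul, ← enorm_mul]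
  congr 2
  field_simp

/-- Functions in `H¹` are bounded. -/
theorem abs_le_norm (u : H1) : ∀ᵐ x, |u.toL2 x| ≤ 2 * ‖u‖ := by
  have h : ∀ k : ℤ, ∀ᵐ x ∂(volume.restrict (Ioc (k • (1 : ℝ)) ((k + 1) • (1 : ℝ)))),
      |u.toL2 x| ≤ 2 * ‖u‖ := by
    intro k
    filter_upwards [sq_le_localBound u one_pos k] with x hx
    have h1 := (hasSum_localBound u one_pos).summable.le_tsum k
      fun j _ => localBound_nonneg u one_pos j
    rw [(hasSum_localBound u one_pos).tsum_eq] at h1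
    have h2 := H1.norm_sq u
    refine abs_le_of_sq_le_sq ?_ (by positivity)
    nlinarith [sq_nonneg ‖u‖]
  have h' := (ae_restrict_iUnion_iff _ _).2 h
  rwa [iUnion_Ioc_zsmul (one_pos (α := ℝ)), Measure.restrict_univ] at h'

theorem uniformLocalMass_mono {p q : ℝ → ℝ≥0∞} (h : ∀ᵐ x, p x ≤ q x) :
    uniformLocalMass p ≤ uniformLocalMass q :=
  iSup_mono fun _ => lintegral_mono_ae (ae_restrict_of_ae h)

theorem uniformLocalMass_add_const (p : ℝ → ℝ≥0∞) (c : ℝ≥0∞) :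
    uniformLocalMass (fun x => p x + c) ≤ uniformLocalMass p + c := by
  refine iSup_le fun t => ?_
  rw [lintegral_add_right _ measurable_const]
  refine add_le_add (le_iSup (fun t => ∫⁻ x in Icc t (t + 1), p x) t) ?_
  simp

/-- The integral form of the multiplier estimate. -/
theorem integrable_and_abs_integral_le {k : ℝ → ℝ} {p : ℝ → ℝ≥0∞} (hk : AEStronglyMeasurable k)
    (u v : H1) (h : ∀ᵐ x, ‖k x‖ₑ ≤ p x * (‖u.toL2 x‖ₑ * ‖v.toL2 x‖ₑ))
    (hp : uniformLocalMass p < ⊤) :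
    Integrable k ∧ |∫ x, k x| ≤ 4 * (uniformLocalMass p).toReal * ‖u‖ * ‖v‖ := by
  have h1 : ∫⁻ x, ‖k x‖ₑ ≤ uniformLocalMass p * ENNReal.ofReal (4 * ‖u‖ * ‖v‖) :=
    (lintegral_mono_ae h).trans (lintegral_mul_mul_le p u v)
  have h2 : uniformLocalMass p * ENNReal.ofReal (4 * ‖u‖ * ‖v‖) < ⊤ :=
    ENNReal.mul_lt_top hp ENNReal.ofReal_lt_top
  refine ⟨⟨hk, h1.trans_lt h2⟩, ?_⟩
  have h3 := (enorm_integral_le_lintegral_enorm k).trans h1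
  have h4 := ENNReal.toReal_mono h2.ne h3
  rw [ENNReal.toReal_mul, ENNReal.toReal_ofReal (by positivity), toReal_enorm,
    Real.norm_eq_abs] at h4
  linarith

end Multiplier

/-! ### The operator of the form on H¹, its invertibility, and its spectral splitting. -/

section FormOperator

theorem exists_op_of_bilin {H : Type*} [NormedAddCommGroup H] [InnerProductSpace ℝ H]
    [CompleteSpace H] (b : H →ₗ[ℝ] H →ₗ[ℝ] ℝ) {C : ℝ}
    (h : ∀ u v, |b u v| ≤ C * ‖u‖ * ‖v‖) : ∃ T : H →L[ℝ] H, ∀ u v, ⟪T u, v⟫ = b u v := by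
  let B : H →L[ℝ] H →L[ℝ] ℝ := b.mkContinuous₂ C h
  refine ⟨InnerProductSpace.continuousLinearMapOfBilin (𝕜 := ℝ) B, fun u v => ?_⟩
  rw [InnerProductSpace.continuousLinearMapOfBilin_apply]
  rfl

variable {V W : ℝ → ℝ}

theorem StepanovBounded.aesm (hV : StepanovBounded V) : AEStronglyMeasurable V :=
  hV.1.aestronglyMeasurable

theorem aesm_toL2 (u : H1) : AEStronglyMeasurable u.toL2 volume :=
  (memLp_toL2 u).aestronglyMeasurable

theorem integrable_potential (hV : StepanovBounded V) (u v : H1) :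
    Integrable (fun x => V x * u.toL2 x * v.toL2 x) ∧
      |∫ x, V x * u.toL2 x * v.toL2 x| ≤ 4 * (stepanovNorm V).toReal * ‖u‖ * ‖v‖ := by
  refine integrable_and_abs_integral_le (k := fun x => V x * u.toL2 x * v.toL2 x)
    (p := fun x => ‖V x‖ₑ) ((hV.aesm.mul (aesm_toL2 u)).mul (aesm_toL2 v)) u v (Eventually.of_forall fun x => ?_) hV.2
  rw [enorm_mul, enorm_mul, mul_assoc]

theorem integral_wderiv (u v : H1) : ∫ x, u.wderiv x * v.wderiv x = ⟪u.wderiv, v.wderiv⟫ := by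
  rw [L2.inner_def]
  refine integral_congr_ae (Eventually.of_forall fun x => ?_)
  simp [mul_comm]

theorem form_eq (V : ℝ → ℝ) (u v : H1) :
    form V u v = ⟪u.wderiv, v.wderiv⟫ + ∫ x, V x * u.toL2 x * v.toL2 x := by
  rw [form, integral_wderiv]

theorem form_comm (V : ℝ → ℝ) (u v : H1) : form V u v = form V v u := by
  rw [form_eq, form_eq, real_inner_comm]
  congr 1
  refine integral_congr_ae (Eventually.of_forall fun x => ?_)
  simp only
  ring

theorem form_add_left (hV : StepanovBounded V) (u u' v : H1) :
    form V (u + u') v = form V u v + form V u' v := by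
  have e : ∫ x, V x * (u + u').toL2 x * v.toL2 x
      = (∫ x, V x * u.toL2 x * v.toL2 x) + ∫ x, V x * u'.toL2 x * v.toL2 x := by
    rw [← integral_add (integrable_potential hV u v).1 (integrable_potential hV u' v).1]
    refine integral_congr_ae ?_
    filter_upwards [H1.coe_add u u'] with x hx
    rw [hx]
    ring
  rw [form_eq, form_eq, form_eq, e, show (u + u').wderiv = u.wderiv + u'.wderiv from rfl,
    inner_add_left]
  ring

theorem form_smul_left (V : ℝ → ℝ) (c : ℝ) (u v : H1) :
    form V (c • u) v = c * form V u v := by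
  have e : ∫ x, V x * (c • u).toL2 x * v.toL2 x = c * ∫ x, V x * u.toL2 x * v.toL2 x := by
    rw [← integral_const_mul]
    refine integral_congr_ae ?_
    filter_upwards [H1.coe_smul c u] with x hx
    rw [hx]
    ring
  rw [form_eq, form_eq, e, show (c • u).wderiv = c • u.wderiv from rfl, real_inner_smul_left]
  ring

theorem abs_form_le (hV : StepanovBounded V) (u v : H1) :
    |form V u v| ≤ (1 + 4 * (stepanovNorm V).toReal) * ‖u‖ * ‖v‖ := by
  rw [form_eq]
  have h1 := abs_real_inner_le_norm u.wderiv v.wderiv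
  have h2 := (integrable_potential hV u v).2
  have h3 : ‖u.wderiv‖ * ‖v.wderiv‖ ≤ ‖u‖ * ‖v‖ := by
    gcongr
    · exact u.norm_wderiv_le
    · exact v.norm_wderiv_le
  refine (abs_add_le _ _).trans ?_
  linarith

theorem exists_formOp (hV : StepanovBounded V) :
    ∃ T : H1 →L[ℝ] H1, ∀ u v, ⟪T u, v⟫ = form V u v := by
  have hr (u v v' : H1) : form V u (v + v') = form V u v + form V u v' := by
    rw [form_comm, form_add_left hV, form_comm V v, form_comm V v']
  have hs (c : ℝ) (u v : H1) : form V u (c • v) = c * form V u v := by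
    rw [form_comm, form_smul_left, form_comm V v]
  exact exists_op_of_bilin
    (LinearMap.mk₂ ℝ (form V) (form_add_left hV) (form_smul_left V) hr hs) (abs_form_le hV)

open Classical in
/-- The bounded operator on `H¹` representing the form of `V`. -/
def formOp (V : ℝ → ℝ) : H1 →L[ℝ] H1 :=
  if h : ∃ T : H1 →L[ℝ] H1, ∀ u v, ⟪T u, v⟫ = form V u v then h.choose else 0

theorem inner_formOp (hV : StepanovBounded V) (u v : H1) : ⟪formOp V u, v⟫ = form V u v := by
  have h := exists_formOp hV
  rw [formOp, dif_pos h]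
  exact h.choose_spec u v

theorem symm_formOp (hV : StepanovBounded V) : SymmOp (formOp V) := fun u v => by
  rw [inner_formOp hV, real_inner_comm, inner_formOp hV, form_comm]

theorem opNorm_le_of_inner {H : Type*} [NormedAddCommGroup H] [InnerProductSpace ℝ H]
    {T : H →L[ℝ] H} {C : ℝ} (hC : 0 ≤ C) (h : ∀ u v, |⟪T u, v⟫| ≤ C * ‖u‖ * ‖v‖) : ‖T‖ ≤ C := by
  refine T.opNorm_le_bound hC fun u => ?_
  have h1 := h u (T u)
  rw [real_inner_self_eq_norm_sq, abs_of_nonneg (sq_nonneg _)] at h1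
  rcases (norm_nonneg (T u)).eq_or_lt with h0 | h0
  · rw [← h0]; positivity
  · exact le_of_mul_le_mul_right (by linarith) h0

theorem StepanovBounded.sub_aux (hV : StepanovBounded V) (hW : StepanovBounded W) :
    StepanovBounded fun x => V x - W x := by
  refine ⟨hV.1.sub hW.1, ?_⟩
  refine lt_of_le_of_lt ?_ (ENNReal.add_lt_top.2 ⟨hV.2, hW.2⟩)
  refine iSup_le fun t => ?_
  calc ∫⁻ x in Icc t (t + 1), ‖V x - W x‖ₑ ≤ ∫⁻ x in Icc t (t + 1), (‖V x‖ₑ + ‖W x‖ₑ) :=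
        lintegral_mono fun x => enorm_sub_le
    _ = (∫⁻ x in Icc t (t + 1), ‖V x‖ₑ) + ∫⁻ x in Icc t (t + 1), ‖W x‖ₑ :=
        lintegral_add_left' hV.aesm.restrict.enorm _
    _ ≤ _ := add_le_add (le_iSup (fun t => ∫⁻ x in Icc t (t + 1), ‖V x‖ₑ) t)
        (le_iSup (fun t => ∫⁻ x in Icc t (t + 1), ‖W x‖ₑ) t)

theorem norm_formOp_sub_le (hV : StepanovBounded V) (hW : StepanovBounded W) :
    ‖formOp V - formOp W‖ ≤ 4 * (stepanovNorm fun x => V x - W x).toReal := by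
  refine opNorm_le_of_inner (by positivity) fun u v => ?_
  rw [sub_apply, inner_sub_left, inner_formOp hV, inner_formOp hW, form_eq,
    form_eq, add_sub_add_left_eq_sub, ← integral_sub (integrable_potential hV u v).1
    (integrable_potential hW u v).1]
  convert (integrable_potential (hV.sub_aux hW) u v).2 using 4
  ring

/-- The embedding `H¹ → L²` as a bounded operator. -/
def toL2L : H1 →L[ℝ] L2 := toL2ₗ.mkContinuous 1 fun u => by
  rw [one_mul]; exact u.norm_toL2_le

/-- The operator on `H¹` representing the inner product of `L²`. -/
def l2Op : H1 →L[ℝ] H1 := (ContinuousLinearMap.adjoint toL2L) ∘L toL2L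

theorem inner_l2Op (u v : H1) : ⟪l2Op u, v⟫ = ⟪u.toL2, v.toL2⟫ :=
  ContinuousLinearMap.adjoint_inner_left toL2L v (toL2L u)

theorem symm_l2Op : SymmOp l2Op := fun u v => by
  rw [inner_l2Op, real_inner_comm, real_inner_comm (l2Op v), inner_l2Op]

/-- The form is bounded below by half of the `H¹` norm, up to the `L²` norm. -/
theorem exists_garding (hV : StepanovBounded V) :
    ∃ K > (0 : ℝ), LowerBd (1 / 2) (formOp V + K • l2Op) := by
  set m := (stepanovNorm V).toReal
  have hm : 0 ≤ m := ENNReal.toReal_nonneg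
  -- Cells this short give the derivative the weight 2lm ≤ 1/2, absorbed by ‖u'‖². The remaining
  -- weight 2m/l of ‖u‖₂² determines K.
  set l := 1 / (4 * (m + 1))
  have hl : 0 < l := by positivity
  have hl1 : l ≤ 1 := by
    rw [div_le_one (by positivity)]
    linarith
  have hml : 2 * l * m ≤ 1 / 2 := by
    simp only [l]
    rw [← sub_nonneg]
    field_simp
    ring_nf
    positivity
  refine ⟨2 / l * m + 1, by positivity, fun u => ?_⟩
  have h1 := lintegral_mul_sq_le (fun x => ‖V x‖ₑ) u hl hl1
  have h2 : |∫ x, V x * u.toL2 x * u.toL2 x|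
      ≤ m * (2 / l * ‖u.toL2‖ ^ 2 + 2 * l * ‖u.wderiv‖ ^ 2) := by
    have h3 := enorm_integral_le_lintegral_enorm (μ := volume)
      fun x => V x * u.toL2 x * u.toL2 x
    have h4 : ∫⁻ x, ‖V x * u.toL2 x * u.toL2 x‖ₑ = ∫⁻ x, ‖V x‖ₑ * ‖u.toL2 x‖ₑ ^ 2 := by
      refine lintegral_congr fun x => ?_
      rw [enorm_mul, enorm_mul, sq, mul_assoc]
    rw [h4] at h3
    have h5 := ENNReal.toReal_mono (ENNReal.mul_lt_top hV.2 ENNReal.ofReal_lt_top).ne (h3.trans h1)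
    rw [ENNReal.toReal_mul, ENNReal.toReal_ofReal (by positivity), toReal_enorm,
      Real.norm_eq_abs] at h5
    exact h5
  have h3 : ⟪(formOp V + (2 / l * m + 1) • l2Op) u, u⟫
      = ‖u.wderiv‖ ^ 2 + (∫ x, V x * u.toL2 x * u.toL2 x) + (2 / l * m + 1) * ‖u.toL2‖ ^ 2 := by
    rw [add_apply, smul_apply, inner_add_left,
      real_inner_smul_left, inner_l2Op, inner_formOp hV, form_eq, real_inner_self_eq_norm_sq,
      real_inner_self_eq_norm_sq]
  rw [h3, H1.norm_sq u]
  have h4 := neg_le_of_abs_le h2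
  nlinarith [sq_nonneg ‖u.wderiv‖, sq_nonneg ‖u.toL2‖,
    mul_le_mul_of_nonneg_right hml (sq_nonneg ‖u.wderiv‖)]

/-- Injectivity is that of L. To reach h, coercivity gives w₁ with (L + K)w₁ = h in the form sense;
the defect K w₁ lies in L², where the inverse of L gives w₂ with L w₂ = K w₁, and w₁ + w₂ is the
solution. -/
theorem isUnit_formOp (hV : StepanovBounded V) (h0 : (0 : ℝ) ∉ NLS.spectrum V) :
    IsUnit (formOp V) := by
  obtain ⟨B, hB⟩ : (0 : ℝ) ∈ NLS.resolventSet V := by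
    by_contra h
    exact h0 h
  simp only [zero_smul, add_zero] at hB
  obtain ⟨K, hK, hA⟩ := exists_garding hV
  have hAu := isUnit_of_lowerBd (by norm_num) hA
  rw [ContinuousLinearMap.isUnit_iff_bijective]
  refine ⟨(injective_iff_map_eq_zero _).2 fun w hw => ?_, fun h => ?_⟩
  · have h1 : OperatorGraph V w.toL2 0 := ⟨w, rfl, fun v => by
      rw [← inner_formOp hV, hw, inner_zero_left, inner_zero_left]⟩
    have h2 := (hB _ _).1 h1
    rw [map_zero] at h2
    exact H1.ext_toL2 h2
  · obtain ⟨w₁, hw₁⟩ := (ContinuousLinearMap.isUnit_iff_bijective.1 hAu).2 h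
    obtain ⟨w₂, -, hw₂⟩ := (hB (B (K • w₁.toL2)) (K • w₁.toL2)).2 rfl
    refine ⟨w₁ + w₂, ext_inner_right ℝ fun v => ?_⟩
    rw [map_add, inner_add_left, inner_formOp hV w₂, hw₂, ← hw₁]
    rw [add_apply, smul_apply, inner_add_left, real_inner_smul_left,
      real_inner_smul_left, inner_l2Op]

/-- A Stepanov bounded potential with `0` in the resolvent set of `L`. -/
structure Gapped (V : ℝ → ℝ) : Prop where
  bdd : StepanovBounded V
  isUnit : IsUnit (formOp V)

/-- `K` is a constant of coercivity: the form plus `K` times the `L²` product is coercive. -/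
def CoerciveShift (V : ℝ → ℝ) (K : ℝ) : Prop := 0 < K ∧ ∃ c > 0, LowerBd c (formOp V + K • l2Op)

theorem Gapped.pencil (h : Gapped V) {K : ℝ} (hK : CoerciveShift V K) {χ : ℝ}
    (hχ : χ = 1 ∨ χ = -1) : Pencil (formOp V + K • l2Op) (χ • formOp V) where
  pos := ⟨(symm_formOp h.bdd).add (symm_l2Op.smul K), hK.2⟩
  symm := (symm_formOp h.bdd).smul χ
  isUnit := by
    rcases hχ with rfl | rfl
    · rw [one_smul]; exact h.isUnit
    · have e : (-1 : ℝ) • formOp V = -formOp V := by module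
      rw [e]; exact h.isUnit.neg

/-- The form of A is that of L plus K > 0 times the L² product, so once the spaces are orthogonal
for L, orthogonality in L² and for A coincide. -/
theorem isSpectralSplitting_iff (h : StepanovBounded V) {K : ℝ} (hK : 0 < K)
    {Ep En : Submodule ℝ H1} :
    IsSpectralSplitting V Ep En ↔ IsSplit (formOp V + K • l2Op) (formOp V) Ep En := by
  have e (u v : H1) : ⟪(formOp V + K • l2Op) u, v⟫ = form V u v + K * ⟪u.toL2, v.toL2⟫ := by
    rw [add_apply, smul_apply, inner_add_left,
      real_inner_smul_left, inner_l2Op, inner_formOp h]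
  constructor
  · intro hs
    refine ⟨hs.isCompl, fun u hu v hv => ?_, fun u hu v hv => ?_, fun u hu h0 => ?_,
      fun u hu h0 => ?_⟩
    · rw [e, hs.orthogonal u hu v hv, hs.form_orthogonal u hu v hv]; simp
    · rw [inner_formOp h]; exact hs.form_orthogonal u hu v hv
    · rw [inner_formOp h]; exact hs.pos u hu h0
    · rw [inner_formOp h]; exact hs.neg u hu h0
  · intro hs
    have hf : ∀ u ∈ Ep, ∀ v ∈ En, form V u v = 0 := fun u hu v hv => by
      rw [← inner_formOp h]; exact hs.orthogonal' u hu v hv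
    refine ⟨hs.isCompl, fun u hu v hv => ?_, hf, fun u hu h0 => ?_, fun u hu h0 => ?_⟩
    · have := hs.orthogonal u hu v hv
      rw [e, hf u hu v hv, zero_add] at this
      exact (mul_eq_zero.1 this).resolve_left hK.ne'
    · rw [← inner_formOp h]; exact hs.pos u hu h0
    · rw [← inner_formOp h]; exact hs.neg u hu h0

theorem IsSplit.neg_symm {A T : H1 →L[ℝ] H1} (hA : SymmOp A) (hT : SymmOp T)
    {Ep En : Submodule ℝ H1} (h : IsSplit A T Ep En) : IsSplit A (-T) En Ep where
  isCompl := h.isCompl.symm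
  orthogonal u hu v hv := by rw [hA, real_inner_comm]; exact h.orthogonal v hv u hu
  orthogonal' u hu v hv := by
    rw [neg_apply, inner_neg_left, hT, real_inner_comm,
      h.orthogonal' v hv u hu, neg_zero]
  pos u hu h0 := by
    rw [neg_apply, inner_neg_left]
    exact neg_pos.2 (h.neg u hu h0)
  neg u hu h0 := by
    rw [neg_apply, inner_neg_left]
    exact neg_lt_zero.2 (h.pos u hu h0)

theorem Gapped.splitting (h : Gapped V) {K : ℝ} (hK : CoerciveShift V K) (Ep En : Submodule ℝ H1) :
    IsSpectralSplitting V Ep En ↔ Ep = pencilPos (formOp V + K • l2Op) (formOp V) ∧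
      En = pencilNeg (formOp V + K • l2Op) (formOp V) := by
  have hp : Pencil (formOp V + K • l2Op) (formOp V) := by
    simpa using h.pencil hK (Or.inl rfl : (1 : ℝ) = 1 ∨ (1 : ℝ) = -1)
  rw [isSpectralSplitting_iff h.bdd hK.1]
  refine ⟨fun hs => hs.unique hp, ?_⟩
  rintro ⟨rfl, rfl⟩
  exact hp.isSplit

theorem Gapped.negSubspace_eq (h : Gapped V) {Ep En : Submodule ℝ H1}
    (hs : IsSpectralSplitting V Ep En) : negSubspace V = En := by
  obtain ⟨K, hK0, hK⟩ := exists_garding h.bdd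
  have hK' : CoerciveShift V K := ⟨hK0, _, by norm_num, hK⟩
  have h1 := (h.splitting hK' Ep En).1 hs
  have : {En | ∃ Ep, IsSpectralSplitting V Ep En} = {En} := by
    ext E
    simp only [mem_ofPred_eq, mem_singleton_iff]
    refine ⟨fun ⟨E', h'⟩ => ?_, fun h' => ⟨Ep, h' ▸ hs⟩⟩
    rw [((h.splitting hK' _ _).1 h').2, h1.2]
  rw [negSubspace, this, sSup_singleton]

theorem Gapped.posSubspace_eq (h : Gapped V) {Ep En : Submodule ℝ H1}
    (hs : IsSpectralSplitting V Ep En) : posSubspace V = Ep := by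
  obtain ⟨K, hK0, hK⟩ := exists_garding h.bdd
  have hK' : CoerciveShift V K := ⟨hK0, _, by norm_num, hK⟩
  have h1 := (h.splitting hK' Ep En).1 hs
  have : {Ep | ∃ En, IsSpectralSplitting V Ep En} = {Ep} := by
    ext E
    simp only [mem_ofPred_eq, mem_singleton_iff]
    refine ⟨fun ⟨E', h'⟩ => ?_, fun h' => ⟨En, h' ▸ hs⟩⟩
    rw [((h.splitting hK' _ _).1 h').1, h1.1]
  rw [posSubspace, this, sSup_singleton]

theorem Gapped.exists_splitting (h : Gapped V) : ∃ Ep En, IsSpectralSplitting V Ep En := by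
  obtain ⟨K, hK0, hK⟩ := exists_garding h.bdd
  exact ⟨_, _, (h.splitting ⟨hK0, _, by norm_num, hK⟩ _ _).2 ⟨rfl, rfl⟩⟩

/-- The positive subspace of L is the negative subspace of −L, so both values of χ are covered by
one pencil with T representing χL. -/
theorem Gapped.constraintSubspace_eq (h : Gapped V) {K : ℝ} (hK : CoerciveShift V K) {χ : ℝ}
    (hχ : χ = 1 ∨ χ = -1) :
    constraintSubspace χ V = pencilNeg (formOp V + K • l2Op) (χ • formOp V) := by
  have hp := h.pencil hK hχ
  have hs := (h.splitting hK _ _).2 ⟨rfl, rfl⟩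
  rcases hχ with rfl | rfl
  · rw [constraintSubspace, if_pos rfl, one_smul, h.negSubspace_eq hs]
  · rw [constraintSubspace, if_neg (by norm_num), h.posSubspace_eq hs]
    have e : (-1 : ℝ) • formOp V = -formOp V := by module
    rw [e] at hp ⊢
    have h2 := ((isSpectralSplitting_iff h.bdd hK.1).1 hs).neg_symm
      ((symm_formOp h.bdd).add (symm_l2Op.smul K)) (symm_formOp h.bdd)
    exact (h2.unique hp).2

end FormOperator

/-! ### Measurability of Carathéodory functions and of their compositions. -/

section Caratheodory

/-- A Carathéodory function coincides for a.e. `x` with one that is continuous in `u` for every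
`x` and jointly measurable. -/
theorem IsCaratheodory.exists_measurable {g : ℝ → ℝ → ℝ} (hg : IsCaratheodory g) :
    ∃ g' : ℝ → ℝ → ℝ, (∀ x, Continuous (g' x)) ∧
      Measurable (fun p : ℝ × ℝ => g' p.2 p.1) ∧ ∀ᵐ x, g x = g' x := by
  classical
  let h : ℚ → ℝ → ℝ := fun q => (hg.2 q).mk
  have hh : ∀ᵐ x, Continuous (g x) ∧ ∀ q : ℚ, g x q = h q x :=
    hg.1.and (ae_all_iff.2 fun q => (hg.2 q).ae_eq_mk)
  obtain ⟨N, hN, hNm, hN0⟩ := exists_measurable_superset_of_null (ae_iff.1 hh)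
  have hgood {x : ℝ} (hx : x ∉ N) : Continuous (g x) ∧ ∀ q : ℚ, g x q = h q x := by
    by_contra hc
    exact hx (hN hc)
  -- Off the measurable null set N, g is continuous in u and agrees at rational u with measurable
  -- versions; the value 0 on N keeps all sections continuous and measurable, irrational u being
  -- limits of rational ones.
  let g' : ℝ → ℝ → ℝ := fun x => if x ∈ N then 0 else g x
  have hcont (x : ℝ) : Continuous (g' x) := by
    by_cases hx : x ∈ N
    · simp only [g', if_pos hx]; exact continuous_zero
    · simp only [g', if_neg hx]; exact (hgood hx).1
  have hq (q : ℚ) : Measurable fun x => g' x q := by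
    have : (fun x => g' x q) = Nᶜ.indicator (h q) := by
      ext x
      by_cases hx : x ∈ N
      · simp [g', hx]
      · simp [g', hx, (hgood hx).2 q]
    rw [this]
    exact ((hg.2 q).measurable_mk).indicator hNm.compl
  have hm (u : ℝ) : Measurable fun x => g' x u := by
    obtain ⟨a, -, -, ha⟩ := Real.exists_seq_rat_strictMono_tendsto u
    refine measurable_of_tendsto_metrizable (fun n => hq (a n)) ?_
    rw [tendsto_pi_nhds]
    intro x
    exact ((hcont x).tendsto u).comp ha
  refine ⟨g', hcont, measurable_uncurry_of_continuous_of_measurable (u := fun u x => g' x u)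
    hcont hm, ?_⟩
  have : ∀ᵐ x, x ∉ N := measure_eq_zero_iff_ae_notMem.1 hN0
  filter_upwards [this] with x hx
  simp only [g', if_neg hx]

theorem IsCaratheodory.aemeasurable_comp {g : ℝ → ℝ → ℝ} (hg : IsCaratheodory g) {w : ℝ → ℝ}
    (hw : AEMeasurable w) : AEMeasurable fun x => g x (w x) := by
  obtain ⟨g', -, hm, he⟩ := hg.exists_measurable
  refine (hm.comp_aemeasurable (hw.prodMk aemeasurable_id)).congr ?_
  filter_upwards [he] with x hx
  rw [hx]
  rfl

theorem IsCaratheodory.aesm_comp {g : ℝ → ℝ → ℝ} (hg : IsCaratheodory g) (u : H1) :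
    AEStronglyMeasurable fun x => g x (u.toL2 x) :=
  (hg.aemeasurable_comp (aesm_toL2 u).aemeasurable).aestronglyMeasurable

theorem IsCaratheodory.primitive {g : ℝ → ℝ → ℝ} (hg : IsCaratheodory g) :
    IsCaratheodory (primitive g) := by
  refine ⟨?_, fun u => ?_⟩
  · filter_upwards [hg.1] with x hx
    exact intervalIntegral.continuous_primitive (fun a b => hx.intervalIntegrable a b) 0
  · obtain ⟨g', hc, hm, he⟩ := hg.exists_measurable
    have h1 : AEMeasurable fun x => ∫ s in (0 : ℝ)..u, g' x s := by
      have hs : StronglyMeasurable (fun p : ℝ × ℝ => g' p.1 p.2) :=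
        (hm.comp measurable_swap).stronglyMeasurable
      have h2 (s : Set ℝ) : Measurable fun x => ∫ y in s, g' x y :=
        (hs.integral_prod_right (ν := volume.restrict s)).measurable
      simp only [intervalIntegral]
      exact ((h2 _).sub (h2 _)).aemeasurable
    refine h1.congr ?_
    filter_upwards [he] with x hx
    rw [NLS.primitive, hx]

end Caratheodory

/-! ### Mean value estimates at a fixed x. -/

section Pointwise

theorem exists_mvt {φ : ℝ → ℝ} (hφ : Differentiable ℝ φ) (a b : ℝ) :
    ∃ ξ ∈ uIcc a b, φ b - φ a = deriv φ ξ * (b - a) := by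
  rcases lt_trichotomy a b with h | h | h
  · obtain ⟨ξ, hξ, he⟩ := exists_deriv_eq_slope φ h hφ.continuous.continuousOn
      hφ.differentiableOn
    refine ⟨ξ, Icc_subset_uIcc (Ioo_subset_Icc_self hξ), ?_⟩
    rw [he]
    field_simp [(sub_pos.2 h).ne']
  · subst h
    exact ⟨a, left_mem_uIcc, by simp⟩
  · obtain ⟨ξ, hξ, he⟩ := exists_deriv_eq_slope φ h hφ.continuous.continuousOn
      hφ.differentiableOn
    refine ⟨ξ, Icc_subset_uIcc' (Ioo_subset_Icc_self hξ), ?_⟩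
    rw [he]
    have : a - b ≠ 0 := (sub_pos.2 h).ne'
    field_simp
    ring

theorem mem_Icc_of_uIcc {a b ξ R : ℝ} (ha : |a| ≤ R) (hb : |b| ≤ R) (h : ξ ∈ uIcc a b) :
    ξ ∈ Icc (-R) R := by
  rw [abs_le] at ha hb
  exact (uIcc_subset_Icc (mem_Icc.2 ha) (mem_Icc.2 hb)) h

/-- The supremum of the derivative on `[-R, R]`. -/
def derivSup (R : ℝ) (g : ℝ → ℝ → ℝ) (x : ℝ) : ℝ≥0∞ := ⨆ u ∈ Icc (-R) R, ‖g x u‖ₑ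

theorem le_derivSup {R : ℝ} {g : ℝ → ℝ → ℝ} {x u : ℝ} (hu : u ∈ Icc (-R) R) :
    ‖g x u‖ₑ ≤ derivSup R g x :=
  le_iSup₂ (f := fun u (_ : u ∈ Icc (-R) R) => ‖g x u‖ₑ) u hu

theorem hasDerivAt_primitive {f : ℝ → ℝ → ℝ} {x : ℝ} (h : Continuous (f x)) (u : ℝ) :
    HasDerivAt (primitive f x) (f x u) u :=
  intervalIntegral.integral_hasDerivAt_right (h.intervalIntegrable _ _)
    h.stronglyMeasurable.stronglyMeasurableAtFilter h.continuousAt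

theorem enorm_sub_le_derivSup {f : ℝ → ℝ → ℝ} {x R a b : ℝ} (hf : ContDiff ℝ 1 (f x))
    (ha : |a| ≤ R) (hb : |b| ≤ R) :
    ‖f x b - f x a‖ₑ ≤ derivSup R (partialU f) x * ‖b - a‖ₑ := by
  obtain ⟨ξ, hξ, he⟩ := exists_mvt (hf.differentiable (by simp)) a b
  rw [he, enorm_mul]
  gcongr
  exact le_derivSup (g := partialU f) (mem_Icc_of_uIcc ha hb hξ)

/-- Both functions vanish at 0, so seminorms of f_u alone control f and, after one more integration,
F. This is why the envelope topology need not involve them. -/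
theorem enorm_diff_le_derivSup {f g : ℝ → ℝ → ℝ} {x R a : ℝ} (hf : ContDiff ℝ 1 (f x))
    (hg : ContDiff ℝ 1 (g x)) (hf0 : f x 0 = 0) (hg0 : g x 0 = 0) (ha : |a| ≤ R) :
    ‖f x a - g x a‖ₑ ≤ derivSup R (fun x u => partialU f x u - partialU g x u) x * ‖a‖ₑ := by
  have hfd := hf.differentiable (by simp)
  have hgd := hg.differentiable (by simp)
  obtain ⟨ξ, hξ, he⟩ := exists_mvt (hfd.sub hgd) 0 a
  simp only [Pi.sub_apply, hf0, hg0, sub_zero] at he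
  rw [deriv_sub (hfd ξ) (hgd ξ)] at he
  rw [he, enorm_mul]
  gcongr
  exact le_derivSup (g := fun x u => partialU f x u - partialU g x u)
    (mem_Icc_of_uIcc (by simpa using (abs_nonneg a).trans ha) ha hξ)

theorem abs_le_abs_of_mem_uIcc {a ξ : ℝ} (h : ξ ∈ uIcc 0 a) : |ξ| ≤ |a| := by
  have := abs_sub_left_of_mem_uIcc h
  simpa using this

theorem enorm_primitive_diff_le {f g : ℝ → ℝ → ℝ} {x R a : ℝ} (hf : ContDiff ℝ 1 (f x))
    (hg : ContDiff ℝ 1 (g x)) (hf0 : f x 0 = 0) (hg0 : g x 0 = 0) (ha : |a| ≤ R) :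
    ‖primitive f x a - primitive g x a‖ₑ
      ≤ derivSup R (fun x u => partialU f x u - partialU g x u) x * (‖a‖ₑ * ‖a‖ₑ) := by
  have hfd (u : ℝ) := hasDerivAt_primitive hf.continuous u
  have hgd (u : ℝ) := hasDerivAt_primitive hg.continuous u
  obtain ⟨ξ, hξ, he⟩ := exists_mvt (φ := primitive f x - primitive g x)
    (fun u => ((hfd u).sub (hgd u)).differentiableAt) 0 a
  rw [((hfd ξ).sub (hgd ξ)).deriv] at he
  simp only [Pi.sub_apply, primitive, intervalIntegral.integral_same, sub_zero] at he
  have hξa := abs_le_abs_of_mem_uIcc hξ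
  simp only [primitive]
  rw [he, enorm_mul, ← mul_assoc]
  gcongr
  refine (enorm_diff_le_derivSup hf hg hf0 hg0 (hξa.trans ha)).trans ?_
  gcongr
  exact enorm_le_iff_norm_le.2 hξa

theorem enorm_primitive_taylor_le {f : ℝ → ℝ → ℝ} {x R a b : ℝ} (hf : ContDiff ℝ 1 (f x))
    (ha : |a| ≤ R) (hb : |b| ≤ R) :
    ‖primitive f x b - primitive f x a - f x a * (b - a)‖ₑ
      ≤ derivSup R (partialU f) x * (‖b - a‖ₑ * ‖b - a‖ₑ) := by
  have hfd (u : ℝ) := hasDerivAt_primitive hf.continuous u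
  obtain ⟨ξ, hξ, he⟩ := exists_mvt (fun u => (hfd u).differentiableAt) a b
  rw [(hfd ξ).deriv] at he
  rw [he, ← sub_mul, enorm_mul, ← mul_assoc]
  gcongr
  have hξR := mem_Icc_of_uIcc ha hb hξ
  refine (enorm_sub_le_derivSup hf ha (abs_le.2 hξR)).trans ?_
  gcongr
  exact enorm_le_iff_norm_le.2 (abs_sub_left_of_mem_uIcc hξ)

/-- f(b) − f(a) = f_u(ξ)(b − a), and f_u(ξ) − g_u(c) splits into the distance of f_u from g_u at ξ
and an increment of g_u. Only the limit g has to be Lipschitz in its derivative. -/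
theorem enorm_linearization_le {f g : ℝ → ℝ → ℝ} {x R a b c μ r : ℝ} (hf : ContDiff ℝ 1 (f x))
    (hLip : ∀ u v : ℝ, |u| ≤ R → |v| ≤ R → |partialU g x u - partialU g x v| ≤ μ * |u - v|)
    (hμ : 0 ≤ μ)
    (ha : |a| ≤ R) (hb : |b| ≤ R) (hc : |c| ≤ R) (hac : |a - c| ≤ r) (hbc : |b - c| ≤ r) :
    ‖f x b - f x a - partialU g x c * (b - a)‖ₑ
      ≤ (derivSup R (fun x u => partialU f x u - partialU g x u) x + ENNReal.ofReal (μ * r))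
        * ‖b - a‖ₑ := by
  obtain ⟨ξ, hξ, he⟩ := exists_mvt (hf.differentiable (by simp)) a b
  have hξR := mem_Icc_of_uIcc ha hb hξ
  have hξc : |ξ - c| ≤ r := by
    rw [abs_le] at hac hbc ⊢
    rcases mem_uIcc.1 hξ with h | h <;> constructor <;> linarith [h.1, h.2]
  rw [he, ← sub_mul, enorm_mul]
  gcongr
  have e : deriv (f x) ξ - partialU g x c
      = (partialU f x ξ - partialU g x ξ) + (partialU g x ξ - partialU g x c) := by
    change partialU f x ξ - _ = _
    ring
  rw [e]
  refine (enorm_add_le _ _).trans ?_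
  gcongr
  · exact le_derivSup (g := fun x u => partialU f x u - partialU g x u) hξR
  · rw [← ofReal_norm]
    refine ENNReal.ofReal_le_ofReal ((hLip ξ c (abs_le.2 hξR) hc).trans ?_)
    gcongr

end Pointwise

/-! ### The superposition operator on H¹ and its linearization. -/

section Nemytskii

/-- Carathéodory nonlinearities of class `C¹` with Stepanov bounded derivative that vanish
at `u = 0`. -/
structure Nonlin (f : ℝ → ℝ → ℝ) : Prop where
  contDiff : ∀ᵐ x, ContDiff ℝ 1 (f x)
  cara : IsCaratheodory f
  caraU : IsCaratheodory (partialU f)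
  zero : ∀ᵐ x, f x 0 = 0
  bdd : ∀ R > 0, stepanovSeminorm R (partialU f) < ⊤

/-- The distance of two nonlinearities in the seminorm of the derivatives. -/
def nlDist (R : ℝ) (f g : ℝ → ℝ → ℝ) : ℝ≥0∞ :=
  stepanovSeminorm R fun x u => partialU f x u - partialU g x u

theorem abs_le_of_norm_le {u : H1} {R : ℝ} (h : 2 * ‖u‖ ≤ R) : ∀ᵐ x, |u.toL2 x| ≤ R := by
  filter_upwards [abs_le_norm u] with x hx
  exact hx.trans h

variable {f g : ℝ → ℝ → ℝ}

/-- Elements of H¹ satisfy |u| ≤ 2‖u‖ a.e., so on H¹ balls the values stay in [−R, R] and the mean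
value theorem reduces superposition to a Stepanov multiplier. -/
theorem Nonlin.integral_sub_mul (hf : Nonlin f) {R : ℝ} (hR : 0 < R) {a b : H1} (v : H1)
    (ha : 2 * ‖a‖ ≤ R) (hb : 2 * ‖b‖ ≤ R) :
    Integrable (fun x => (f x (a.toL2 x) - f x (b.toL2 x)) * v.toL2 x) ∧
      |∫ x, (f x (a.toL2 x) - f x (b.toL2 x)) * v.toL2 x|
        ≤ 4 * (stepanovSeminorm R (partialU f)).toReal * ‖a - b‖ * ‖v‖ := by
  refine integrable_and_abs_integral_le (k := fun x => _) (p := derivSup R (partialU f))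
    (((hf.cara.aesm_comp a).sub (hf.cara.aesm_comp b)).mul (aesm_toL2 v)) (a - b) v ?_
    (hf.bdd R hR)
  filter_upwards [hf.contDiff, abs_le_of_norm_le ha, abs_le_of_norm_le hb, H1.coe_sub a b]
    with x hx hxa hxb hs
  simp only [Pi.mul_apply, Pi.sub_apply]
  rw [enorm_mul, hs, ← mul_assoc]
  gcongr
  exact enorm_sub_le_derivSup hx hxb hxa

theorem Nonlin.integral_mul (hf : Nonlin f) {R : ℝ} (hR : 0 < R) {u : H1} (v : H1)
    (hu : 2 * ‖u‖ ≤ R) :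
    Integrable (fun x => f x (u.toL2 x) * v.toL2 x) ∧
      |∫ x, f x (u.toL2 x) * v.toL2 x|
        ≤ 4 * (stepanovSeminorm R (partialU f)).toReal * ‖u‖ * ‖v‖ := by
  have h := hf.integral_sub_mul hR (b := 0) v hu (by simpa using hR.le)
  rw [sub_zero] at h
  have e : (fun x => (f x (u.toL2 x) - f x ((0 : H1).toL2 x)) * v.toL2 x) =ᵐ[volume]
      fun x => f x (u.toL2 x) * v.toL2 x := by
    filter_upwards [H1.coe_zero, hf.zero] with x h0 hx
    rw [h0, hx, sub_zero]
  rw [integral_congr_ae e] at h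
  exact ⟨h.1.congr e, h.2⟩

theorem Nonlin.integrable_mul (hf : Nonlin f) (u v : H1) :
    Integrable (fun x => f x (u.toL2 x) * v.toL2 x) :=
  (hf.integral_mul (R := 2 * ‖u‖ + 1) (by positivity) v (by linarith)).1

theorem Nonlin.integral_diff_mul (hf : Nonlin f) (hg : Nonlin g) {R : ℝ} {u : H1} (v : H1)
    (hu : 2 * ‖u‖ ≤ R) (hd : nlDist R f g < ⊤) :
    |∫ x, (f x (u.toL2 x) - g x (u.toL2 x)) * v.toL2 x|
        ≤ 4 * (nlDist R f g).toReal * ‖u‖ * ‖v‖ := by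
  refine (integrable_and_abs_integral_le (k := fun x => _)
    (p := derivSup R fun x u => partialU f x u - partialU g x u)
    (((hf.cara.aesm_comp u).sub (hg.cara.aesm_comp u)).mul (aesm_toL2 v)) u v ?_ hd).2
  filter_upwards [hf.contDiff, hg.contDiff, hf.zero, hg.zero, abs_le_of_norm_le hu]
    with x h1 h2 h3 h4 h5
  simp only [Pi.mul_apply, Pi.sub_apply]
  rw [enorm_mul, ← mul_assoc]
  gcongr
  exact enorm_diff_le_derivSup h1 h2 h3 h4 h5

theorem Nonlin.integrable_primitive (hf : Nonlin f) (u : H1) :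
    Integrable fun x => primitive f x (u.toL2 x) := by
  set R := 2 * ‖u‖ + 1
  have hR : 0 < R := by positivity
  refine (integrable_and_abs_integral_le (p := derivSup R (partialU f))
    (hf.cara.primitive.aesm_comp u) u u ?_ (hf.bdd R hR)).1
  filter_upwards [hf.contDiff, hf.zero, abs_le_of_norm_le (show 2 * ‖u‖ ≤ R by simp [R])]
    with x h1 h2 h3
  have h4 := enorm_primitive_taylor_le h1 (a := 0) (by simpa using hR.le) h3
  simpa [primitive, h2] using h4

theorem Nonlin.integral_primitive_diff (hf : Nonlin f) (hg : Nonlin g) {R : ℝ} {u : H1}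
    (hu : 2 * ‖u‖ ≤ R) (hd : nlDist R f g < ⊤) :
    |(∫ x, primitive f x (u.toL2 x)) - ∫ x, primitive g x (u.toL2 x)|
        ≤ 4 * (nlDist R f g).toReal * ‖u‖ * ‖u‖ := by
  rw [← integral_sub (hf.integrable_primitive u) (hg.integrable_primitive u)]
  refine (integrable_and_abs_integral_le (k := fun x => _)
    (p := derivSup R fun x u => partialU f x u - partialU g x u)
    ((hf.cara.primitive.aesm_comp u).sub (hg.cara.primitive.aesm_comp u)) u u ?_ hd).2
  filter_upwards [hf.contDiff, hg.contDiff, hf.zero, hg.zero, abs_le_of_norm_le hu]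
    with x h1 h2 h3 h4 h5
  exact enorm_primitive_diff_le h1 h2 h3 h4 h5

theorem Nonlin.integral_primitive_taylor (hf : Nonlin f) {R : ℝ} (hR : 0 < R) {a b : H1}
    (ha : 2 * ‖a‖ ≤ R) (hb : 2 * ‖b‖ ≤ R) :
    |(∫ x, primitive f x (b.toL2 x)) - (∫ x, primitive f x (a.toL2 x))
        - ∫ x, f x (a.toL2 x) * (b - a).toL2 x|
      ≤ 4 * (stepanovSeminorm R (partialU f)).toReal * ‖b - a‖ * ‖b - a‖ := by
  have i1 : Integrable fun x => primitive f x (b.toL2 x) - primitive f x (a.toL2 x) :=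
    (hf.integrable_primitive b).sub (hf.integrable_primitive a)
  rw [← integral_sub (hf.integrable_primitive b) (hf.integrable_primitive a),
    ← integral_sub i1 (hf.integrable_mul a (b - a))]
  refine (integrable_and_abs_integral_le (k := fun x => _) (p := derivSup R (partialU f))
    (((hf.cara.primitive.aesm_comp b).sub (hf.cara.primitive.aesm_comp a)).sub
      ((hf.cara.aesm_comp a).mul (aesm_toL2 (b - a)))) (b - a) (b - a) ?_ (hf.bdd R hR)).2
  filter_upwards [hf.contDiff, abs_le_of_norm_le ha, abs_le_of_norm_le hb, H1.coe_sub b a]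
    with x h1 h2 h3 h4
  simp only [Pi.mul_apply, Pi.sub_apply]
  rw [h4]
  exact enorm_primitive_taylor_le h1 h2 h3

theorem exists_nlOp (hf : Nonlin f) (u : H1) :
    ∃ w : H1, ∀ v : H1, ⟪w, v⟫ = ∫ x, f x (u.toL2 x) * v.toL2 x := by
  set R := 2 * ‖u‖ + 1
  have hR : 0 < R := by positivity
  let φ : H1 →ₗ[ℝ] ℝ :=
    { toFun := fun v => ∫ x, f x (u.toL2 x) * v.toL2 x
      map_add' := fun v w => by
        rw [← integral_add (hf.integrable_mul u v) (hf.integrable_mul u w)]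
        refine integral_congr_ae ?_
        filter_upwards [H1.coe_add v w] with x hx
        rw [hx, mul_add]
      map_smul' := fun c v => by
        rw [RingHom.id_apply, smul_eq_mul, ← integral_const_mul]
        refine integral_congr_ae ?_
        filter_upwards [H1.coe_smul c v] with x hx
        rw [hx]
        ring }
  let φ' : H1 →L[ℝ] ℝ := φ.mkContinuous
    (4 * (stepanovSeminorm R (partialU f)).toReal * ‖u‖) fun v =>
      (hf.integral_mul hR v (by simp [R])).2
  refine ⟨(InnerProductSpace.toDual ℝ H1).symm φ', fun v => ?_⟩
  rw [InnerProductSpace.toDual_symm_apply]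
  rfl

open Classical in
/-- The superposition operator, as a map from `H¹` to its dual, identified with `H¹`. -/
def nlOp (f : ℝ → ℝ → ℝ) (u : H1) : H1 :=
  if h : ∃ w : H1, ∀ v : H1, ⟪w, v⟫ = ∫ x, f x (u.toL2 x) * v.toL2 x then h.choose else 0

theorem inner_nlOp (hf : Nonlin f) (u v : H1) :
    ⟪nlOp f u, v⟫ = ∫ x, f x (u.toL2 x) * v.toL2 x := by
  have h := exists_nlOp hf u
  rw [nlOp, dif_pos h]
  exact h.choose_spec v

theorem norm_le_of_inner {H : Type*} [NormedAddCommGroup H] [InnerProductSpace ℝ H]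
    {w : H} {C : ℝ} (hC : 0 ≤ C) (h : ∀ v, |⟪w, v⟫| ≤ C * ‖v‖) : ‖w‖ ≤ C := by
  have h1 := h w
  rw [real_inner_self_eq_norm_sq, abs_of_nonneg (sq_nonneg _)] at h1
  rcases (norm_nonneg w).eq_or_lt with h0 | h0
  · rwa [← h0]
  · exact le_of_mul_le_mul_right (by linarith) h0

theorem Nonlin.inner_nlOp_sub (hf : Nonlin f) (a b v : H1) :
    ⟪nlOp f a - nlOp f b, v⟫ = ∫ x, (f x (a.toL2 x) - f x (b.toL2 x)) * v.toL2 x := by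
  rw [inner_sub_left, inner_nlOp hf, inner_nlOp hf,
    ← integral_sub (hf.integrable_mul a v) (hf.integrable_mul b v)]
  simp only [sub_mul]

theorem Nonlin.norm_nlOp_sub_le (hf : Nonlin f) {R : ℝ} (hR : 0 < R) {a b : H1}
    (ha : 2 * ‖a‖ ≤ R) (hb : 2 * ‖b‖ ≤ R) :
    ‖nlOp f a - nlOp f b‖ ≤ 4 * (stepanovSeminorm R (partialU f)).toReal * ‖a - b‖ := by
  refine norm_le_of_inner (by positivity) fun v => ?_
  rw [hf.inner_nlOp_sub]
  exact (hf.integral_sub_mul hR v ha hb).2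

theorem Nonlin.norm_nlOp_diff_le (hf : Nonlin f) (hg : Nonlin g) {R : ℝ} {u : H1}
    (hu : 2 * ‖u‖ ≤ R) (hd : nlDist R f g < ⊤) :
    ‖nlOp f u - nlOp g u‖ ≤ 4 * (nlDist R f g).toReal * ‖u‖ := by
  refine norm_le_of_inner (by positivity) fun v => ?_
  rw [inner_sub_left, inner_nlOp hf, inner_nlOp hg,
    ← integral_sub (hf.integrable_mul u v) (hg.integrable_mul u v)]
  simp only [← sub_mul]
  exact hf.integral_diff_mul hg v hu hd

theorem stepanovBounded_of_norm {q : ℝ → ℝ} (hq : AEStronglyMeasurable q)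
    (h : stepanovNorm q < ⊤) : StepanovBounded q := by
  refine ⟨?_, h⟩
  intro x
  refine ⟨Icc (x - 1 / 2) (x - 1 / 2 + 1), Icc_mem_nhds (by linarith) (by linarith),
    hq.restrict, ?_⟩
  exact lt_of_le_of_lt (le_iSup (fun t => ∫⁻ x in Icc t (t + 1), ‖q x‖ₑ) (x - 1 / 2)) h

theorem Nonlin.stepanovBounded (hf : Nonlin f) (u : H1) :
    StepanovBounded fun x => partialU f x (u.toL2 x) := by
  set R := 2 * ‖u‖ + 1
  refine stepanovBounded_of_norm (hf.caraU.aesm_comp u)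
    (lt_of_le_of_lt (uniformLocalMass_mono ?_) (hf.bdd R (by positivity)))
  filter_upwards [abs_le_of_norm_le (show 2 * ‖u‖ ≤ R by simp [R])] with x hx
  exact le_derivSup (abs_le.1 hx)

theorem stepanovBounded_zero : StepanovBounded fun _ => 0 :=
  stepanovBounded_of_norm aestronglyMeasurable_const (by simp [stepanovNorm, uniformLocalMass])

/-- The operator on `H¹` representing the form `∫ q v w`. -/
def mulOp (q : ℝ → ℝ) : H1 →L[ℝ] H1 := formOp q - formOp fun _ => 0

theorem inner_mulOp {q : ℝ → ℝ} (hq : StepanovBounded q) (v w : H1) :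
    ⟪mulOp q v, w⟫ = ∫ x, q x * v.toL2 x * w.toL2 x := by
  rw [mulOp, sub_apply, inner_sub_left, inner_formOp hq,
    inner_formOp stepanovBounded_zero, form_eq, form_eq]
  simp

theorem symm_mulOp {q : ℝ → ℝ} (hq : StepanovBounded q) : SymmOp (mulOp q) :=
  (symm_formOp hq).sub (symm_formOp stepanovBounded_zero)

/-- The derivative of the superposition operator at `u`. -/
def nlDeriv (f : ℝ → ℝ → ℝ) (u : H1) : H1 →L[ℝ] H1 := mulOp fun x => partialU f x (u.toL2 x)

theorem inner_nlDeriv (hf : Nonlin f) (u v w : H1) :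
    ⟪nlDeriv f u v, w⟫ = ∫ x, partialU f x (u.toL2 x) * v.toL2 x * w.toL2 x :=
  inner_mulOp (hf.stepanovBounded u) v w

/-- Linearization of a nonlinearity near `u`, by the derivative at `u` of a nearby one. -/
theorem Nonlin.inner_linearization_le (hf : Nonlin f) (hg : Nonlin g) {R μ r : ℝ}
    (hμ : 0 ≤ μ) (hLip : ∀ᵐ x, ∀ u v : ℝ, |u| ≤ R → |v| ≤ R →
      |partialU g x u - partialU g x v| ≤ μ * |u - v|)
    {a b u : H1} (ha : 2 * ‖a‖ ≤ R) (hb : 2 * ‖b‖ ≤ R) (hu : 2 * ‖u‖ ≤ R)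
    (har : ‖a - u‖ ≤ r) (hbr : ‖b - u‖ ≤ r) (hd : nlDist R f g < ⊤) :
    |⟪nlOp f b - nlOp f a - nlDeriv g u (b - a), b - a⟫|
      ≤ (4 * (nlDist R f g).toReal + 8 * μ * r) * ‖b - a‖ ^ 2 := by
  have hr : 0 ≤ r := (norm_nonneg _).trans har
  rw [inner_sub_left, hf.inner_nlOp_sub, inner_nlDeriv hg]
  have i1 : Integrable fun x => (f x (b.toL2 x) - f x (a.toL2 x)) * (b - a).toL2 x := by
    simp only [sub_mul]
    exact (hf.integrable_mul b _).sub (hf.integrable_mul a _)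
  rw [← integral_sub i1 (integrable_potential (hg.stepanovBounded u) _ _).1]
  set p : ℝ → ℝ≥0∞ := fun x =>
    derivSup R (fun x u => partialU f x u - partialU g x u) x + ENNReal.ofReal (μ * (2 * r))
  have hp : uniformLocalMass p ≤ nlDist R f g + ENNReal.ofReal (μ * (2 * r)) :=
    uniformLocalMass_add_const _ _
  have hp' : nlDist R f g + ENNReal.ofReal (μ * (2 * r)) < ⊤ :=
    ENNReal.add_lt_top.2 ⟨hd, ENNReal.ofReal_lt_top⟩
  have h := (integrable_and_abs_integral_le (k := fun x => _) (p := p)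
    (i1.1.sub (integrable_potential (hg.stepanovBounded u) (b - a) (b - a)).1.1)
    (b - a) (b - a) ?_ (hp.trans_lt hp')).2
  · refine h.trans ?_
    have h1 := ENNReal.toReal_mono hp'.ne hp
    rw [ENNReal.toReal_add hd.ne ENNReal.ofReal_ne_top, ENNReal.toReal_ofReal (by positivity)] at h1
    calc 4 * (uniformLocalMass p).toReal * ‖b - a‖ * ‖b - a‖
        ≤ 4 * ((nlDist R f g).toReal + μ * (2 * r)) * ‖b - a‖ * ‖b - a‖ := by gcongr
      _ = _ := by ring
  · filter_upwards [hf.contDiff, hLip, abs_le_of_norm_le ha, abs_le_of_norm_le hb,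
      abs_le_of_norm_le hu, H1.coe_sub b a, H1.coe_sub a u, H1.coe_sub b u, abs_le_norm (a - u),
      abs_le_norm (b - u)] with x h1 h2 h3 h4 h5 h6 h7 h8 h9 h10
    rw [h7] at h9
    rw [h8] at h10
    have h11 := enorm_linearization_le h1 h2 hμ h3 h4 h5 (h9.trans (by gcongr : _ ≤ 2 * r))
      (h10.trans (by gcongr))
    simp only [Pi.sub_apply]
    rw [h6, ← sub_mul, enorm_mul, ← mul_assoc]
    gcongr

end Nemytskii

/-! ### Differentiability of the energy and the Nehari conditions as gradient equations. -/

section Energy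

theorem H1.inner_smul_left (c : ℝ) (u v : H1) : ⟪c • u, v⟫ = c * ⟪u, v⟫ :=
  real_inner_smul_left u v c

variable {V : ℝ → ℝ} {f : ℝ → ℝ → ℝ}

/-- The gradient of `χ J` on `H¹`. -/
def grad (χ : ℝ) (V : ℝ → ℝ) (f : ℝ → ℝ → ℝ) (u : H1) : H1 := χ • formOp V u - nlOp f u

theorem energy_eq (hV : StepanovBounded V) (χ : ℝ) (u : H1) :
    energy χ V f u = 1 / 2 * ⟪formOp V u, u⟫ - χ * ∫ x, primitive f x (u.toL2 x) := by
  rw [energy, inner_formOp hV]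

/-- The quadratic part expands exactly, and the Taylor remainder of ∫F is O(‖h‖²) because f_u has
finite seminorm on the range of values involved. -/
theorem hasFDerivAt_energy (hV : StepanovBounded V) (hf : Nonlin f) (χ : ℝ) (u : H1) :
    HasFDerivAt (energy χ V f) (innerSL ℝ (formOp V u - χ • nlOp f u)) u := by
  set R := 2 * (‖u‖ + 1)
  have hR : 0 < R := by positivity
  set M := (stepanovSeminorm R (partialU f)).toReal
  rw [hasFDerivAt_iff_isLittleO_nhds_zero]
  have hO : (fun h : H1 => energy χ V f (u + h) - energy χ V f u
      - innerSL ℝ (formOp V u - χ • nlOp f u) h) =O[𝓝 0] fun h => ‖h‖ ^ 2 := by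
    refine Asymptotics.IsBigO.of_bound (‖formOp V‖ / 2 + |χ| * (4 * M)) ?_
    filter_upwards [Metric.ball_mem_nhds (0 : H1) one_pos] with h hh
    have hh1 : ‖h‖ ≤ 1 := by
      have : ‖h‖ < 1 := by simpa using hh
      exact this.le
    have h1 := hf.integral_primitive_taylor hR (a := u) (b := u + h) (by simp only [R]; linarith)
      (by have := norm_add_le u h
          simp only [R]; linarith)
    rw [add_sub_cancel_left] at h1
    have h2 : ⟪formOp V h, u⟫ = ⟪formOp V u, h⟫ := by
      rw [symm_formOp hV, real_inner_comm]
    have e : energy χ V f (u + h) - energy χ V f u - innerSL ℝ (formOp V u - χ • nlOp f u) h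
        = 1 / 2 * ⟪formOp V h, h⟫ - χ * ((∫ x, primitive f x ((u + h).toL2 x))
          - (∫ x, primitive f x (u.toL2 x)) - ∫ x, f x (u.toL2 x) * h.toL2 x) := by
      rw [energy_eq hV, energy_eq hV, innerSL_apply_apply, inner_sub_left, H1.inner_smul_left,
        inner_nlOp hf, inner_quadratic_add, h2]
      ring
    rw [e, norm_pow, norm_norm, Real.norm_eq_abs]
    refine (abs_sub _ _).trans ?_
    rw [abs_mul, abs_mul, abs_of_pos (by norm_num : (0 : ℝ) < 1 / 2)]
    have h3 : |⟪formOp V h, h⟫| ≤ ‖formOp V‖ * ‖h‖ * ‖h‖ :=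
      (abs_real_inner_le_norm _ _).trans (by gcongr; exact (formOp V).le_opNorm h)
    have h4 := mul_le_mul_of_nonneg_left h1 (abs_nonneg χ)
    calc _ ≤ 1 / 2 * (‖formOp V‖ * ‖h‖ * ‖h‖) + |χ| * (4 * M * ‖h‖ * ‖h‖) := by gcongr
      _ = _ := by ring
  exact hO.trans_isLittleO (Asymptotics.isLittleO_norm_pow_id one_lt_two)

/-- Since χ² = 1, the derivative of J is χ times the pairing with `grad`, so the two vanish together
and later arguments need not distinguish the sign. -/
theorem mem_nehari_iff (hV : StepanovBounded V) (hf : Nonlin f) {χ : ℝ} (hχ : χ = 1 ∨ χ = -1)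
    (u : H1) : u ∈ nehari χ V f ↔ u ≠ 0 ∧ ⟪grad χ V f u, u⟫ = 0 ∧
      ∀ v ∈ constraintSubspace χ V, ⟪grad χ V f u, v⟫ = 0 := by
  have e (v : H1) : fderiv ℝ (energy χ V f) u v = χ * ⟪grad χ V f u, v⟫ := by
    rw [(hasFDerivAt_energy hV hf χ u).fderiv, innerSL_apply_apply, grad, inner_sub_left,
      inner_sub_left, H1.inner_smul_left, H1.inner_smul_left]
    rcases hχ with rfl | rfl <;> ring
  have h0 : χ ≠ 0 := by rcases hχ with rfl | rfl <;> norm_num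
  simp only [nehari, mem_ofPred_eq, e, mul_eq_zero, h0, false_or]

end Energy

/-! ### Negative definiteness of the Hessian at points of the Nehari manifold. -/

section Hessian

/-- The structural conditions on a superlinear nonlinearity. -/
structure Superlin (f : ℝ → ℝ → ℝ) : Prop where
  zeroU : ∀ᵐ x, partialU f x 0 = 0
  lip : ∀ R > 0, ∃ μ > 0, ∀ᵐ x, ∀ u v : ℝ, |u| ≤ R → |v| ≤ R →
    |partialU f x u - partialU f x v| ≤ μ * |u - v|
  growth : ∃ θ : ℝ, 0 < θ ∧ θ < 1 ∧ ∀ᵐ x, ∀ u : ℝ, u ≠ 0 →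
    0 < f x u * u ∧ f x u * u ≤ θ * (partialU f x u * u ^ 2)
  lower : ∀ u : ℝ, u ≠ 0 → ∃ c > 0, ∀ᵐ x, c ≤ f x u * u

/-- If `T u` and `M u` agree on `u` and on a negative subspace for `T`, and `Q` dominates a
multiple of `M` larger than one, then `T - Q` is negative definite on the sum of `ℝ u` and the
negative subspace. -/
theorem negDef_of_superlinear {H : Type*} [NormedAddCommGroup H] [InnerProductSpace ℝ H]
    {T M Q : H →L[ℝ] H} (hT : SymmOp T) (hM : SymmOp M) {u : H} {θ α : ℝ} (hθ : 0 < θ)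
    (hθ1 : θ < 1) (hα : 0 < α) (hM0 : ∀ w, 0 ≤ ⟪M w, w⟫) (hMQ : ∀ w, ⟪M w, w⟫ ≤ θ * ⟪Q w, w⟫)
    (hMu : 0 < ⟪M u, u⟫) (hu : ⟪T u, u⟫ = ⟪M u, u⟫) {E : Set H}
    (hE : ∀ v ∈ E, ⟪T u, v⟫ = ⟪M u, v⟫) (hneg : ∀ v ∈ E, ⟪T v, v⟫ ≤ -(α * ‖v‖ ^ 2)) :
    ∃ δ > 0, ∀ (s : ℝ), ∀ v ∈ E,
      ⟪(T - Q) (s • u + v), s • u + v⟫ ≤ -(δ * (s ^ 2 + ‖v‖ ^ 2)) := by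
  -- With w = su + v the constraints give ⟨Tw,w⟩ = ⟨Mw,w⟩ − ⟨Mv,v⟩ + ⟨Tv,v⟩, and ⟨Qw,w⟩ ≥ (1 +
  -- κ)⟨Mw,w⟩. As κ ≤ 1, the gain is at least κ(⟨Mw,w⟩ + ⟨Mv,v⟩) ≥ (κ/2)s²⟨Mu,u⟩, plus α‖v‖² from
  -- ⟨Tv,v⟩.
  set κ := min (1 / θ - 1) 1
  have hκ : 0 < κ := lt_min (by rw [sub_pos, lt_div_iff₀ hθ]; linarith) one_pos
  refine ⟨min α (κ / 2 * ⟪M u, u⟫), by positivity, fun s v hv => ?_⟩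
  set w := s • u + v
  have exp {S : H →L[ℝ] H} (hS : SymmOp S) :
      ⟪S w, w⟫ = s ^ 2 * ⟪S u, u⟫ + 2 * s * ⟪S u, v⟫ + ⟪S v, v⟫ := by
    have h1 : ⟪S v, u⟫ = ⟪S u, v⟫ := by rw [hS, real_inner_comm]
    simp only [w, map_add, map_smul, inner_add_left, inner_add_right, real_inner_smul_left,
      real_inner_smul_right, h1]
    ring
  have eT := exp hT
  have eM := exp hM
  -- su + 2v = w + v and su = w − v, so nonnegativity here is the parallelogram bound ⟨M(w − v), w −
  -- v⟩ ≤ 2⟨Mw,w⟩ + 2⟨Mv,v⟩.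
  have h1 : ⟪M (s • u + (2 : ℝ) • v), s • u + (2 : ℝ) • v⟫
      = s ^ 2 * ⟪M u, u⟫ + 4 * s * ⟪M u, v⟫ + 4 * ⟪M v, v⟫ := by
    have h1 : ⟪M v, u⟫ = ⟪M u, v⟫ := by rw [hM, real_inner_comm]
    simp only [map_add, map_smul, inner_add_left, inner_add_right, real_inner_smul_left,
      real_inner_smul_right, h1]
    ring
  have h2 := hM0 (s • u + (2 : ℝ) • v)
  rw [h1] at h2
  have h3 : 1 / θ * ⟪M w, w⟫ ≤ ⟪Q w, w⟫ := by
    rw [one_div, inv_mul_le_iff₀ hθ]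
    exact hMQ w
  have h4 : κ * ⟪M w, w⟫ ≤ (1 / θ - 1) * ⟪M w, w⟫ := by
    have := hM0 w
    gcongr
    exact min_le_left _ _
  have h5 : κ * ⟪M v, v⟫ ≤ 1 * ⟪M v, v⟫ := by
    have := hM0 v
    gcongr
    exact min_le_right _ _
  have h6 := hneg v hv
  have h7 : ⟪(T - Q) w, w⟫ = ⟪T w, w⟫ - ⟪Q w, w⟫ := by rw [sub_apply, inner_sub_left]
  rw [h7, eT, hu, hE v hv]
  have h8 : min α (κ / 2 * ⟪M u, u⟫) * ‖v‖ ^ 2 ≤ α * ‖v‖ ^ 2 := by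
    gcongr
    exact min_le_left _ _
  have h9 : min α (κ / 2 * ⟪M u, u⟫) * s ^ 2 ≤ κ / 2 * ⟪M u, u⟫ * s ^ 2 := by
    gcongr
    exact min_le_right _ _
  have h10 : κ * (s ^ 2 * ⟪M u, u⟫) ≤ κ * (2 * ⟪M w, w⟫ + 2 * ⟪M v, v⟫) := by
    gcongr
    linarith
  linarith

variable {V : ℝ → ℝ} {g : ℝ → ℝ → ℝ}

/-- M is multiplication by a = g(x,u)/u, equal to 0 where u = 0, so that M u represents g(x,u).
Superlinearity gives 0 ≤ a ≤ θ g_u(x,u), which makes a Stepanov bounded, and ⟨Mu,u⟩ > 0 since u ≠ 0.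
-/
theorem exists_hessian_negDef (hV : Gapped V) (hg : Nonlin g) (hs : Superlin g) {K : ℝ}
    (hK : CoerciveShift V K) {χ : ℝ} (hχ : χ = 1 ∨ χ = -1) {u : H1} (hu : u ∈ nehari χ V g) :
    ∃ δ > 0, ∀ (s : ℝ) (v : H1), negProj (formOp V + K • l2Op) (χ • formOp V) v = v →
      ⟪(χ • formOp V - nlDeriv g u) (s • u + v), s • u + v⟫ ≤ -(δ * (s ^ 2 + ‖v‖ ^ 2)) := by
  obtain ⟨hu0, huu, huv⟩ := (mem_nehari_iff hV.bdd hg hχ u).1 hu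
  rw [hV.constraintSubspace_eq hK hχ] at huv
  obtain ⟨θ, hθ, hθ1, hgr⟩ := hs.growth
  obtain ⟨α, hα, -, hneg⟩ := (hV.pencil hK hχ).exists_coercive
  set a : ℝ → ℝ := fun x => g x (u.toL2 x) / u.toL2 x
  set q : ℝ → ℝ := fun x => partialU g x (u.toL2 x)
  have ham : AEStronglyMeasurable a :=
    ((hg.cara.aesm_comp u).aemeasurable.div (aesm_toL2 u).aemeasurable).aestronglyMeasurable
  have hau : ∀ᵐ x, a x * u.toL2 x = g x (u.toL2 x) := by
    filter_upwards [hg.zero] with x hx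
    by_cases h0 : u.toL2 x = 0
    · rw [h0, hx, mul_zero]
    · exact div_mul_cancel₀ _ h0
  have haq : ∀ᵐ x, 0 ≤ a x ∧ a x ≤ θ * q x := by
    filter_upwards [hgr, hs.zeroU] with x hx hx0
    by_cases h0 : u.toL2 x = 0
    · simp [a, q, h0, hx0]
    · obtain ⟨h1, h2⟩ := hx _ h0
      have e : a x = g x (u.toL2 x) * u.toL2 x / u.toL2 x ^ 2 := by
        simp only [a]; field_simp
      have hsq : 0 < u.toL2 x ^ 2 := by positivity
      rw [e]
      refine ⟨by positivity, ?_⟩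
      rw [div_le_iff₀ hsq, mul_assoc]
      exact h2
  have hq : StepanovBounded q := hg.stepanovBounded u
  have ha : StepanovBounded a := by
    refine stepanovBounded_of_norm ham (lt_of_le_of_lt (uniformLocalMass_mono ?_) hq.2)
    filter_upwards [haq] with x hx
    refine enorm_le_iff_norm_le.2 ?_
    rw [Real.norm_of_nonneg hx.1]
    refine le_trans ?_ (le_abs_self _)
    have : 0 ≤ q x := by
      by_contra hc
      nlinarith [hx.1, hx.2]
    nlinarith [hx.2]
  have hMu (v : H1) : ⟪mulOp a u, v⟫ = ⟪nlOp g u, v⟫ := by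
    rw [inner_mulOp ha, inner_nlOp hg]
    refine integral_congr_ae ?_
    filter_upwards [hau] with x hx
    rw [hx]
  have hM0 (w : H1) : 0 ≤ ⟪mulOp a w, w⟫ := by
    rw [inner_mulOp ha]
    refine integral_nonneg_of_ae ?_
    filter_upwards [haq] with x hx
    rw [mul_assoc]
    exact mul_nonneg hx.1 (mul_self_nonneg _)
  have hgrad (v : H1) (h : ⟪grad χ V g u, v⟫ = 0) : ⟪(χ • formOp V) u, v⟫ = ⟪mulOp a u, v⟫ := by
    rw [grad, inner_sub_left, sub_eq_zero] at h
    rw [hMu, ← h]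
    rfl
  refine negDef_of_superlinear (M := mulOp a) (E := {v | _}) ((symm_formOp hV.bdd).smul χ)
    (symm_mulOp ha) hθ hθ1 hα hM0 (fun w => ?_) ?_ (hgrad u huu)
    (fun v hv => hgrad v (huv v (mem_pencilNeg.2 hv))) hneg
  · rw [inner_mulOp ha, nlDeriv, inner_mulOp hq, ← integral_const_mul]
    refine integral_mono_ae (integrable_potential ha w w).1
      ((integrable_potential hq w w).1.const_mul _) ?_
    filter_upwards [haq] with x hx
    rw [mul_assoc, mul_assoc, ← mul_assoc θ]
    exact mul_le_mul_of_nonneg_right hx.2 (mul_self_nonneg _)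
  · refine lt_of_le_of_ne (hM0 u) fun h0 => hu0 (H1.ext_toL2 (Lp.ext ?_))
    rw [inner_mulOp ha, eq_comm, integral_eq_zero_iff_of_nonneg_ae ?_
      (integrable_potential ha u u).1] at h0
    · filter_upwards [h0, hau, hgr, H1.coe_zero] with x h1 h2 h3 h4
      rw [h2] at h1
      rw [h4]
      by_contra hc
      exact (h3 _ hc).1.ne' h1
    · filter_upwards [haq] with x hx
      rw [mul_assoc]
      exact mul_nonneg hx.1 (mul_self_nonneg _)

end Hessian

/-! ### Translation invariance of every object involved. -/

section Shift

theorem ae_shift {p : ℝ → Prop} (h : ∀ᵐ x, p x) (z : ℝ) : ∀ᵐ x, p (x + z) :=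
  (measurePreserving_add_right volume z).quasiMeasurePreserving.ae h

theorem aemeasurable_shift {a : ℝ → ℝ} (h : AEMeasurable a) (z : ℝ) :
    AEMeasurable fun x => a (x + z) :=
  h.comp_quasiMeasurePreserving (measurePreserving_add_right volume z).quasiMeasurePreserving

theorem uniformLocalMass_shift (p : ℝ → ℝ≥0∞) (z : ℝ) :
    uniformLocalMass (fun x => p (x + z)) = uniformLocalMass p := by
  refine (Equiv.addRight z).iSup_congr fun t => ?_
  have h := (measurePreserving_add_right volume z).setLIntegral_comp_preimage_emb
    (measurableEmbedding_addRight z) p (Icc (t + z) (t + z + 1))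
  rw [Equiv.coe_addRight, ← h]
  congr 2
  ext x
  simp only [mem_preimage, mem_Icc, add_le_add_iff_right]
  constructor <;> rintro ⟨h1, h2⟩ <;> exact ⟨h1, by linarith⟩

/-- Translation on `L²(ℝ)`. -/
def shiftL2 (z : ℝ) : L2 →ₗᵢ[ℝ] L2 :=
  Lp.compMeasurePreservingₗᵢ ℝ (fun x => x + z) (measurePreserving_add_right volume z)

theorem coe_shiftL2 (z : ℝ) (f : L2) : ∀ᵐ x, shiftL2 z f x = f (x + z) :=
  Lp.coeFn_compMeasurePreserving f (measurePreserving_add_right volume z)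

/-- Translation on `H¹(ℝ)`. -/
def shift (z : ℝ) (u : H1) : H1 :=
  ⟨WithLp.toLp 2 (shiftL2 z u.toL2, shiftL2 z u.wderiv), by
    intro φ hφ hc
    have hφ' : ContDiff ℝ (⊤ : ℕ∞) fun x => φ (x - z) := by fun_prop
    have hc' : HasCompactSupport fun x => φ (x - z) :=
      hc.comp_homeomorph (Homeomorph.subRight z)
    have h := hasWeakDeriv u _ hφ' hc'
    have hd (x : ℝ) : deriv (fun x => φ (x - z)) x = deriv φ (x - z) := deriv_comp_sub_const ..
    simp only [hd] at h
    have e1 : ∫ x, shiftL2 z u.toL2 x * deriv φ x = ∫ x, u.toL2 x * deriv φ (x - z) := by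
      rw [← integral_add_right_eq_self (fun x => u.toL2 x * deriv φ (x - z)) z]
      refine integral_congr_ae ?_
      filter_upwards [coe_shiftL2 z u.toL2] with x hx
      rw [hx, add_sub_cancel_right]
    have e2 : ∫ x, shiftL2 z u.wderiv x * φ x = ∫ x, u.wderiv x * φ (x - z) := by
      rw [← integral_add_right_eq_self (fun x => u.wderiv x * φ (x - z)) z]
      refine integral_congr_ae ?_
      filter_upwards [coe_shiftL2 z u.wderiv] with x hx
      rw [hx, add_sub_cancel_right]
    exact e1.trans (h.trans (congrArg Neg.neg e2.symm))⟩

theorem shift_toL2 (z : ℝ) (u : H1) : (shift z u).toL2 = shiftL2 z u.toL2 := rfl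
theorem shift_wderiv (z : ℝ) (u : H1) : (shift z u).wderiv = shiftL2 z u.wderiv := rfl

theorem coe_shift (z : ℝ) (u : H1) : ∀ᵐ x, (shift z u).toL2 x = u.toL2 (x + z) :=
  coe_shiftL2 z u.toL2

theorem shift_shift {z z' : ℝ} (h : z + z' = 0) (u : H1) : shift z (shift z' u) = u := by
  refine H1.ext_toL2 (Lp.ext ?_)
  filter_upwards [coe_shift z (shift z' u), ae_shift (coe_shift z' u) z] with x h1 h2
  rw [h1, h2, add_assoc, h, add_zero]

/-- Translation as a linear equivalence of `H¹(ℝ)`. -/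
def shiftEquiv (z : ℝ) : H1 ≃ₗ[ℝ] H1 where
  toFun := shift z
  invFun := shift (-z)
  map_add' u v := H1.ext_toL2 (map_add (shiftL2 z) u.toL2 v.toL2)
  map_smul' c u := H1.ext_toL2 (map_smul (shiftL2 z) c u.toL2)
  left_inv u := shift_shift (by simp) u
  right_inv u := shift_shift (by simp) u

theorem inner_shift (z : ℝ) (u v : H1) : ⟪shift z u, shift z v⟫ = ⟪u, v⟫ := by
  rw [H1.inner_eq, H1.inner_eq, shift_toL2, shift_toL2, shift_wderiv, shift_wderiv,
    LinearIsometry.inner_map_map, LinearIsometry.inner_map_map]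

theorem norm_shift (z : ℝ) (u : H1) : ‖shift z u‖ = ‖u‖ := by
  rw [norm_eq_sqrt_real_inner, inner_shift, ← norm_eq_sqrt_real_inner]

theorem form_shift (V : ℝ → ℝ) (z : ℝ) (u v : H1) :
    form (fun x => V (x + z)) (shift z u) (shift z v) = form V u v := by
  rw [form_eq, form_eq, shift_wderiv, shift_wderiv, LinearIsometry.inner_map_map]
  congr 1
  rw [← integral_add_right_eq_self (fun x => V x * u.toL2 x * v.toL2 x) z]
  refine integral_congr_ae ?_
  filter_upwards [coe_shift z u, coe_shift z v] with x h1 h2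
  rw [h1, h2]

variable {V : ℝ → ℝ} {f : ℝ → ℝ → ℝ}

theorem StepanovBounded.shift (hV : StepanovBounded V) (z : ℝ) :
    StepanovBounded fun x => V (x + z) := by
  refine stepanovBounded_of_norm
    (aemeasurable_shift hV.aesm.aemeasurable z).aestronglyMeasurable ?_
  have := uniformLocalMass_shift (fun x => ‖V x‖ₑ) z
  rw [stepanovNorm, this]
  exact hV.2

theorem formOp_shift (hV : StepanovBounded V) (z : ℝ) (u : H1) :
    formOp (fun x => V (x + z)) (shift z u) = shift z (formOp V u) := by
  refine ext_inner_right ℝ fun v => ?_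
  rw [← shift_shift (by simp : z + -z = 0) v, inner_formOp (hV.shift z), form_shift, inner_shift,
    inner_formOp hV]

theorem Gapped.shift (hV : Gapped V) (z : ℝ) : Gapped fun x => V (x + z) := by
  refine ⟨hV.bdd.shift z, ?_⟩
  rw [ContinuousLinearMap.isUnit_iff_bijective]
  have h := ContinuousLinearMap.isUnit_iff_bijective.1 hV.isUnit
  have e : ⇑(formOp fun x => V (x + z)) = shiftEquiv z ∘ formOp V ∘ (shiftEquiv z).symm := by
    ext1 u
    conv_lhs => rw [← shift_shift (by simp : z + -z = 0) u]
    exact formOp_shift hV.bdd z _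
  rw [e]
  exact (shiftEquiv z).bijective.comp (h.comp (shiftEquiv z).symm.bijective)

theorem IsSpectralSplitting.shift {Ep En : Submodule ℝ H1} (h : IsSpectralSplitting V Ep En)
    (z : ℝ) : IsSpectralSplitting (fun x => V (x + z)) (Ep.map (shiftEquiv z).toLinearMap)
      (En.map (shiftEquiv z).toLinearMap) where
  isCompl := (Submodule.orderIsoMapComap (shiftEquiv z)).isCompl h.isCompl
  orthogonal := by
    rintro _ ⟨u, hu, rfl⟩ _ ⟨v, hv, rfl⟩
    rw [← h.orthogonal u hu v hv]
    exact (shiftL2 z).inner_map_map _ _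
  form_orthogonal := by
    rintro _ ⟨u, hu, rfl⟩ _ ⟨v, hv, rfl⟩
    rw [← h.form_orthogonal u hu v hv]
    exact form_shift V z u v
  pos := by
    rintro _ ⟨u, hu, rfl⟩ h0
    refine (h.pos u hu fun h1 => h0 (by rw [h1, map_zero])).trans_eq ?_
    exact (form_shift V z u u).symm
  neg := by
    rintro _ ⟨u, hu, rfl⟩ h0
    refine (form_shift V z u u).trans_lt (h.neg u hu fun h1 => h0 (by rw [h1, map_zero]))

theorem Gapped.constraintSubspace_shift (hV : Gapped V) (χ z : ℝ) :
    constraintSubspace χ (fun x => V (x + z))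
      = (constraintSubspace χ V).map (shiftEquiv z).toLinearMap := by
  obtain ⟨Ep, En, hs⟩ := hV.exists_splitting
  rw [constraintSubspace, constraintSubspace, hV.negSubspace_eq hs, hV.posSubspace_eq hs,
    (hV.shift z).negSubspace_eq (hs.shift z), (hV.shift z).posSubspace_eq (hs.shift z)]
  split_ifs <;> rfl

theorem IsCaratheodory.shift {g : ℝ → ℝ → ℝ} (hg : IsCaratheodory g) (z : ℝ) :
    IsCaratheodory fun x => g (x + z) :=
  ⟨ae_shift hg.1 z, fun u => aemeasurable_shift (hg.2 u) z⟩

theorem Nonlin.shift (hf : Nonlin f) (z : ℝ) : Nonlin fun x => f (x + z) where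
  contDiff := ae_shift hf.contDiff z
  cara := hf.cara.shift z
  caraU := hf.caraU.shift z
  zero := ae_shift hf.zero z
  bdd R hR := by
    refine lt_of_eq_of_lt ?_ (hf.bdd R hR)
    exact uniformLocalMass_shift (derivSup R (partialU f)) z

theorem energy_shift (χ : ℝ) (V : ℝ → ℝ) (f : ℝ → ℝ → ℝ) (z : ℝ) (u : H1) :
    energy χ (fun x => V (x + z)) (fun x => f (x + z)) (shift z u) = energy χ V f u := by
  rw [energy, energy, form_shift]
  congr 2
  rw [← integral_add_right_eq_self (fun x => primitive f x (u.toL2 x)) z]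
  refine integral_congr_ae ?_
  filter_upwards [coe_shift z u] with x h1
  rw [h1]
  rfl

theorem inner_grad_shift (hV : StepanovBounded V) (hf : Nonlin f) (χ z : ℝ) (u v : H1) :
    ⟪grad χ (fun x => V (x + z)) (fun x => f (x + z)) (shift z u), shift z v⟫
      = ⟪grad χ V f u, v⟫ := by
  rw [grad, grad, inner_sub_left, inner_sub_left, H1.inner_smul_left, H1.inner_smul_left,
    inner_formOp hV, inner_formOp (hV.shift z), form_shift, inner_nlOp hf,
    inner_nlOp (hf.shift z)]
  congr 1
  rw [← integral_add_right_eq_self (fun x => f x (u.toL2 x) * v.toL2 x) z]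
  refine integral_congr_ae ?_
  filter_upwards [coe_shift z u, coe_shift z v] with x h1 h2
  rw [h1, h2]

theorem shift_mem_nehari (hV : Gapped V) (hf : Nonlin f) {χ : ℝ} (hχ : χ = 1 ∨ χ = -1) (z : ℝ)
    {u : H1} (hu : u ∈ nehari χ V f) :
    shift z u ∈ nehari χ (fun x => V (x + z)) (fun x => f (x + z)) := by
  obtain ⟨h1, h2, h3⟩ := (mem_nehari_iff hV.bdd hf hχ u).1 hu
  refine (mem_nehari_iff (hV.bdd.shift z) (hf.shift z) hχ _).2 ⟨fun h0 => h1 ?_, ?_, ?_⟩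
  · rw [← norm_eq_zero, ← norm_shift z, h0, norm_zero]
  · rw [inner_grad_shift hV.bdd hf, h2]
  · rw [hV.constraintSubspace_shift χ z]
    rintro _ ⟨v, hv, rfl⟩
    exact (inner_grad_shift hV.bdd hf χ z u v).trans (h3 v hv)

theorem groundLevel_shift_le (hV : Gapped V) (hf : Nonlin f) {χ : ℝ} (hχ : χ = 1 ∨ χ = -1)
    (z : ℝ) : groundLevel χ (fun x => V (x + z)) (fun x => f (x + z)) ≤ groundLevel χ V f := by
  refine le_iInf₂ fun u hu => ?_
  refine (iInf₂_le (shift z u) (shift_mem_nehari hV hf hχ z hu)).trans_eq ?_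
  rw [energy_shift]

/-- The ground level is invariant under translations. -/
theorem groundLevel_shift (hV : Gapped V) (hf : Nonlin f) {χ : ℝ} (hχ : χ = 1 ∨ χ = -1)
    (z : ℝ) : groundLevel χ (fun x => V (x + z)) (fun x => f (x + z)) = groundLevel χ V f := by
  refine le_antisymm (groundLevel_shift_le hV hf hχ z) ?_
  have h := groundLevel_shift_le (hV.shift z) (hf.shift z) hχ (-z)
  simpa [add_assoc] using h

end Shift

/-! ### Passage of the hypotheses to limits of shifts. -/

section Limits

/-- Nonnegativity passes to limits of translates in the uniform local mass. -/
theorem ae_nonneg_of_limit {a b : ℝ → ℝ} {D : ℕ → ℝ → ℝ≥0∞} {z : ℕ → ℝ} {C : ℝ≥0∞}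
    (hC : C ≠ ⊤) (hb : AEMeasurable b) (ha : ∀ᵐ x, 0 ≤ a x)
    (h : ∀ n, ∀ᵐ x, ‖a (x + z n) - b x‖ₑ ≤ C * D n x)
    (hD : Tendsto (fun n => uniformLocalMass (D n)) atTop (𝓝 0)) : ∀ᵐ x, 0 ≤ b x := by
  -- Where b is negative, nonnegativity of the translate of a forces −b ≤ |a(· + z n) − b|; thus the
  -- negative part of b has mass tending to 0 on each unit interval.
  have h1 (t : ℝ) (n : ℕ) :
      ∫⁻ x in Icc t (t + 1), ENNReal.ofReal (-b x) ≤ C * uniformLocalMass (D n) := by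
    calc ∫⁻ x in Icc t (t + 1), ENNReal.ofReal (-b x)
        ≤ ∫⁻ x in Icc t (t + 1), C * D n x := by
          refine lintegral_mono_ae (ae_restrict_of_ae ?_)
          filter_upwards [h n, ae_shift ha (z n)] with x h2 h3
          refine le_trans ?_ h2
          rw [← ofReal_norm]
          refine ENNReal.ofReal_le_ofReal (le_trans ?_ (le_abs_self _))
          linarith
      _ = C * ∫⁻ x in Icc t (t + 1), D n x := lintegral_const_mul' _ _ hC
      _ ≤ _ := by
          gcongr
          exact le_iSup (fun t => ∫⁻ x in Icc t (t + 1), D n x) t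
  have h2 : Tendsto (fun n => C * uniformLocalMass (D n)) atTop (𝓝 0) := by
    simpa using ENNReal.Tendsto.const_mul hD (Or.inr hC)
  have h3 (t : ℝ) : ∀ᵐ x ∂volume.restrict (Icc t (t + 1)), 0 ≤ b x := by
    have h4 : ∫⁻ x in Icc t (t + 1), ENNReal.ofReal (-b x) = 0 :=
      le_antisymm (ge_of_tendsto' h2 (h1 t)) zero_le
    replace h4 := (lintegral_eq_zero_iff' (f := fun x => ENNReal.ofReal (-b x))
      hb.neg.ennreal_ofReal.restrict).1 h4
    filter_upwards [h4] with x hx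
    have : -b x ≤ 0 := ENNReal.ofReal_eq_zero.1 hx
    linarith
  have h4 : ∀ᵐ x ∂volume.restrict (⋃ k : ℤ, Icc (k : ℝ) (k + 1)), 0 ≤ b x :=
    (ae_restrict_iUnion_iff _ _).2 fun k => h3 k
  rwa [iUnion_Icc_intCast, Measure.restrict_univ] at h4

variable {V W : ℝ → ℝ} {f g : ℝ → ℝ → ℝ} {z : ℕ → ℝ}

/-- Affine inequalities between values of a nonlinearity and of its derivative pass to limits
of translates. -/
theorem Nonlin.affine_limit (hf : Nonlin f) (hg : Nonlin g)
    (hz : ∀ R > 0, Tendsto (fun n => nlDist R (fun x => f (x + z n)) g) atTop (𝓝 0))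
    {α β γ δ u v : ℝ}
    (h : ∀ᵐ x, 0 ≤ α * partialU f x u + β * partialU f x v + γ * f x u + δ) :
    ∀ᵐ x, 0 ≤ α * partialU g x u + β * partialU g x v + γ * g x u + δ := by
  set R := |u| + |v| + 1
  have hu : |u| ≤ R := by have := abs_nonneg v; simp only [R]; linarith
  have hv : |v| ≤ R := by have := abs_nonneg u; simp only [R]; linarith
  refine ae_nonneg_of_limit (z := z) (C := ‖α‖ₑ + ‖β‖ₑ + ‖γ‖ₑ * ‖u‖ₑ)
    (D := fun n => derivSup R fun x u => partialU (fun x => f (x + z n)) x u - partialU g x u)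
    (by finiteness) ?_ h (fun n => ?_) (hz R (by positivity))
  · exact (((((hg.caraU.2 u).const_mul α).add ((hg.caraU.2 v).const_mul β)).add
      ((hg.cara.2 u).const_mul γ)).add_const δ)
  · filter_upwards [(hf.shift (z n)).contDiff, hg.contDiff, (hf.shift (z n)).zero, hg.zero]
      with x h1 h2 h3 h4
    have e1 := enorm_diff_le_derivSup (f := fun x => f (x + z n)) h1 h2 h3 h4 hu
    have e2 := le_derivSup (x := x)
      (g := fun x u => partialU (fun x => f (x + z n)) x u - partialU g x u) (abs_le.1 hu)
    have e3 := le_derivSup (x := x)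
      (g := fun x u => partialU (fun x => f (x + z n)) x u - partialU g x u) (abs_le.1 hv)
    set d := derivSup R (fun x u => partialU (fun x => f (x + z n)) x u - partialU g x u) x
    have e : α * partialU f (x + z n) u + β * partialU f (x + z n) v + γ * f (x + z n) u + δ
        - (α * partialU g x u + β * partialU g x v + γ * g x u + δ)
        = α * (partialU f (x + z n) u - partialU g x u)
          + β * (partialU f (x + z n) v - partialU g x v) + γ * (f (x + z n) u - g x u) := by
      ring
    rw [e]
    calc _ ≤ ‖α‖ₑ * d + ‖β‖ₑ * d + ‖γ‖ₑ * (d * ‖u‖ₑ) := by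
          refine (enorm_add_le _ _).trans (add_le_add ((enorm_add_le _ _).trans
            (add_le_add ?_ ?_)) ?_) <;> rw [enorm_mul]
          · exact mul_le_mul_right e2 _
          · exact mul_le_mul_right e3 _
          · exact mul_le_mul_right e1 _
      _ = _ := by ring

theorem nonneg_of_rat {φ : ℝ → ℝ} (hφ : Continuous φ) (h : ∀ q : ℚ, 0 ≤ φ q) (u : ℝ) :
    0 ≤ φ u :=
  Rat.denseRange_cast.induction_on (p := fun u => 0 ≤ φ u) u
    (isClosed_le continuous_const hφ) h

theorem partialU_nonneg (h0 : ∀ᵐ x, partialU f x 0 = 0)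
    (hgr : ∃ θ : ℝ, 0 < θ ∧ θ < 1 ∧ ∀ᵐ x, ∀ u : ℝ, u ≠ 0 →
      0 < f x u * u ∧ f x u * u ≤ θ * (partialU f x u * u ^ 2)) :
    ∀ᵐ x, ∀ u, 0 ≤ partialU f x u := by
  obtain ⟨θ, hθ, -, hgr⟩ := hgr
  filter_upwards [hgr, h0] with x h1 h0 u
  by_cases hu : u = 0
  · rw [hu, h0]
  · obtain ⟨h2, h3⟩ := h1 u hu
    have h4 : 0 < u ^ 2 := by positivity
    by_contra hc
    have := mul_pos_of_neg_of_neg (not_le.1 hc) (neg_lt_zero.2 h4)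
    nlinarith

/-- A rational strictly between 0 and u transports the strict sign, which continuity alone would
weaken to ≥. -/
theorem mul_pos_of_monotone {φ : ℝ → ℝ} (hφ : Monotone φ) (h : ∀ q : ℚ, q ≠ 0 → 0 < φ q * q)
    {u : ℝ} (hu : u ≠ 0) : 0 < φ u * u := by
  rcases hu.lt_or_gt with h0 | h0
  · obtain ⟨q, h1, h2⟩ := exists_rat_btwn h0
    have h3 : (q : ℝ) ≠ 0 := h2.ne
    refine mul_pos_of_neg_of_neg ((hφ h1.le).trans_lt ?_) h0
    exact neg_of_mul_pos_left (h q (by exact_mod_cast h3)) h2.le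
  · obtain ⟨q, h1, h2⟩ := exists_rat_btwn h0
    have h3 : (q : ℝ) ≠ 0 := h1.ne'
    exact mul_pos ((pos_of_mul_pos_left (h q (by exact_mod_cast h3)) h1.le).trans_le (hφ h2.le)) h0

/-- At fixed u each condition is made of affine inequalities in f and f_u, stable under limits.
Countably many rational u share one null set and continuity fills in the rest; the strict sign
survives because of the lower bounds uniform in x. -/
theorem Superlin.limit (hs : Superlin f) (hf : Nonlin f) (hg : Nonlin g)
    (hz : ∀ R > 0, Tendsto (fun n => nlDist R (fun x => f (x + z n)) g) atTop (𝓝 0)) :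
    Superlin g := by
  have lower (u : ℝ) (hu : u ≠ 0) : ∃ c > 0, ∀ᵐ x, c ≤ g x u * u := by
    obtain ⟨c, hc, h⟩ := hs.lower u hu
    refine ⟨c, hc, ?_⟩
    have h1 := hf.affine_limit hg hz (α := 0) (β := 0) (γ := u) (δ := -c) (u := u) (v := 0) (by
      filter_upwards [h] with x hx
      linarith)
    filter_upwards [h1] with x hx
    linarith
  have hU : ∀ᵐ x, ∀ q : ℚ, 0 ≤ partialU g x q := ae_all_iff.2 fun q => by
    have h1 := hf.affine_limit hg hz (α := 1) (β := 0) (γ := 0) (δ := 0) (u := q) (v := 0) (by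
      filter_upwards [partialU_nonneg hs.zeroU hs.growth] with x hx
      linarith [hx q])
    filter_upwards [h1] with x hx
    linarith
  refine ⟨?_, fun R hR => ?_, ?_, lower⟩
  · have h1 := hf.affine_limit hg hz (α := 1) (β := 0) (γ := 0) (δ := 0) (u := 0) (v := 0) (by
      filter_upwards [hs.zeroU] with x hx
      rw [hx]; simp)
    have h2 := hf.affine_limit hg hz (α := -1) (β := 0) (γ := 0) (δ := 0) (u := 0) (v := 0) (by
      filter_upwards [hs.zeroU] with x hx
      rw [hx]; simp)
    filter_upwards [h1, h2] with x h3 h4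
    linarith
  -- The approximating rationals increase to u and v and may start outside [−R, R]; the radius R + 1
  -- leaves room for them.
  · obtain ⟨μ, hμ, h⟩ := hs.lip (R + 1) (by positivity)
    refine ⟨μ, hμ, ?_⟩
    have h1 : ∀ᵐ x, ∀ p q : ℚ, |(p : ℝ)| ≤ R + 1 → |(q : ℝ)| ≤ R + 1 →
        partialU g x p - partialU g x q ≤ μ * |(p : ℝ) - q| := by
      refine ae_all_iff.2 fun p => ae_all_iff.2 fun q => ?_
      by_cases hp : |(p : ℝ)| ≤ R + 1
      · by_cases hq : |(q : ℝ)| ≤ R + 1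
        · have h2 := hf.affine_limit hg hz (α := -1) (β := 1) (γ := 0) (δ := μ * |(p : ℝ) - q|)
            (u := p) (v := q) (by
              filter_upwards [h] with x hx
              have := (abs_le.1 (hx p q hp hq)).2
              linarith)
          filter_upwards [h2] with x hx _ _
          linarith
        · exact Eventually.of_forall fun x _ h => absurd h hq
      · exact Eventually.of_forall fun x h => absurd h hp
    filter_upwards [h1, hg.caraU.1] with x hx hc u v hu hv
    have key (u v : ℝ) (hu : |u| ≤ R) (hv : |v| ≤ R) :
        partialU g x u - partialU g x v ≤ μ * |u - v| := by
      obtain ⟨a, -, -, ha⟩ := Real.exists_seq_rat_strictMono_tendsto u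
      obtain ⟨b, -, -, hb⟩ := Real.exists_seq_rat_strictMono_tendsto v
      have ha' : ∀ᶠ n in atTop, |((a n : ℚ) : ℝ)| ≤ R + 1 :=
        (ha.abs.eventually_lt_const (by linarith)).mono fun n h => h.le
      have hb' : ∀ᶠ n in atTop, |((b n : ℚ) : ℝ)| ≤ R + 1 :=
        (hb.abs.eventually_lt_const (by linarith)).mono fun n h => h.le
      refine le_of_tendsto_of_tendsto (((hc.tendsto u).comp ha).sub ((hc.tendsto v).comp hb))
        ((ha.sub hb).abs.const_mul μ) ?_
      filter_upwards [ha', hb'] with n h1 h2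
      exact hx _ _ h1 h2
    refine abs_le.2 ⟨?_, key u v hu hv⟩
    have := key v u hv hu
    rw [abs_sub_comm] at this
    linarith
  · obtain ⟨θ, hθ, hθ1, hgr⟩ := hs.growth
    refine ⟨θ, hθ, hθ1, ?_⟩
    have h1 : ∀ᵐ x, ∀ q : ℚ, 0 ≤ θ * (partialU g x q * (q : ℝ) ^ 2) - g x q * q := by
      refine ae_all_iff.2 fun q => ?_
      have h2 := hf.affine_limit hg hz (α := θ * (q : ℝ) ^ 2) (β := 0) (γ := -q) (δ := 0)
        (u := q) (v := 0) (by
          filter_upwards [hgr, hf.zero] with x hx h0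
          by_cases hq : (q : ℝ) = 0
          · simp [hq]
          · linarith [(hx q hq).2])
      filter_upwards [h2] with x hx
      linarith
    have h2 : ∀ᵐ x, ∀ q : ℚ, q ≠ 0 → 0 < g x q * q := by
      refine ae_all_iff.2 fun q => ?_
      by_cases hq : q = 0
      · exact Eventually.of_forall fun x h => absurd hq h
      · obtain ⟨c, hc, h⟩ := lower q (by exact_mod_cast hq)
        filter_upwards [h] with x hx _
        exact hc.trans_le hx
    filter_upwards [h1, h2, hU, hg.contDiff, hg.caraU.1] with x h3 h4 h5 h6 h7 u hu
    have h8 := nonneg_of_rat h7 h5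
    refine ⟨mul_pos_of_monotone
      (monotone_of_deriv_nonneg (h6.differentiable (by simp)) h8) h4 hu, ?_⟩
    have h6' := h6.continuous
    have := nonneg_of_rat (φ := fun u => θ * (partialU g x u * u ^ 2) - g x u * u)
      (by fun_prop) h3 u
    linarith

theorem tendsto_formOp_shift (hV : StepanovBounded V) (hW : StepanovBounded W)
    (hz : Tendsto (fun n => stepanovNorm fun x => V (x + z n) - W x) atTop (𝓝 0)) :
    Tendsto (fun n => formOp fun x => V (x + z n)) atTop (𝓝 (formOp W)) := by
  refine (tendsto_iff_norm_sub_tendsto_zero (E := H1 →L[ℝ] H1)).2 ?_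
  have h : Tendsto (fun n => 4 * (stepanovNorm fun x => V (x + z n) - W x).toReal) atTop (𝓝 0) := by
    simpa using ((ENNReal.tendsto_toReal ENNReal.zero_ne_top).comp hz).const_mul 4
  exact squeeze_zero (fun n => norm_nonneg (E := H1 →L[ℝ] H1) _) (fun n => norm_formOp_sub_le (hV.shift _) hW) h

/-- Translations act isometrically and conjugate the form operators into each other, so all shifts
share the lower bound c. It passes to the limit, where symmetry makes the square coercive and hence
the operator invertible. -/
theorem Gapped.limit (hV : Gapped V) (hW : StepanovBounded W)
    (hz : Tendsto (fun n => stepanovNorm fun x => V (x + z n) - W x) atTop (𝓝 0)) :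
    Gapped W := by
  refine ⟨hW, ?_⟩
  obtain ⟨U, hU⟩ := hV.isUnit
  set c := 1 / (‖(U⁻¹ : (H1 →L[ℝ] H1)ˣ).val‖ + 1)
  have hc : 0 < c := by positivity
  have h1 (u : H1) : c * ‖u‖ ≤ ‖formOp V u‖ := by
    have h2 : (U⁻¹ : (H1 →L[ℝ] H1)ˣ).val (formOp V u) = u := by
      rw [← hU]
      exact apply_of_mul_eq U.inv_mul u
    have h3 := (U⁻¹ : (H1 →L[ℝ] H1)ˣ).val.le_opNorm (formOp V u)
    rw [h2] at h3
    simp only [c]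
    rw [one_div, inv_mul_le_iff₀ (by positivity)]
    linarith [norm_nonneg (formOp V u)]
  have h2 (u : H1) : c * ‖u‖ ≤ ‖formOp W u‖ := by
    have h3 : Tendsto (fun n => formOp (fun x => V (x + z n)) u) atTop (𝓝 (formOp W u)) :=
      ((ContinuousLinearMap.apply ℝ H1 u).continuous.tendsto _).comp
        (tendsto_formOp_shift hV.bdd hW hz)
    refine ge_of_tendsto' h3.norm fun n => ?_
    have h4 := h1 (NLS.shift (-z n) u)
    rwa [norm_shift, ← norm_shift (z n) (formOp V _), ← formOp_shift hV.bdd,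
      shift_shift (by simp)] at h4
  have h3 : LowerBd (c ^ 2) (formOp W * formOp W) := fun u => by
    rw [mul_apply_eq_comp, symm_formOp hW, real_inner_self_eq_norm_sq, ← mul_pow]
    exact pow_le_pow_left₀ (by positivity) (h2 u) 2
  exact ((Commute.refl (formOp W)).isUnit_mul_iff.1 (isUnit_of_lowerBd (by positivity) h3)).1

end Limits

/-! ### Approximation of Nehari points and semicontinuity of the ground level. -/

section GroundLevel

variable {V W : ℝ → ℝ} {f g : ℝ → ℝ → ℝ} {z : ℕ → ℝ}

theorem tendsto_toReal_zero {a : ℕ → ℝ≥0∞} (h : Tendsto a atTop (𝓝 0)) :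
    Tendsto (fun n => (a n).toReal) atTop (𝓝 0) := by
  have h1 := (ENNReal.tendsto_toReal ENNReal.zero_ne_top).comp h
  rwa [ENNReal.toReal_zero] at h1

theorem tendsto_op_add_const {H : Type*} [NormedAddCommGroup H] [InnerProductSpace ℝ H]
    {T : ℕ → H →L[ℝ] H} {S : H →L[ℝ] H} (h : Tendsto T atTop (𝓝 S)) (B : H →L[ℝ] H) :
    Tendsto (fun n => T n + B) atTop (𝓝 (S + B)) :=
  h.add_const B

/-- A single K serves the limit and all late shifts, so that their pencils differ only through the
form operators and converge. -/
theorem eventually_coerciveShift {T : ℕ → ℝ → ℝ} {K : ℝ} (hK : 0 < K)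
    (hW : LowerBd (1 / 2) (formOp W + K • l2Op))
    (hT : Tendsto (fun n => ‖formOp (T n) - formOp W‖) atTop (𝓝 0)) :
    ∀ᶠ n in atTop, CoerciveShift (T n) K := by
  filter_upwards [hT.eventually_lt_const (by norm_num : (0 : ℝ) < 1 / 4)] with n hn
  refine ⟨hK, 1 / 4, by norm_num, fun u => ?_⟩
  have h1 := hW u
  have h2 := inner_le_norm_op (formOp W - formOp (T n)) u
  rw [show ‖formOp W - formOp (T n)‖ = ‖formOp (T n) - formOp W‖ from
    norm_sub_rev (E := H1 →L[ℝ] H1) _ _] at h2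
  have h3 : ‖formOp (T n) - formOp W‖ * ‖u‖ ^ 2 ≤ 1 / 4 * ‖u‖ ^ 2 := by gcongr
  simp only [add_apply, sub_apply, inner_add_left, inner_sub_left] at h1 h2 ⊢
  linarith

theorem abs_energy_sub_le (hV : StepanovBounded V) (hW : StepanovBounded W) (hf : Nonlin f)
    (hg : Nonlin g) {χ : ℝ} (hχ : |χ| = 1) {R : ℝ} {a : H1} (ha : 2 * ‖a‖ ≤ R)
    (hd : nlDist R f g < ⊤) :
    |energy χ V f a - energy χ W g a|
      ≤ (‖formOp V - formOp W‖ + 4 * (nlDist R f g).toReal) * ‖a‖ ^ 2 := by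
  have e : energy χ V f a - energy χ W g a = 1 / 2 * ⟪(formOp V - formOp W) a, a⟫
      - χ * ((∫ x, primitive f x (a.toL2 x)) - ∫ x, primitive g x (a.toL2 x)) := by
    rw [energy_eq hV, energy_eq hW, sub_apply, inner_sub_left]
    ring
  have h1 : |⟪(formOp V - formOp W) a, a⟫| ≤ ‖formOp V - formOp W‖ * ‖a‖ * ‖a‖ :=
    (abs_real_inner_le_norm _ _).trans (by gcongr; exact (formOp V - formOp W).le_opNorm a)
  have h2 := hf.integral_primitive_diff hg ha hd
  have h3 := abs_nonneg ⟪(formOp V - formOp W) a, a⟫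
  rw [e]
  refine (abs_sub _ _).trans ?_
  rw [abs_mul, abs_mul, hχ, one_mul, abs_of_pos (by norm_num : (0 : ℝ) < 1 / 2)]
  linarith

theorem norm_grad_sub_le {χ : ℝ} (hχ : |χ| = 1) (hf : Nonlin f) {R : ℝ} (hR : 0 < R) {a b : H1}
    (ha : 2 * ‖a‖ ≤ R) (hb : 2 * ‖b‖ ≤ R) : ‖grad χ V f a - grad χ V f b‖
      ≤ (‖formOp V‖ + 4 * (stepanovSeminorm R (partialU f)).toReal) * ‖a - b‖ := by
  have e : grad χ V f a - grad χ V f b = χ • formOp V (a - b) - (nlOp f a - nlOp f b) := by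
    rw [grad, grad, map_sub]
    module
  have h1 : ‖χ • formOp V (a - b)‖ ≤ ‖formOp V‖ * ‖a - b‖ := by
    rw [norm_smul, Real.norm_eq_abs, hχ, one_mul]
    exact (formOp V).le_opNorm _
  rw [e, add_mul]
  exact (norm_sub_le _ _).trans (add_le_add h1 (hf.norm_nlOp_sub_le hR ha hb))

theorem norm_grad_diff_le {χ : ℝ} (hχ : |χ| = 1) (hf : Nonlin f) (hg : Nonlin g) {R : ℝ} {u : H1}
    (hu : 2 * ‖u‖ ≤ R) (hd : nlDist R f g < ⊤) : ‖grad χ V f u - grad χ W g u‖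
      ≤ (‖formOp V - formOp W‖ + 4 * (nlDist R f g).toReal) * ‖u‖ := by
  have e : grad χ V f u - grad χ W g u = χ • (formOp V - formOp W) u - (nlOp f u - nlOp g u) := by
    rw [grad, grad, sub_apply]
    module
  have h1 : ‖χ • (formOp V - formOp W) u‖ ≤ ‖formOp V - formOp W‖ * ‖u‖ := by
    rw [norm_smul, Real.norm_eq_abs, hχ, one_mul]
    exact (formOp V - formOp W).le_opNorm _
  rw [e, add_mul]
  exact (norm_sub_le _ _).trans (add_le_add h1 (hf.norm_nlOp_diff_le hg hu hd))

theorem inner_grad_linearization_le {χ : ℝ} (hχ : |χ| = 1) (hf : Nonlin f) (hg : Nonlin g)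
    {R μ r : ℝ} (hμ : 0 ≤ μ) (hLip : ∀ᵐ x, ∀ u v : ℝ, |u| ≤ R → |v| ≤ R →
      |partialU g x u - partialU g x v| ≤ μ * |u - v|)
    {a b u : H1} (ha : 2 * ‖a‖ ≤ R) (hb : 2 * ‖b‖ ≤ R) (hu : 2 * ‖u‖ ≤ R)
    (har : ‖a - u‖ ≤ r) (hbr : ‖b - u‖ ≤ r) (hd : nlDist R f g < ⊤) :
    ⟪grad χ V f a - grad χ V f b - (χ • formOp W - nlDeriv g u) (a - b), a - b⟫
      ≤ (‖formOp V - formOp W‖ + 4 * (nlDist R f g).toReal + 8 * μ * r) * ‖a - b‖ ^ 2 := by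
  have e : grad χ V f a - grad χ V f b - (χ • formOp W - nlDeriv g u) (a - b)
      = χ • (formOp V - formOp W) (a - b)
        - (nlOp f a - nlOp f b - nlDeriv g u (a - b)) := by
    simp only [grad, sub_apply, smul_apply, map_sub]
    module
  have h1 : |χ * ⟪(formOp V - formOp W) (a - b), a - b⟫|
      ≤ ‖formOp V - formOp W‖ * ‖a - b‖ * ‖a - b‖ := by
    rw [abs_mul, hχ, one_mul]
    exact (abs_real_inner_le_norm _ _).trans
      (by gcongr; exact (formOp V - formOp W).le_opNorm _)
  have h2 := hf.inner_linearization_le hg hμ hLip hb ha hu hbr har hd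
  rw [e, inner_sub_left, H1.inner_smul_left]
  linarith [(abs_le.1 h1).2, (abs_le.1 h2).1]

/-- Points of the Nehari manifold of a limit are approximated by points of the Nehari manifolds
of the translates. -/
theorem eventually_exists_mem_nehari (hV : Gapped V) (hf : Nonlin f) (hW : Gapped W)
    (hg : Nonlin g) (hs : Superlin g)
    (hzV : Tendsto (fun n => stepanovNorm fun x => V (x + z n) - W x) atTop (𝓝 0))
    (hzf : ∀ R > 0, Tendsto (fun n => nlDist R (fun x => f (x + z n)) g) atTop (𝓝 0))
    {χ : ℝ} (hχ : χ = 1 ∨ χ = -1) {u : H1} (hu : u ∈ nehari χ W g) {ρ : ℝ} (hρ : 0 < ρ) :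
    ∀ᶠ n in atTop, ∃ a ∈ nehari χ (fun x => V (x + z n)) (fun x => f (x + z n)),
      ‖a - u‖ ≤ ρ := by
  have hχ1 : |χ| = 1 := by rcases hχ with rfl | rfl <;> simp
  set T : ℕ → H1 →L[ℝ] H1 := fun n => formOp fun x => V (x + z n)
  have hT : Tendsto T atTop (𝓝 (formOp W)) := tendsto_formOp_shift hV.bdd hW.bdd hzV
  have hT0 : Tendsto (fun n => ‖T n - formOp W‖) atTop (𝓝 0) :=
    (tendsto_iff_norm_sub_tendsto_zero (E := H1 →L[ℝ] H1)).1 hT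
  obtain ⟨K, hK, hKW⟩ := exists_garding hW.bdd
  have hKn := eventually_coerciveShift hK hKW hT0
  have hKW' : CoerciveShift W K := ⟨hK, _, by norm_num, hKW⟩
  set P : ℕ → H1 →L[ℝ] H1 := fun n => negProj (T n + K • l2Op) (χ • T n)
  have hPW := hW.pencil hKW' hχ
  have hP : Tendsto P atTop (𝓝 (negProj (formOp W + K • l2Op) (χ • formOp W))) :=
    tendsto_negProj hPW (hKn.mono fun n hn => (hV.shift (z n)).pencil hn hχ)
      (tendsto_op_add_const hT _) (hT.const_smul χ)
  obtain ⟨hu0, huu, huv⟩ := (mem_nehari_iff hW.bdd hg hχ u).1 hu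
  rw [hW.constraintSubspace_eq hKW' hχ] at huv
  obtain ⟨δ, hδ, hD⟩ := exists_hessian_negDef hW hg hs hKW' hχ hu
  set R := 2 * (‖u‖ + 1)
  have hR : 0 < R := by positivity
  have huR : 2 * ‖u‖ ≤ R := by simp only [R]; linarith
  have hball {a : H1} (h : ‖a - u‖ ≤ 1) : 2 * ‖a‖ ≤ R := by
    have := norm_le_norm_add_norm_sub' a u
    simp only [R]; linarith
  obtain ⟨μ, hμ, hLip⟩ := hs.lip R hR
  set d : ℕ → ℝ≥0∞ := fun n => nlDist R (fun x => f (x + z n)) g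
  have hd : ∀ᶠ n in atTop, d n < ⊤ := (hzf R hR).eventually_lt_const ENNReal.zero_lt_top
  have hε : Tendsto (fun n => ‖T n - formOp W‖ + 4 * (d n).toReal) atTop (𝓝 0) := by
    simpa using hT0.add ((tendsto_toReal_zero (hzf R hR)).const_mul 4)
  set G : ℕ → H1 → H1 := fun n => grad χ (fun x => V (x + z n)) fun x => f (x + z n)
  have hG : Tendsto (fun n => G n u) atTop (𝓝 (grad χ W g u)) := by
    refine tendsto_iff_norm_sub_tendsto_zero.2 ?_
    have h0 : Tendsto (fun n => (‖T n - formOp W‖ + 4 * (d n).toReal) * ‖u‖) atTop (𝓝 0) := by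
      simpa using hε.mul_const ‖u‖
    refine squeeze_zero' (Eventually.of_forall fun n => norm_nonneg _) ?_ h0
    filter_upwards [hd] with n hn
    exact norm_grad_diff_le hχ1 (hf.shift (z n)) hg huR hn
  have hM (n : ℕ) : stepanovSeminorm R (partialU fun x => f (x + z n))
      = stepanovSeminorm R (partialU f) := uniformLocalMass_shift (derivSup R (partialU f)) (z n)
  -- The radius is at most ‖u‖/2, which keeps the point found away from 0.
  have key := exists_constrained_zero (P := P) (G := G) (g₀ := grad χ W g u) (u := u)
    (D := χ • formOp W - nlDeriv g u) (hPW.negProj_negProj) hP hδ hD huu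
    (fun v hv => huv v (mem_pencilNeg.2 hv)) hG
    (Λ := ‖formOp W‖ + 1 + 4 * (stepanovSeminorm R (partialU f)).toReal)
    (C := 8 * μ) one_pos (by positivity) hε ?_ ?_ (lt_min hρ (half_pos (norm_pos_iff.2 hu0)))
  · filter_upwards [key, hKn] with n ⟨a, h1, h2, h3⟩ hn
    refine ⟨a, (mem_nehari_iff (hV.shift (z n)).bdd (hf.shift (z n)) hχ a).2
      ⟨?_, h2, fun v hv => h3 v ?_⟩, h1.trans (min_le_left _ _)⟩
    · rintro rfl
      rw [zero_sub, norm_neg] at h1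
      have h4 := h1.trans (min_le_right _ _)
      have h5 := norm_pos_iff.2 hu0
      linarith
    · rw [(hV.shift (z n)).constraintSubspace_eq hn hχ] at hv
      exact mem_pencilNeg.1 hv
  · filter_upwards [hT0.eventually_lt_const one_pos] with n hn a b ha hb
    refine (norm_grad_sub_le hχ1 (hf.shift (z n)) hR (hball ha) (hball hb)).trans ?_
    rw [hM]
    have : ‖T n‖ ≤ ‖formOp W‖ + 1 := by
      have := norm_le_norm_add_norm_sub' (T n) (formOp W)
      linarith
    gcongr
  · filter_upwards [hd] with n hn r hr a b ha hb
    exact inner_grad_linearization_le hχ1 (hf.shift (z n)) hg hμ.le hLip (hball (ha.trans hr))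
      (hball (hb.trans hr)) huR ha hb hn

/-- If u had energy below m, take a real c strictly between. Half of the gap η pays for the change
of functional and half for moving from u to a, so a point of a shifted manifold has energy at most c
< m, contradicting translation invariance. -/
theorem groundLevel_le_of_limit (hV : Gapped V) (hf : Nonlin f) (hW : Gapped W)
    (hg : Nonlin g) (hs : Superlin g)
    (hzV : Tendsto (fun n => stepanovNorm fun x => V (x + z n) - W x) atTop (𝓝 0))
    (hzf : ∀ R > 0, Tendsto (fun n => nlDist R (fun x => f (x + z n)) g) atTop (𝓝 0))
    {χ : ℝ} (hχ : χ = 1 ∨ χ = -1) : groundLevel χ V f ≤ groundLevel χ W g := by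
  have hχ1 : |χ| = 1 := by rcases hχ with rfl | rfl <;> simp
  refine le_iInf₂ fun u hu => ?_
  by_contra hc
  obtain ⟨c, hc1, hc2⟩ := EReal.lt_iff_exists_real_btwn.1 (not_le.1 hc)
  have hη : 0 < c - χ * energy χ W g u := sub_pos.2 (EReal.coe_lt_coe_iff.1 hc1)
  set η := c - χ * energy χ W g u
  obtain ⟨ρ, hρ, hcont⟩ := Metric.continuousAt_iff.1
    (hasFDerivAt_energy hW.bdd hg χ u).continuousAt (η / 2) (half_pos hη)
  set R := 2 * (‖u‖ + 1)
  have hR : 0 < R := by positivity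
  set d : ℕ → ℝ≥0∞ := fun n => nlDist R (fun x => f (x + z n)) g
  have hd : ∀ᶠ n in atTop, d n < ⊤ := (hzf R hR).eventually_lt_const ENNReal.zero_lt_top
  have hT0 : Tendsto (fun n => ‖formOp (fun x => V (x + z n)) - formOp W‖) atTop (𝓝 0) :=
    (tendsto_iff_norm_sub_tendsto_zero (E := H1 →L[ℝ] H1)).1
      (tendsto_formOp_shift hV.bdd hW.bdd hzV)
  have hε : Tendsto (fun n => (‖formOp (fun x => V (x + z n)) - formOp W‖ + 4 * (d n).toReal)
      * (‖u‖ + 1) ^ 2) atTop (𝓝 0) := by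
    simpa using (hT0.add ((tendsto_toReal_zero (hzf R hR)).const_mul 4)).mul_const
      ((‖u‖ + 1) ^ 2)
  obtain ⟨n, ⟨a, ha, hau⟩, hn, hεn⟩ := ((eventually_exists_mem_nehari hV hf hW hg hs hzV hzf hχ hu
    (lt_min (half_pos hρ) one_pos)).and (hd.and (hε.eventually_lt_const (half_pos hη)))).exists
  have h1 : ‖a‖ ≤ ‖u‖ + 1 := by
    have := norm_le_norm_add_norm_sub' a u
    linarith [hau.trans (min_le_right _ _)]
  have h2 := abs_energy_sub_le (hV.shift (z n)).bdd hW.bdd (hf.shift (z n)) hg hχ1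
    (by simp only [R]; linarith : 2 * ‖a‖ ≤ R) hn
  have h3 : |energy χ (fun x => V (x + z n)) (fun x => f (x + z n)) a - energy χ W g a| < η / 2 := by
    refine (h2.trans ?_).trans_lt hεn
    gcongr
  have h4 : |energy χ W g a - energy χ W g u| < η / 2 := by
    refine hcont ?_
    rw [dist_eq_norm]
    linarith [hau.trans (min_le_left _ _)]
  have h5 : χ * energy χ (fun x => V (x + z n)) (fun x => f (x + z n)) a ≤ c := by
    have e : c = χ * energy χ W g u + η := by simp only [η]; ring
    have h6 := abs_lt.1 h3
    have h7 := abs_lt.1 h4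
    rcases hχ with rfl | rfl <;> linarith [h6.1, h6.2, h7.1, h7.2]
  refine hc2.not_ge ?_
  rw [← groundLevel_shift hV hf hχ (z n)]
  exact (iInf₂_le a ha).trans (EReal.coe_le_coe_iff.2 h5)

end GroundLevel

/-! ### Symmetry of the limit relation and the conclusion. -/

section Envelope

variable {V W : ℝ → ℝ} {f g : ℝ → ℝ → ℝ}

theorem InEnvelope.nonlin (h : InEnvelope V f W g) : Nonlin g :=
  ⟨h.contDiff, h.measurable, h.measurable_partialU, h.map_zero, h.bounded⟩

/-- Translating the whole difference by z does not change the norm and moves the shift from one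
function to the other; so being a limit of shifts is symmetric. -/
theorem stepanovNorm_shift_rev (V W : ℝ → ℝ) (z : ℝ) :
    (stepanovNorm fun x => W (x + -z) - V x) = stepanovNorm fun x => V (x + z) - W x := by
  rw [stepanovNorm, ← uniformLocalMass_shift _ z]
  simp only [add_neg_cancel_right]
  simp only [enorm_sub_rev (W _)]
  rfl

theorem nlDist_shift_rev (R : ℝ) (f g : ℝ → ℝ → ℝ) (z : ℝ) :
    nlDist R (fun x => g (x + -z)) f = nlDist R (fun x => f (x + z)) g := by
  rw [nlDist, stepanovSeminorm, ← uniformLocalMass_shift _ z]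
  simp only [partialU, add_neg_cancel_right]
  simp only [enorm_sub_rev (deriv (g _) _)]
  rfl

/-- Positivity of the primitive and monotonicity give a lower bound for `f(x,u)u`. -/
theorem primitive_le_mul {f : ℝ → ℝ → ℝ} {x : ℝ} (hc : Continuous (f x))
    (hm : Monotone (f x)) (u : ℝ) :
    primitive f x u ≤ f x u * u := by
  obtain ⟨ξ, hξ, he⟩ := exists_mvt (fun v => (hasDerivAt_primitive hc v).differentiableAt) 0 u
  rw [(hasDerivAt_primitive hc ξ).deriv] at he
  simp only [primitive, intervalIntegral.integral_same, sub_zero] at he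
  rw [primitive, he]
  rcases le_total 0 u with h | h
  · rw [uIcc_of_le h] at hξ
    exact mul_le_mul_of_nonneg_right (hm hξ.2) h
  · rw [uIcc_of_ge h] at hξ
    exact mul_le_mul_of_nonpos_right (hm hξ.1) h

end Envelope

end NLS

end

theorem proposition4p3 (χ : ℝ) (V : ℝ → ℝ) (f : ℝ → ℝ → ℝ)
    (hχ : χ = 1 ∨ χ = -1)
    -- assumption on the potential
    (hV : NLS.StepanovAP V)
    (hgap : (0 : ℝ) ∉ NLS.spectrum V)
    (hneg : χ = -1 → ∃ r ∈ NLS.spectrum V, r < 0)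
    -- regularity and almost periodicity of the nonlinearity
    (hf : ∀ᵐ x, ContDiff ℝ 1 (f x))
    (hFap : NLS.StrictlyStepanovAP (NLS.primitive f))
    (hfap : NLS.StrictlyStepanovAP f)
    (hfuap : NLS.StrictlyStepanovAP (NLS.partialU f))
    (hFpos : ∀ u : ℝ, u ≠ 0 → ∃ c > 0, ∀ᵐ x, c ≤ NLS.primitive f x u)
    -- behaviour at zero and local Lipschitz continuity of the derivative
    (hf0 : ∀ᵐ x, f x 0 = 0 ∧ NLS.partialU f x 0 = 0)
    (hLip : ∀ R > 0, ∃ μ > 0, ∀ᵐ x, ∀ u v : ℝ, |u| ≤ R → |v| ≤ R →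
      |NLS.partialU f x u - NLS.partialU f x v| ≤ μ * |u - v|)
    -- superlinearity
    (hθ : ∃ θ : ℝ, 0 < θ ∧ θ < 1 ∧ ∀ᵐ x, ∀ u : ℝ, u ≠ 0 →
      0 < f x u * u ∧ f x u * u ≤ θ * (NLS.partialU f x u * u ^ 2))
    (W : ℝ → ℝ) (g : ℝ → ℝ → ℝ) (hWg : NLS.InEnvelope V f W g) :
    NLS.groundLevel χ W g = NLS.groundLevel χ V f := by
  have hfN : NLS.Nonlin f :=
    ⟨hf, hfap.1, hfuap.1, hf0.mono fun x h => h.1, hfuap.2.1⟩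
  have hVG : NLS.Gapped V := ⟨hV.1, NLS.isUnit_formOp hV.1 hgap⟩
  have hfU : ∀ᵐ x, ∀ u, 0 ≤ NLS.partialU f x u :=
    NLS.partialU_nonneg (hf0.mono fun x h => h.2) hθ
  have hfS : NLS.Superlin f := by
    -- f_u ≥ 0 makes f nondecreasing in u, so F ≤ f u, and the lower bound for F gives the one for f
    -- u that has to survive limits.
    refine ⟨hf0.mono fun x h => h.2, hLip, hθ, fun u hu => ?_⟩
    obtain ⟨c, hc, h⟩ := hFpos u hu
    refine ⟨c, hc, ?_⟩
    filter_upwards [h, hf, hfU] with x h1 h2 h4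
    exact h1.trans (NLS.primitive_le_mul h2.continuous
      (monotone_of_deriv_nonneg (h2.differentiable (by simp)) h4) u)
  have hgN := hWg.nonlin
  obtain ⟨z, hzV, hzf⟩ := hWg.limit
  have hWG := hVG.limit hWg.potential hzV
  have hgS := hfS.limit hfN hgN hzf
  -- The first inequality treats (V, f) as the limit of (W, g) shifted by −z n, the second uses the
  -- given shifts.
  refine le_antisymm (NLS.groundLevel_le_of_limit (z := fun n => -z n) hWG hgN hVG hfN hfS
    ?_ (fun R hR => ?_) hχ) (NLS.groundLevel_le_of_limit hVG hfN hWG hgN hgS hzV hzf hχ)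
  · simpa only [NLS.stepanovNorm_shift_rev] using hzV
  · simp only [NLS.nlDist_shift_rev]
    exact hzf R hR
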